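/- Let $\phi: S^2\to(0,\infty)$ be smooth and let $\mathcal K=\{r\omega:\ \omega\in S^2,\ 0\le r\le\phi(\omega)\}\subset\mathbb R^3$, $\partial\mathcal K=\{\phi(\omega)\omega:\omega\in S^2\}$, be the corresponding strictly star-shaped obstacle. Let $g$ be the standard metric of $S^3\subset\mathbb R^4$ and let $\mathcal P:\mathbb R\times\mathbb R^3\to(-\pi,\pi)\times S^3$ be the Penrose map $\mathcal P(t,r\omega)=(T,(\cos R,(\sin R)\,\omega))$ with $T=\arctan(t+r)+\arctan(t-r)$, $R=\arctan(t+r)-\arctan(t-r)$. Put $$Y=\big([0,\pi)\times S^3\big)\setminus\mathcal P\big([0,\infty)\times\mathcal K\big),\qquad \partial Y=\mathcal P\big([0,\infty)\times\partial\mathcal K\big),\qquad Y_T=\{X\in S^3:(T,X)\in Y\}.$$ Let $\eta=dT^2-g$, let $\nabla$ be the Levi-Civita connection of the Riemannian metric $dT^2+g$, and for a Lorentzian metric $h$ let $\square_h u=|h|^{-1/2}\sum_{j,k=0}^3\partial_j\big(h^{jk}|h|^{1/2}\partial_k u\big)$ in local coordinates, where $(h^{jk})=(h_{jk})^{-1}$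 and $|h|=|\det(h_{jk})|$. Write $|u'|^2=|\partial_Tu|^2+\sum_{j,k=1}^3g^{jk}\partial_ju\,\partial_ku$, and take $L^p$ norms over $Y_T$ with respect to the volume element of $g$. **Theorem 3.2.** There is $\delta>0$ (depending only on $\mathcal K$) such that for every $C_0\ge0$ there is a constant $C$ (depending only on $\mathcal K$ and $C_0$) with the following property. Let $h$ be a Lorentzian metric (signature $(+,-,-,-)$) on $Y\cup\partial Y$, of class $C^1$ up to $\partial Y$ and $\{T=0\}$ (that is, $C^1$ in a neighbourhood of each point of $Y\cup\partial Y$ in $\mathbb R\times S^3$), such that $$|h(V,W)-\eta(V,W)|\le\delta$$ at all points of $Y$ for all tangent vectors $V,W$ of norm one in the metric $dT^2+g$, and $$\|\nabla(h-\eta)\|_{L^1_TL^\infty_X}=\int_0^\pi\big\|\nabla(h-\eta)(T,\cdot)\big\|_{L^\infty(Y_T)}\,dT\le C_0 .$$ Let $u$ be a real function of class $C^2$ up to $\partial Y$ and $\{T=0\}$, in the same sense, with $$\square_hu=F\ \text{ in }Y,\qquad u=0\ \text{ on }\partial Y .$$ Then $$\|u'(T,\cdot)\|_{L^2(Y_T)}\le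 C\,\|u'(0,\cdot)\|_{L^2(Y_0)}+C\int_0^T\|F(S,\cdot)\|_{L^2(Y_S)}\,dS,\qquad 0<T<\pi .$$ -/

import Mathlib

open scoped Manifold ContDiff NNReal RealInnerProductSpace

noncomputable section

namespace EinsteinWave

/-! ### The cylinder `ℝ × S³`

`S³` is the unit sphere of `ℝ⁴`, with coordinate functions `X 0, …, X 3`; the north pole is
`(1, 0, 0, 0)`.  The tangent space of `ℝ × S³` at `(T, X)` is regarded as the subspace
`{(τ, ξ) | ⟪X, ξ⟫ = 0}` of `ℝ × ℝ⁴`. -/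

/-- The unit sphere `S²` of `ℝ³`. -/
abbrev S2 : Type := Metric.sphere (0 : EuclideanSpace ℝ (Fin 3)) 1

/-- The unit sphere `S³` of `ℝ⁴`. -/
abbrev S3 : Type := Metric.sphere (0 : EuclideanSpace ℝ (Fin 4)) 1

/-- The space `ℝ × ℝ⁴` that contains the tangent vectors `(τ, ξ)` of `ℝ × S³`. -/
abbrev Amb : Type := ℝ × EuclideanSpace ℝ (Fin 4)

/-- A field of bilinear forms along `ℝ × S³`.  Only the values on tangent vectors matter; every
covariant 2-tensor on `ℝ × S³` is obtained, with the same regularity, from one that has been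
extended by means of the orthogonal projection of `ℝ⁴` to the tangent spaces of `S³`. -/
abbrev TensorField : Type := ℝ × S3 → Amb →L[ℝ] Amb →L[ℝ] ℝ

/-- `V` is tangent to `ℝ × S³` at `p`. -/
def IsTangent (p : ℝ × S3) (V : Amb) : Prop := ⟪(p.2 : EuclideanSpace ℝ (Fin 4)), V.2⟫ = 0

/-- The form `(V, W) ↦ ⟪V_X, W_X⟫`, which is the standard metric `g` of `S³` on tangent vectors. -/
def spaceForm : Amb →L[ℝ] Amb →L[ℝ] ℝ :=
  ContinuousLinearMap.bilinearComp
    (innerSL ℝ : EuclideanSpace ℝ (Fin 4) →L[ℝ] EuclideanSpace ℝ (Fin 4) →L[ℝ] ℝ)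
    (ContinuousLinearMap.snd ℝ ℝ (EuclideanSpace ℝ (Fin 4)))
    (ContinuousLinearMap.snd ℝ ℝ (EuclideanSpace ℝ (Fin 4)))

/-- The form `dT²`, that is, `(V, W) ↦ V_T W_T`. -/
def timeForm : Amb →L[ℝ] Amb →L[ℝ] ℝ :=
  ContinuousLinearMap.bilinearComp (ContinuousLinearMap.mul ℝ ℝ)
    (ContinuousLinearMap.fst ℝ ℝ (EuclideanSpace ℝ (Fin 4)))
    (ContinuousLinearMap.fst ℝ ℝ (EuclideanSpace ℝ (Fin 4)))

/-- The Riemannian metric `dT² + g`, with `g` the standard metric of `S³`. -/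
def gHat : TensorField := fun _ => timeForm + spaceForm

/-- The Lorentzian metric `η = dT² - g`. -/
def eta : TensorField := fun _ => timeForm - spaceForm

theorem gHat_apply (p : ℝ × S3) (V W : Amb) : gHat p V W = V.1 * W.1 + ⟪V.2, W.2⟫ := rfl

theorem eta_apply (p : ℝ × S3) (V W : Amb) : eta p V W = V.1 * W.1 - ⟪V.2, W.2⟫ := rfl

/-- At `p`, the form `h` is symmetric on tangent vectors and has signature `(+,-,-,-)`: there are
four tangent vectors with Gram matrix `diag(1,-1,-1,-1)`. -/
def IsLorentzianAt (h : TensorField) (p : ℝ × S3) : Prop :=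
  (∀ V W : Amb, IsTangent p V → IsTangent p W → h p V W = h p W V) ∧
  ∃ e : Fin 4 → Amb, (∀ a, IsTangent p (e a)) ∧
    ∀ a b, h p (e a) (e b) = if a = b then (if a = 0 then 1 else -1) else 0

/-- `|h(V, W) - η(V, W)| ≤ δ` at `p` for all tangent `V`, `W` of norm one for `dT² + g`. -/
def IsCloseAt (δ : ℝ) (h : TensorField) (p : ℝ × S3) : Prop :=
  ∀ V W : Amb, IsTangent p V → IsTangent p W → gHat p V V = 1 → gHat p W W = 1 →
    |h p V W - eta p V W| ≤ δ

/-- `f` is of class `C^n` (in a neighbourhood of `p`) on the manifold `ℝ × S³`. -/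
def IsCkAt {G : Type*} [NormedAddCommGroup G] [NormedSpace ℝ G] (n : ℕ∞)
    (f : ℝ × S3 → G) (p : ℝ × S3) : Prop :=
  ContMDiffAt (𝓘(ℝ, ℝ).prod (𝓡 3)) 𝓘(ℝ, G) n f p

/-! ### Stereographic coordinates -/

/-- The point `(ε (1-|x|²)/(1+|x|²), 2x/(1+|x|²))` of `ℝ⁴`. -/
def stereoVec (ε : ℤˣ) (x : Fin 3 → ℝ) : EuclideanSpace ℝ (Fin 4) :=
  WithLp.toLp 2 (Fin.cons (((ε : ℤ) : ℝ) * (1 - ∑ i, x i ^ 2) / (1 + ∑ i, x i ^ 2))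
    (fun i => 2 * x i / (1 + ∑ i, x i ^ 2)))

theorem stereoVec_mem (ε : ℤˣ) (x : Fin 3 → ℝ) :
    stereoVec ε x ∈ Metric.sphere (0 : EuclideanSpace ℝ (Fin 4)) 1 := by
  have hε : (((ε : ℤ) : ℝ)) ^ 2 = 1 := by
    rcases Int.units_eq_one_or ε with h | h <;> simp [h]
  have hpos : (0 : ℝ) < 1 + ∑ i, x i ^ 2 := by positivity
  rw [mem_sphere_zero_iff_norm, EuclideanSpace.norm_eq, Real.sqrt_eq_one]
  have hs : ∑ i : Fin 3, (2 * x i / (1 + ∑ i, x i ^ 2)) ^ 2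
      = 4 * (∑ i, x i ^ 2) / (1 + ∑ i, x i ^ 2) ^ 2 := by
    rw [Finset.mul_sum, Finset.sum_div]
    refine Finset.sum_congr rfl fun i _ => ?_
    rw [div_pow, mul_pow]; norm_num
  rw [Fin.sum_univ_succ]
  simp only [stereoVec, Real.norm_eq_abs, sq_abs, Fin.cons_zero, Fin.cons_succ]
  rw [hs, div_pow, mul_pow, hε]
  field_simp
  ring

/-- The inverse of stereographic projection of `S³`.  For `ε = 1` the image is `S³` without the
south pole `(-1,0,0,0)`, for `ε = -1` it is `S³` without the north pole. -/
def stereoInv (ε : ℤˣ) (x : Fin 3 → ℝ) : S3 := ⟨stereoVec ε x, stereoVec_mem ε x⟩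

/-- Stereographic projection, inverse to `stereoInv ε`. -/
def stereo (ε : ℤˣ) (X : S3) : Fin 3 → ℝ := fun i =>
  (X : EuclideanSpace ℝ (Fin 4)) i.succ
    / (1 + ((ε : ℤ) : ℝ) * (X : EuclideanSpace ℝ (Fin 4)) 0)

open Classical in
/-- A stereographic chart whose domain contains `X`: the one with `ε = 1` except at the
south pole. -/
def chartOf (X : S3) : ℤˣ := if (X : EuclideanSpace ℝ (Fin 4)) 0 = -1 then -1 else 1

/-- Local coordinates of `ℝ × S³`: the point with coordinates `y = (T, x₁, x₂, x₃)`. -/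
def param (ε : ℤˣ) (y : Fin 4 → ℝ) : ℝ × S3 := (y 0, stereoInv ε (Fin.tail y))

/-- The coordinates of a point in the chart `ε`. -/
def coord (ε : ℤˣ) (p : ℝ × S3) : Fin 4 → ℝ := Fin.cons p.1 (stereo ε p.2)

/-- The partial derivative `∂_j` of a function of the coordinates. -/
def pd {n : ℕ} (j : Fin n) (f : (Fin n → ℝ) → ℝ) (y : Fin n → ℝ) : ℝ :=
  fderiv ℝ f y (Pi.single j 1)

/-- The coordinate vector field `∂_j`, as a tangent vector in `ℝ × ℝ⁴`. -/
def coordVec (ε : ℤˣ) (y : Fin 4 → ℝ) (j : Fin 4) : Amb :=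
  fderiv ℝ (fun z : Fin 4 → ℝ => ((z 0, stereoVec ε (Fin.tail z)) : Amb)) y (Pi.single j 1)

/-- The components `k_{ij} = k(∂_i, ∂_j)` of a covariant 2-tensor. -/
def comp (ε : ℤˣ) (k : TensorField) (y : Fin 4 → ℝ) : Matrix (Fin 4) (Fin 4) ℝ :=
  Matrix.of fun i j => k (param ε y) (coordVec ε y i) (coordVec ε y j)

/-! ### Norms and the volume of the round sphere -/

/-- The components `g_{ij}` of the standard metric of `S³`. -/
def sphereMetric (ε : ℤˣ) (x : Fin 3 → ℝ) : Matrix (Fin 3) (Fin 3) ℝ :=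
  Matrix.of fun i j => ⟪fderiv ℝ (stereoVec ε) x (Pi.single i 1),
    fderiv ℝ (stereoVec ε) x (Pi.single j 1)⟫

/-- The Riemannian volume `√(det g) dx` of `S³`; a single chart suffices, since it omits only one
point. -/
def sphereVol : MeasureTheory.Measure S3 :=
  ((MeasureTheory.volume : MeasureTheory.Measure (Fin 3 → ℝ)).withDensity
    (fun x => ENNReal.ofReal (Real.sqrt (sphereMetric 1 x).det))).map (stereoInv 1)

/-- `|u'|² = |∂_T u|² + Σ g^{jk} ∂_j u ∂_k u`, in local coordinates. -/
def energyCoord (ε : ℤˣ) (v : (Fin 4 → ℝ) → ℝ) (y : Fin 4 → ℝ) : ℝ :=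
  (pd 0 v y) ^ 2 + ∑ j : Fin 3, ∑ k : Fin 3,
    (sphereMetric ε (Fin.tail y))⁻¹ j k * pd j.succ v y * pd k.succ v y

/-- `|u'(p)|`, the length of the full space-time gradient of `u` for `dT² + g`. -/
def gradNorm (u : ℝ × S3 → ℝ) (p : ℝ × S3) : ℝ :=
  Real.sqrt (energyCoord (chartOf p.2) (u ∘ param (chartOf p.2)) (coord (chartOf p.2) p))

/-! ### The covariant derivative for `dT² + g` -/

/-- The Christoffel symbols `Γ^m_{ij}` of the Levi-Civita connection of `dT² + g`. -/
def christoffel (ε : ℤˣ) (m i j : Fin 4) (y : Fin 4 → ℝ) : ℝ :=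
  (1 / 2) * ∑ l : Fin 4, (comp ε gHat y)⁻¹ m l *
    (pd i (fun z => comp ε gHat z l j) y + pd j (fun z => comp ε gHat z l i) y
      - pd l (fun z => comp ε gHat z i j) y)

/-- The components `∇_i k_{jl}` of the covariant derivative of a covariant 2-tensor `k`. -/
def nablaCoord (ε : ℤˣ) (k : TensorField) (i j l : Fin 4) (y : Fin 4 → ℝ) : ℝ :=
  pd i (fun z => comp ε k z j l) y
    - ∑ m : Fin 4, christoffel ε m i j y * comp ε k y m l
    - ∑ m : Fin 4, christoffel ε m i l y * comp ε k y j m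

/-- `|∇k|²`, the squared length of the 3-tensor `∇k` for `dT² + g`, in local coordinates. -/
def nablaSqCoord (ε : ℤˣ) (k : TensorField) (y : Fin 4 → ℝ) : ℝ :=
  ∑ i : Fin 4, ∑ j : Fin 4, ∑ l : Fin 4, ∑ i' : Fin 4, ∑ j' : Fin 4, ∑ l' : Fin 4,
    (comp ε gHat y)⁻¹ i i' * (comp ε gHat y)⁻¹ j j' * (comp ε gHat y)⁻¹ l l' *
      nablaCoord ε k i j l y * nablaCoord ε k i' j' l' y

/-- `|∇k|` at the point `p`. -/
def nablaNorm (k : TensorField) (p : ℝ × S3) : ℝ :=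
  Real.sqrt (nablaSqCoord (chartOf p.2) k (coord (chartOf p.2) p))

/-! ### The D'Alembertian -/

/-- `|h|^{-1/2} Σ_{j,k} ∂_j (h^{jk} |h|^{1/2} ∂_k v)` for a metric with components `H = (h_{jk})`,
where `(h^{jk})` is the inverse matrix and `|h|` the absolute value of the determinant. -/
def boxCoord (H : (Fin 4 → ℝ) → Matrix (Fin 4) (Fin 4) ℝ) (v : (Fin 4 → ℝ) → ℝ)
    (y : Fin 4 → ℝ) : ℝ :=
  (Real.sqrt |(H y).det|)⁻¹ * ∑ j : Fin 4, ∑ k : Fin 4,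
    pd j (fun z => (H z)⁻¹ j k * Real.sqrt |(H z).det| * pd k v z) y

/-- The D'Alembertian `□_h u` of the metric `h`. -/
def dAlembertian (h : TensorField) (u : ℝ × S3 → ℝ) (p : ℝ × S3) : ℝ :=
  boxCoord (comp (chartOf p.2) h) (u ∘ param (chartOf p.2)) (coord (chartOf p.2) p)

/-! ### The Penrose map and the exterior domain -/

/-- The variable `T = arctan(t+r) + arctan(t-r)`. -/
def penroseT (t r : ℝ) : ℝ := Real.arctan (t + r) + Real.arctan (t - r)

/-- The variable `R = arctan(t+r) - arctan(t-r)`, the distance from the north pole. -/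
def penroseR (t r : ℝ) : ℝ := Real.arctan (t + r) - Real.arctan (t - r)

/-- The point `(cos R, (sin R) θ)`, where `x = |x| θ` and `R = R(t, |x|)`; it is the north pole
if `x = 0`. -/
def penroseVec (t : ℝ) (x : EuclideanSpace ℝ (Fin 3)) : EuclideanSpace ℝ (Fin 4) :=
  WithLp.toLp 2 (Fin.cons (Real.cos (penroseR t ‖x‖))
    (fun i => Real.sin (penroseR t ‖x‖) * (x i / ‖x‖)))

theorem penroseVec_mem (t : ℝ) (x : EuclideanSpace ℝ (Fin 3)) :
    penroseVec t x ∈ Metric.sphere (0 : EuclideanSpace ℝ (Fin 4)) 1 := by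
  rw [mem_sphere_zero_iff_norm, EuclideanSpace.norm_eq, Real.sqrt_eq_one, Fin.sum_univ_succ]
  simp only [penroseVec, Real.norm_eq_abs, sq_abs, Fin.cons_zero, Fin.cons_succ]
  by_cases hx : x = 0
  · simp [hx, penroseR]
  · have hn : ‖x‖ ≠ 0 := norm_ne_zero_iff.mpr hx
    have hs : ∑ i, x i ^ 2 = ‖x‖ ^ 2 := by
      rw [EuclideanSpace.norm_sq_eq]; simp
    have h1 : ∑ i, (Real.sin (penroseR t ‖x‖) * (x i / ‖x‖)) ^ 2
        = Real.sin (penroseR t ‖x‖) ^ 2 := by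
      simp only [mul_pow, div_pow]
      rw [← Finset.mul_sum, ← Finset.sum_div, hs, div_self (pow_ne_zero 2 hn), mul_one]
    rw [h1]
    exact Real.cos_sq_add_sin_sq _

/-- The Penrose map `ℝ × ℝ³ → (-π, π) × S³`. -/
def penrose (q : ℝ × EuclideanSpace ℝ (Fin 3)) : ℝ × S3 :=
  (penroseT q.1 ‖q.2‖, ⟨penroseVec q.1 q.2, penroseVec_mem q.1 q.2⟩)

/-- The obstacle `{x = r θ : 0 ≤ r ≤ φ(θ)}`. -/
def obstacle (φ : S2 → ℝ) : Set (EuclideanSpace ℝ (Fin 3)) :=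
  {x | ∃ (r : ℝ) (θ : S2), 0 ≤ r ∧ r ≤ φ θ ∧ x = r • (θ : EuclideanSpace ℝ (Fin 3))}

/-- The boundary `{x = r θ : r = φ(θ)}` of the obstacle. -/
def obstacleBoundary (φ : S2 → ℝ) : Set (EuclideanSpace ℝ (Fin 3)) :=
  {x | ∃ θ : S2, x = φ θ • (θ : EuclideanSpace ℝ (Fin 3))}

/-- `Y = ([0, π) × S³) \ 𝒫([0, ∞) × 𝒦)`. -/
def domainY (φ : S2 → ℝ) : Set (ℝ × S3) :=
  (Set.Ico 0 Real.pi ×ˢ Set.univ) \ (penrose '' (Set.Ici 0 ×ˢ obstacle φ))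

/-- The lateral boundary `∂Y = 𝒫([0, ∞) × ∂𝒦)`. -/
def boundaryY (φ : S2 → ℝ) : Set (ℝ × S3) :=
  penrose '' (Set.Ici 0 ×ˢ obstacleBoundary φ)

/-- The cross section `Y_T`. -/
def sliceY (φ : S2 → ℝ) (T : ℝ) : Set S3 := {X | (T, X) ∈ domainY φ}

/-- The norm of `f(T, ·)` in `L^p(Y_T)`. -/
def normSlice (φ : S2 → ℝ) (p : ENNReal) (f : ℝ × S3 → ℝ) (T : ℝ) : ENNReal :=
  MeasureTheory.eLpNorm (fun X => f (T, X)) p (sphereVol.restrict (sliceY φ T))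

end EinsteinWave

end

/-! The proof is the energy method with multiplier `∂_T`, carried out in one stereographic chart,
which omits only the south pole. Put `P = |h|^{1/2} h⁻¹` and let `J^j = P^{jk} ∂_k u ∂_T u - ½ δ^j_0
P^{kl} ∂_k u ∂_l u`. Then `∂_j J^j = |h|^{1/2} F ∂_T u - ½ (∂_T P^{kl}) ∂_k u ∂_l u`
(`div_current`), and three facts turn this into the estimate.

Coercivity: if `h` is close to `η`, then `J^0` is comparable with `|u'|²` times the volume density
(`energy_density_bounds`, `current_zero_bounds`).

Deformation: the multiplier is a coordinate field of a product metric, so every Christoffel symbol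
of `dT² + g` with lower index `T` vanishes and only `∂_T P` enters. It is bounded pointwise by `|∇(h
- η)|` (`pd_zero_hat`, `abs_deform_le`). The resulting Grönwall weight is integrable in `T`, and
`C₀` appears in the exponential.

Boundary: in the chart the domain is `{Psi > 0}`. Since `u = 0` on `{Psi = 0}`, `du = c dPsi` there,
and the flux of `J` is `(c²/2) ∂_T Psi · P(dPsi, dPsi)` (`flux_eq`). The sections of the obstacle
shrink as `T` grows, so `∂_T Psi ≥ 0`. Star-shapedness makes the gauge of the obstacle homogeneous
of degree one, and this forces `dPsi` to be space-like with a margin that is uniform up to `T = π`,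
although the sections collapse to the north pole there (`conormal_spacelike`). For small `δ`,
depending only on the obstacle, `P(dPsi, dPsi) ≤ 0` persists, and the flux can be dropped
(`flux_nonpos`).

Instead of a divergence theorem on a domain with moving boundary, `J` is multiplied by cutoffs near
`{Psi = 0}` and near the south pole. The boundary cutoff contributes an almost nonpositive flux
against a weight of uniformly bounded mass (`exists_flux_le`, `exists_integral_bslope_le`). The
polar cutoff contributes `O(1/r)`, because `du` is bounded near the pole (`exists_framed_bound`).
Grönwall's inequality for `√(E + τ)` and `τ → 0` finish the argument (`energy_le_of_cut`,
`energy_le`). -/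

noncomputable section

namespace EinsteinWave

section

/-! ### The stereographic chart -/

/-- `|x|²` for `x ∈ ℝ³`. -/
def rsq (x : Fin 3 → ℝ) : ℝ := ∑ i, x i ^ 2

/-- The conformal factor `2 / (1 + |x|²)` of the stereographic chart. -/
def conf (x : Fin 3 → ℝ) : ℝ := 2 / (1 + rsq x)

theorem rsq_nonneg (x : Fin 3 → ℝ) : 0 ≤ rsq x := Finset.sum_nonneg fun _ _ => sq_nonneg _

theorem one_add_rsq_pos (x : Fin 3 → ℝ) : 0 < 1 + rsq x := by linarith [rsq_nonneg x]

theorem conf_pos (x : Fin 3 → ℝ) : 0 < conf x := div_pos two_pos (one_add_rsq_pos x)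

theorem contDiff_rsq {n : WithTop ℕ∞} : ContDiff ℝ n rsq := by
  unfold rsq; fun_prop

theorem contDiff_conf {n : WithTop ℕ∞} : ContDiff ℝ n conf := by
  unfold conf
  exact contDiff_const.div (contDiff_const.add contDiff_rsq) fun x => (one_add_rsq_pos x).ne'

theorem hasFDerivAt_rsq (x : Fin 3 → ℝ) :
    HasFDerivAt rsq (∑ i, (2 * x i) • ContinuousLinearMap.proj (R := ℝ) (φ := fun _ : Fin 3 => ℝ) i)
      x := by
  unfold rsq
  refine HasFDerivAt.fun_sum fun i _ => ?_
  have h := (hasFDerivAt_apply (𝕜 := ℝ) (F' := fun _ : Fin 3 => ℝ) i x).pow 2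
  simpa using h

theorem stereoVec_zero (ε : ℤˣ) (x : Fin 3 → ℝ) :
    stereoVec ε x 0 = ((ε : ℤ) : ℝ) * (1 - rsq x) / (1 + rsq x) := rfl

theorem stereoVec_succ (ε : ℤˣ) (x : Fin 3 → ℝ) (i : Fin 3) :
    stereoVec ε x i.succ = 2 * x i / (1 + rsq x) := rfl

theorem contDiff_stereoVec {n : WithTop ℕ∞} (ε : ℤˣ) : ContDiff ℝ n (stereoVec ε) := by
  rw [contDiff_euclidean]
  intro i
  refine Fin.cases ?_ (fun i => ?_) i
  · simp only [stereoVec_zero]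
    exact (contDiff_const.mul (contDiff_const.sub contDiff_rsq)).div
      (contDiff_const.add contDiff_rsq) fun x => (one_add_rsq_pos x).ne'
  · simp only [stereoVec_succ]
    exact (contDiff_const.mul (contDiff_apply ℝ ℝ i)).div
      (contDiff_const.add contDiff_rsq) fun x => (one_add_rsq_pos x).ne'

theorem fderiv_stereoVec_apply (ε : ℤˣ) (x v : Fin 3 → ℝ) (i : Fin 4) :
    fderiv ℝ (stereoVec ε) x v i = fderiv ℝ (fun z => stereoVec ε z i) x v := by
  have h := ((contDiff_stereoVec (n := 1) ε).differentiable one_ne_zero x).hasFDerivAt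
  have h2 := (EuclideanSpace.proj i : EuclideanSpace ℝ (Fin 4) →L[ℝ] ℝ).hasFDerivAt.comp x h
  have h3 : (⇑(EuclideanSpace.proj i : EuclideanSpace ℝ (Fin 4) →L[ℝ] ℝ) ∘ stereoVec ε)
    = fun z => stereoVec ε z i := rfl
  rw [h3] at h2
  rw [h2.fderiv]
  rfl

theorem fderiv_stereoVec_zero (ε : ℤˣ) (x : Fin 3 → ℝ) (j : Fin 3) :
    fderiv ℝ (stereoVec ε) x (Pi.single j 1) 0
      = -(((ε : ℤ) : ℝ) * (4 * x j / (1 + rsq x) ^ 2)) := by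
  rw [fderiv_stereoVec_apply]
  simp only [stereoVec_zero]
  have hr := hasFDerivAt_rsq x
  have h := ((hr.const_sub 1).const_mul (((ε : ℤ) : ℝ))).mul
    ((hasDerivAt_inv (one_add_rsq_pos x).ne').comp_hasFDerivAt x (hr.const_add 1))
  simp only [div_eq_mul_inv]
  have hp := (one_add_rsq_pos x).ne'
  erw [h.fderiv]
  simp [Pi.single_apply]
  field_simp
  ring

theorem fderiv_stereoVec_succ (ε : ℤˣ) (x : Fin 3 → ℝ) (j i : Fin 3) :
    fderiv ℝ (stereoVec ε) x (Pi.single j 1) i.succ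
      = (if i = j then 2 / (1 + rsq x) else 0) - 4 * x i * x j / (1 + rsq x) ^ 2 := by
  rw [fderiv_stereoVec_apply]
  simp only [stereoVec_succ]
  have hr := hasFDerivAt_rsq x
  have h := ((hasFDerivAt_apply (𝕜 := ℝ) (F' := fun _ : Fin 3 => ℝ) i x).const_mul 2).mul
    ((hasDerivAt_inv (one_add_rsq_pos x).ne').comp_hasFDerivAt x (hr.const_add 1))
  simp only [div_eq_mul_inv]
  have hp := (one_add_rsq_pos x).ne'
  erw [h.fderiv]
  by_cases hij : i = j <;> simp [Pi.single_apply, hij] <;> field_simp <;> ring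

/-- Stereographic projection is conformal. The sign `ε` enters only through `ε² = 1`, so both charts
have the same metric coefficients. -/
theorem inner_fderiv_stereoVec (x : Fin 3 → ℝ) (j k : Fin 3) (ε : ℤˣ) :
    ⟪fderiv ℝ (stereoVec ε) x (Pi.single j 1), fderiv ℝ (stereoVec ε) x (Pi.single k 1)⟫
      = if j = k then conf x ^ 2 else 0 := by
  have hε : (((ε : ℤ) : ℝ)) ^ 2 = 1 := by
    rcases Int.units_eq_one_or ε with h | h <;> simp [h]
  have hp := (one_add_rsq_pos x).ne'
  rw [PiLp.inner_apply, Fin.sum_univ_succ]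
  simp only [fderiv_stereoVec_zero, fderiv_stereoVec_succ, RCLike.inner_apply, conj_trivial]
  have e0 : -(((ε : ℤ) : ℝ) * (4 * x k / (1 + rsq x) ^ 2))
      * -(((ε : ℤ) : ℝ) * (4 * x j / (1 + rsq x) ^ 2))
      = (4 * x k / (1 + rsq x) ^ 2) * (4 * x j / (1 + rsq x) ^ 2) := by
    linear_combination (4 * x k / (1 + rsq x) ^ 2) * (4 * x j / (1 + rsq x) ^ 2) * hε
  rw [e0]
  have hr : rsq x = x 0 ^ 2 + x 1 ^ 2 + x 2 ^ 2 := by simp [rsq, Fin.sum_univ_three]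
  unfold conf
  generalize rsq x = q at *
  subst hr
  fin_cases j <;> fin_cases k <;> simp [Fin.sum_univ_three] <;> field_simp <;> ring

theorem inner_stereoVec_fderiv (ε : ℤˣ) (x v : Fin 3 → ℝ) :
    ⟪stereoVec ε x, fderiv ℝ (stereoVec ε) x v⟫ = 0 := by
  have h := ((contDiff_stereoVec (n := 1) ε).differentiable one_ne_zero x).hasFDerivAt
  have h2 := h.inner ℝ h
  have h3 : (fun t => ⟪stereoVec ε t, stereoVec ε t⟫) = fun _ => (1 : ℝ) := by
    funext t
    rw [real_inner_self_eq_norm_sq, mem_sphere_zero_iff_norm.1 (stereoVec_mem ε t), one_pow]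
  rw [h3] at h2
  have h4 := h2.unique (hasFDerivAt_const (1 : ℝ) x)
  have h5 := congrArg (fun L => L v) h4
  simp only [ContinuousLinearMap.coe_comp, Function.comp_apply, ContinuousLinearMap.prod_apply,
    fderivInnerCLM_apply, zero_apply] at h5
  rw [real_inner_comm] at h5
  have : ⟪fderiv ℝ (stereoVec ε) x v, stereoVec ε x⟫ = ⟪stereoVec ε x, fderiv ℝ (stereoVec ε) x v⟫ :=
    real_inner_comm _ _
  linarith

theorem sphereMetric_eq (x : Fin 3 → ℝ) (ε : ℤˣ) :
    sphereMetric ε x = Matrix.diagonal fun _ => conf x ^ 2 := by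
  ext i j
  rw [sphereMetric, Matrix.of_apply, inner_fderiv_stereoVec, Matrix.diagonal_apply]

theorem sqrt_det_sphereMetric (x : Fin 3 → ℝ) (ε : ℤˣ) :
    Real.sqrt (sphereMetric ε x).det = conf x ^ 3 := by
  rw [sphereMetric_eq, Matrix.det_diagonal, Real.sqrt_eq_iff_mul_self_eq]
  · simp; ring
  · simp; positivity
  · have := conf_pos x; positivity

/-- The projection to the spatial coordinates. -/
def tailCLM : (Fin 4 → ℝ) →L[ℝ] (Fin 3 → ℝ) :=
  ContinuousLinearMap.pi fun i => ContinuousLinearMap.proj i.succ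

theorem tailCLM_apply (y : Fin 4 → ℝ) : tailCLM y = Fin.tail y := rfl

theorem contDiff_tail {n : WithTop ℕ∞} : ContDiff ℝ n (Fin.tail : (Fin 4 → ℝ) → Fin 3 → ℝ) :=
  tailCLM.contDiff

theorem tail_single_zero : Fin.tail (Pi.single (0 : Fin 4) (1 : ℝ) : Fin 4 → ℝ) = 0 := by
  ext i; simp [Fin.tail]

theorem tail_single_succ (j : Fin 3) :
    Fin.tail (Pi.single j.succ (1 : ℝ) : Fin 4 → ℝ) = Pi.single j 1 := by
  ext i; simp [Fin.tail, Pi.single_apply]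

theorem coordVec_eq (ε : ℤˣ) (y : Fin 4 → ℝ) (j : Fin 4) :
    coordVec ε y j = ((Pi.single j (1 : ℝ) : Fin 4 → ℝ) 0,
      fderiv ℝ (stereoVec ε) (Fin.tail y) (Fin.tail (Pi.single j (1 : ℝ) : Fin 4 → ℝ))) := by
  have h1 : HasFDerivAt (fun z : Fin 4 → ℝ => z 0)
      (ContinuousLinearMap.proj (R := ℝ) (φ := fun _ : Fin 4 => ℝ) 0) y := hasFDerivAt_apply 0 y
  have h := ((contDiff_stereoVec (n := 1) ε).differentiable one_ne_zero (Fin.tail y)).hasFDerivAt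
  have h2 : HasFDerivAt (fun z : Fin 4 → ℝ => stereoVec ε (Fin.tail z))
    ((fderiv ℝ (stereoVec ε) (Fin.tail y)).comp tailCLM) y :=
    HasFDerivAt.comp y (f := tailCLM) h (tailCLM.hasFDerivAt)
  unfold coordVec
  rw [(h1.prodMk h2).fderiv]
  rfl

theorem coordVec_zero (ε : ℤˣ) (y : Fin 4 → ℝ) : coordVec ε y 0 = (1, 0) := by
  rw [coordVec_eq, tail_single_zero]; simp

theorem coordVec_succ (ε : ℤˣ) (y : Fin 4 → ℝ) (j : Fin 3) :
    coordVec ε y j.succ = (0, fderiv ℝ (stereoVec ε) (Fin.tail y) (Pi.single j 1)) := by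
  rw [coordVec_eq, tail_single_succ]; simp

theorem contDiff_coordVec {n : ℕ∞} (ε : ℤˣ) (j : Fin 4) :
    ContDiff ℝ n (fun y => coordVec ε y j) := by
  simp only [coordVec_eq]
  have h : ContDiff ℝ n (fderiv ℝ (stereoVec ε)) :=
    (contDiff_stereoVec (n := n + 1) ε).fderiv_right le_rfl
  exact contDiff_const.prodMk ((h.comp contDiff_tail).clm_apply contDiff_const)

theorem isTangent_coordVec (ε : ℤˣ) (y : Fin 4 → ℝ) (j : Fin 4) :
    IsTangent (param ε y) (coordVec ε y j) := by
  rw [coordVec_eq]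
  exact inner_stereoVec_fderiv ε _ _

/-- The lengths `(1, λ, λ, λ)` of the coordinate vector fields. -/
def scale (y : Fin 4 → ℝ) (j : Fin 4) : ℝ := if j = 0 then 1 else conf (Fin.tail y)

theorem scale_zero (y : Fin 4 → ℝ) : scale y 0 = 1 := rfl

theorem scale_succ (y : Fin 4 → ℝ) (j : Fin 3) : scale y j.succ = conf (Fin.tail y) := by
  simp [scale]

theorem scale_pos (y : Fin 4 → ℝ) (j : Fin 4) : 0 < scale y j := by
  unfold scale; split_ifs
  · exact one_pos
  · exact conf_pos _

theorem contDiff_scale {n : WithTop ℕ∞} (j : Fin 4) : ContDiff ℝ n (fun y => scale y j) := by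
  unfold scale; split_ifs
  · exact contDiff_const
  · exact contDiff_conf.comp contDiff_tail

/-- The diagonal entries of the Minkowski metric. -/
def mink (j : Fin 4) : ℝ := if j = 0 then 1 else -1

theorem spaceForm_coordVec (ε : ℤˣ) (y : Fin 4 → ℝ) (i j : Fin 4) :
    ⟪(coordVec ε y i).2, (coordVec ε y j).2⟫
      = if i = j ∧ i ≠ 0 then scale y i ^ 2 else 0 := by
  refine Fin.cases ?_ (fun i => ?_) i
  · rw [coordVec_zero]; simp
  · refine Fin.cases ?_ (fun j => ?_) j
    · rw [coordVec_zero]; simp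
    · rw [coordVec_succ, coordVec_succ, scale_succ, inner_fderiv_stereoVec]
      simp

theorem coordVec_fst (ε : ℤˣ) (y : Fin 4 → ℝ) (i : Fin 4) :
    (coordVec ε y i).1 = if i = 0 then 1 else 0 := by
  rw [coordVec_eq]; simp [Pi.single_apply, eq_comm]

theorem comp_gHat (ε : ℤˣ) (y : Fin 4 → ℝ) :
    comp ε gHat y = Matrix.diagonal fun j => scale y j ^ 2 := by
  ext i j
  rw [comp, Matrix.of_apply, gHat_apply, spaceForm_coordVec, coordVec_fst, coordVec_fst,
    Matrix.diagonal_apply]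
  by_cases h : i = j
  · subst h; by_cases h0 : i = 0 <;> simp [h0, scale]
  · by_cases h0 : i = 0
    · subst h0; simp [h, Ne.symm h]
    · simp [h, h0]

theorem comp_eta (ε : ℤˣ) (y : Fin 4 → ℝ) :
    comp ε eta y = Matrix.diagonal fun j => mink j * scale y j ^ 2 := by
  ext i j
  rw [comp, Matrix.of_apply, eta_apply, spaceForm_coordVec, coordVec_fst, coordVec_fst,
    Matrix.diagonal_apply]
  by_cases h : i = j
  · subst h; by_cases h0 : i = 0 <;> simp [h0, scale, mink]
  · by_cases h0 : i = 0
    · subst h0; simp [h, Ne.symm h]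
    · simp [h, h0]

end

/-! ### Intrinsic quantities expressed in the chart and its orthonormal frame. -/

section

theorem stereo_stereoInv (x : Fin 3 → ℝ) : stereo 1 (stereoInv 1 x) = x := by
  ext i
  have hp := (one_add_rsq_pos x).ne'
  change stereoVec 1 x i.succ / (1 + (((1 : ℤˣ) : ℤ) : ℝ) * stereoVec 1 x 0) = x i
  rw [stereoVec_succ, stereoVec_zero]
  have : 1 + (((1 : ℤˣ) : ℤ) : ℝ) * ((((1 : ℤˣ) : ℤ) : ℝ) * (1 - rsq x) / (1 + rsq x))
      = 2 / (1 + rsq x) := by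
    simp; field_simp; ring
  rw [this]
  field_simp

theorem chartOf_stereoInv (x : Fin 3 → ℝ) : chartOf (stereoInv 1 x) = 1 := by
  have hp := one_add_rsq_pos x
  unfold chartOf
  rw [if_neg]
  change stereoVec 1 x 0 ≠ -1
  rw [stereoVec_zero]
  intro h
  rw [div_eq_iff hp.ne'] at h
  simp at h
  linarith

theorem coord_param (y : Fin 4 → ℝ) : coord 1 (param 1 y) = y := by
  unfold coord param
  rw [stereo_stereoInv]
  exact Fin.cons_self_tail y

theorem chartOf_param (y : Fin 4 → ℝ) : chartOf (param 1 y).2 = 1 := chartOf_stereoInv _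

/-- `chartOf` selects `ε = 1` at every point other than the south pole, so on the image of `param 1`
the pointwise choice of chart disappears. -/
theorem dAlembertian_param (h : TensorField) (u : ℝ × S3 → ℝ) (y : Fin 4 → ℝ) :
    dAlembertian h u (param 1 y) = boxCoord (comp 1 h) (u ∘ param 1) y := by
  unfold dAlembertian
  rw [chartOf_param, coord_param]

/-- The components of the differential of `v` in the orthonormal frame `∂_j / |∂_j|`. -/
def framed (v : (Fin 4 → ℝ) → ℝ) (y : Fin 4 → ℝ) (k : Fin 4) : ℝ := pd k v y / scale y k

theorem gradNorm_param (u : ℝ × S3 → ℝ) (y : Fin 4 → ℝ) :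
    gradNorm u (param 1 y) ^ 2 = ∑ k, framed (u ∘ param 1) y k ^ 2 := by
  unfold gradNorm
  rw [chartOf_param, coord_param]
  have hc := (conf_pos (Fin.tail y)).ne'
  have : energyCoord 1 (u ∘ param 1) y = ∑ k, framed (u ∘ param 1) y k ^ 2 := by
    unfold energyCoord
    have hinv : (sphereMetric 1 (Fin.tail y))⁻¹
        = Matrix.diagonal fun _ => (conf (Fin.tail y) ^ 2)⁻¹ := by
      rw [sphereMetric_eq]
      apply Matrix.inv_eq_right_inv
      rw [Matrix.diagonal_mul_diagonal]
      simp [hc]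
    rw [hinv, Fin.sum_univ_succ (n := 3) (f := fun k => framed (u ∘ param 1) y k ^ 2)]
    simp only [framed, scale_zero, div_one, scale_succ]
    congr 1
    refine Finset.sum_congr rfl fun j _ => ?_
    simp only [Matrix.diagonal_apply, ite_mul, zero_mul, Finset.sum_ite_eq, Finset.mem_univ,
      if_true]
    field_simp
  rw [this, Real.sq_sqrt]
  exact Finset.sum_nonneg fun _ _ => sq_nonneg _

theorem pd_zero_of_tail (f : (Fin 4 → ℝ) → ℝ) (g : (Fin 3 → ℝ) → ℝ)
    (h : ∀ z, f z = g (Fin.tail z)) (y : Fin 4 → ℝ) : pd 0 f y = 0 := by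
  unfold pd
  by_cases hd : DifferentiableAt ℝ f y
  · rw [← hd.lineDeriv_eq_fderiv, lineDeriv]
    have : (fun t : ℝ => f (y + t • Pi.single (0 : Fin 4) (1 : ℝ))) = fun _ => g (Fin.tail y) := by
      funext t
      rw [h]
      congr 1
      ext i
      simp [Fin.tail]
    rw [this, deriv_const]
  -- Without differentiability `fderiv` has the default value `0`, so no regularity of `f` is
  -- needed.
  · rw [fderiv_zero_of_not_differentiableAt hd]; rfl

theorem pd_const {n : ℕ} (j : Fin n) (c : ℝ) (y : Fin n → ℝ) : pd j (fun _ => c) y = 0 := by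
  simp [pd]

/-- `dT² + g` is a product: its coefficients do not depend on `T`, and those with an index `0` are
constant. -/
theorem christoffel_time (ε : ℤˣ) (m j : Fin 4) (y : Fin 4 → ℝ) : christoffel ε m 0 j y = 0 := by
  unfold christoffel
  have h0 : ∀ l k, pd 0 (fun z => comp ε gHat z l k) y = 0 := fun l k => by
    refine pd_zero_of_tail _ (fun x => (Matrix.diagonal fun j : Fin 4 =>
      (if j = 0 then 1 else conf x) ^ 2) l k) (fun z => ?_) y
    rw [comp_gHat]; rfl
  have h1 : ∀ i l, pd i (fun z => comp ε gHat z l 0) y = 0 := fun i l => by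
    have : (fun z => comp ε gHat z l 0) = fun _ => if l = 0 then (1 : ℝ) else 0 := by
      funext z
      rw [comp_gHat, Matrix.diagonal_apply]
      by_cases hl : l = 0 <;> simp [hl, scale]
    rw [this, pd_const]
  have h2 : ∀ i l, pd i (fun z => comp ε gHat z 0 l) y = 0 := fun i l => by
    have : (fun z => comp ε gHat z 0 l) = fun _ => if 0 = l then (1 : ℝ) else 0 := by
      funext z
      rw [comp_gHat, Matrix.diagonal_apply]
      by_cases hl : 0 = l <;> simp [hl, scale]
    rw [this, pd_const]
  simp [h0, h1, h2]

theorem nablaCoord_time (ε : ℤˣ) (k : TensorField) (j l : Fin 4) (y : Fin 4 → ℝ) :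
    nablaCoord ε k 0 j l y = pd 0 (fun z => comp ε k z j l) y := by
  simp [nablaCoord, christoffel_time]

theorem nablaSqCoord_eq (ε : ℤˣ) (k : TensorField) (y : Fin 4 → ℝ) :
    nablaSqCoord ε k y = ∑ i, ∑ j, ∑ l,
      (nablaCoord ε k i j l y / (scale y i * scale y j * scale y l)) ^ 2 := by
  have hinv : (comp ε gHat y)⁻¹ = Matrix.diagonal fun j => (scale y j ^ 2)⁻¹ := by
    rw [comp_gHat]
    apply Matrix.inv_eq_right_inv
    rw [Matrix.diagonal_mul_diagonal]
    have : ∀ j, scale y j ^ 2 * (scale y j ^ 2)⁻¹ = 1 := fun j =>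
      mul_inv_cancel₀ (pow_ne_zero 2 (scale_pos y j).ne')
    simp [this]
  unfold nablaSqCoord
  rw [hinv]
  refine Finset.sum_congr rfl fun i _ => Finset.sum_congr rfl fun j _ =>
    Finset.sum_congr rfl fun l _ => ?_
  simp only [Matrix.diagonal_apply, ite_mul, zero_mul, mul_ite, mul_zero, Finset.sum_ite_eq,
    Finset.mem_univ, if_true]
  have := (scale_pos y i).ne'
  have := (scale_pos y j).ne'
  have := (scale_pos y l).ne'
  field_simp

/-- In the orthonormal frame `|∇k|²` is a sum of squares, and by `nablaCoord_time` the entries with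
first index `0` are plain `T`-derivatives. Those are the only ones that the multiplier `∂_T`
requires. -/
theorem abs_pd_comp_le_nablaNorm (k : TensorField) (j l : Fin 4) (y : Fin 4 → ℝ) :
    |pd 0 (fun z => comp 1 k z j l) y / (scale y j * scale y l)| ≤ nablaNorm k (param 1 y) := by
  unfold nablaNorm
  rw [chartOf_param, coord_param]
  apply Real.abs_le_sqrt
  rw [nablaSqCoord_eq]
  have h0 : ∀ i j l, 0 ≤ (nablaCoord 1 k i j l y / (scale y i * scale y j * scale y l)) ^ 2 :=
    fun _ _ _ => sq_nonneg _
  have e : (pd 0 (fun z => comp 1 k z j l) y / (scale y j * scale y l)) ^ 2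
      = (nablaCoord 1 k 0 j l y / (scale y 0 * scale y j * scale y l)) ^ 2 := by
    rw [nablaCoord_time, scale_zero, one_mul]
  rw [e]
  refine le_trans ?_ (Finset.single_le_sum (f := fun i => ∑ j, ∑ l,
    (nablaCoord 1 k i j l y / (scale y i * scale y j * scale y l)) ^ 2)
    (fun i _ => Finset.sum_nonneg fun j _ => Finset.sum_nonneg fun l _ => h0 i j l)
    (Finset.mem_univ 0))
  refine le_trans ?_ (Finset.single_le_sum (f := fun j => ∑ l,
    (nablaCoord 1 k 0 j l y / (scale y 0 * scale y j * scale y l)) ^ 2)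
    (fun j _ => Finset.sum_nonneg fun l _ => h0 0 j l)
    (Finset.mem_univ j))
  exact Finset.single_le_sum (f := fun l =>
    (nablaCoord 1 k 0 j l y / (scale y 0 * scale y j * scale y l)) ^ 2)
    (fun l _ => h0 0 j l) (Finset.mem_univ l)

theorem contMDiff_stereoInv {n : ℕ∞} (ε : ℤˣ) :
    ContMDiff 𝓘(ℝ, Fin 3 → ℝ) (𝓡 3) n (stereoInv ε) :=
  have : Fact (Module.finrank ℝ (EuclideanSpace ℝ (Fin 4)) = 3 + 1) := ⟨by simp⟩
  (contDiff_stereoVec (n := n) ε).contMDiff.codRestrict_sphere (stereoVec_mem ε)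

theorem contMDiff_param {n : ℕ∞} (ε : ℤˣ) :
    ContMDiff 𝓘(ℝ, Fin 4 → ℝ) (𝓘(ℝ, ℝ).prod (𝓡 3)) n (param ε) := by
  refine ContMDiff.prodMk ?_ ?_
  · exact (contDiff_apply ℝ ℝ (0 : Fin 4)).contMDiff
  · exact (contMDiff_stereoInv ε).comp contDiff_tail.contMDiff

theorem IsCkAt.contDiffAt {G : Type*} [NormedAddCommGroup G] [NormedSpace ℝ G] {n : ℕ∞}
    {f : ℝ × S3 → G} {ε : ℤˣ} {y : Fin 4 → ℝ} (hf : IsCkAt n f (param ε y)) :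
    ContDiffAt ℝ n (f ∘ param ε) y := by
  rw [← contMDiffAt_iff_contDiffAt]
  exact ContMDiffAt.comp y hf (contMDiff_param ε y)

theorem contDiffAt_comp {n : ℕ∞} {h : TensorField} {ε : ℤˣ} {y : Fin 4 → ℝ}
    (hh : IsCkAt n h (param ε y)) (i j : Fin 4) :
    ContDiffAt ℝ n (fun z => comp ε h z i j) y :=
  (hh.contDiffAt.clm_apply (contDiff_coordVec ε i).contDiffAt).clm_apply
    (contDiff_coordVec ε j).contDiffAt

/-- The components of a tensor in the orthonormal frame `∂_j / |∂_j|`. -/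
def hat (h : TensorField) (y : Fin 4 → ℝ) : Matrix (Fin 4) (Fin 4) ℝ :=
  Matrix.of fun i j => comp 1 h y i j / (scale y i * scale y j)

theorem hat_apply_eq (h : TensorField) (y : Fin 4 → ℝ) (i j : Fin 4) :
    hat h y i j = h (param 1 y) ((scale y i)⁻¹ • coordVec 1 y i) ((scale y j)⁻¹ • coordVec 1 y j) := by
  simp [hat, comp]
  field_simp

theorem isTangent_smul {p : ℝ × S3} {V : Amb} (hV : IsTangent p V) (c : ℝ) :
    IsTangent p (c • V) := by
  unfold IsTangent at *
  rw [Prod.smul_snd, inner_smul_right, hV, mul_zero]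

theorem abs_hat_sub_le {δ : ℝ} {h : TensorField} {y : Fin 4 → ℝ} (hδ : IsCloseAt δ h (param 1 y))
    (i j : Fin 4) : |hat h y i j - (Matrix.diagonal mink) i j| ≤ δ := by
  have hn : ∀ i, gHat (param 1 y) ((scale y i)⁻¹ • coordVec 1 y i)
      ((scale y i)⁻¹ • coordVec 1 y i) = 1 := fun i => by
    have h1 : gHat (param 1 y) (coordVec 1 y i) (coordVec 1 y i) = scale y i ^ 2 := by
      have := congrFun (congrFun (comp_gHat 1 y) i) i
      rw [Matrix.diagonal_apply_eq] at this
      rw [← this]; rfl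
    have := (scale_pos y i).ne'
    simp only [map_smul, smul_apply, smul_eq_mul, h1]
    field_simp
  have he : eta (param 1 y) ((scale y i)⁻¹ • coordVec 1 y i) ((scale y j)⁻¹ • coordVec 1 y j)
      = (Matrix.diagonal mink) i j := by
    have h1 : eta (param 1 y) (coordVec 1 y i) (coordVec 1 y j)
        = Matrix.diagonal (fun j => mink j * scale y j ^ 2) i j := by
      have := congrFun (congrFun (comp_eta 1 y) i) j
      rw [← this]; rfl
    have := (scale_pos y i).ne'
    simp only [map_smul, smul_apply, smul_eq_mul, h1]
    by_cases hij : i = j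
    · subst hij; rw [Matrix.diagonal_apply_eq, Matrix.diagonal_apply_eq]; field_simp
    · rw [Matrix.diagonal_apply_ne _ hij, Matrix.diagonal_apply_ne _ hij]; simp
  rw [hat_apply_eq, ← he]
  exact hδ _ _ (isTangent_smul (isTangent_coordVec 1 y i) _)
    (isTangent_smul (isTangent_coordVec 1 y j) _) (hn i) (hn j)

theorem comp_eq_diagonal_mul_hat (h : TensorField) (y : Fin 4 → ℝ) :
    comp 1 h y = Matrix.diagonal (scale y) * hat h y * Matrix.diagonal (scale y) := by
  ext i j
  rw [Matrix.mul_diagonal, Matrix.diagonal_mul, hat, Matrix.of_apply]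
  have := (scale_pos y i).ne'
  have := (scale_pos y j).ne'
  field_simp

/-- The matrix `|det M|^{1/2} M⁻¹`. -/
def densInv (M : Matrix (Fin 4) (Fin 4) ℝ) : Matrix (Fin 4) (Fin 4) ℝ :=
  Real.sqrt |M.det| • M⁻¹

theorem sqrt_det_comp (h : TensorField) (y : Fin 4 → ℝ) :
    Real.sqrt |(comp 1 h y).det| = conf (Fin.tail y) ^ 3 * Real.sqrt |(hat h y).det| := by
  have hc := conf_pos (Fin.tail y)
  have hd : (Matrix.diagonal (scale y)).det = conf (Fin.tail y) ^ 3 := by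
    rw [Matrix.det_diagonal, Fin.prod_univ_succ]; simp [scale_zero, scale_succ]
  rw [comp_eq_diagonal_mul_hat, Matrix.det_mul, Matrix.det_mul, hd]
  have : |conf (Fin.tail y) ^ 3 * (hat h y).det * conf (Fin.tail y) ^ 3|
      = (conf (Fin.tail y) ^ 3) ^ 2 * |(hat h y).det| := by
    rw [abs_mul, abs_mul, abs_of_pos (by positivity : 0 < conf (Fin.tail y) ^ 3)]; ring
  rw [this, Real.sqrt_mul (by positivity), Real.sqrt_sq (by positivity)]

/-- Separates the `T`-independent conformal weights, singular at the south pole, from the frame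
components `hat h`, to which the bounds on `h - η` apply uniformly. -/
theorem densInv_comp (h : TensorField) (y : Fin 4 → ℝ) (j k : Fin 4) :
    densInv (comp 1 h y) j k
      = conf (Fin.tail y) ^ 3 * densInv (hat h y) j k / (scale y j * scale y k) := by
  have hinv : (Matrix.diagonal (scale y))⁻¹ = Matrix.diagonal fun j => (scale y j)⁻¹ := by
    apply Matrix.inv_eq_right_inv
    rw [Matrix.diagonal_mul_diagonal]
    have : ∀ j, scale y j * (scale y j)⁻¹ = 1 := fun j => mul_inv_cancel₀ (scale_pos y j).ne'
    simp [this]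
  have h1 : (comp 1 h y)⁻¹ j k = (hat h y)⁻¹ j k / (scale y j * scale y k) := by
    rw [comp_eq_diagonal_mul_hat, Matrix.mul_inv_rev, Matrix.mul_inv_rev, hinv,
      Matrix.diagonal_mul, Matrix.mul_diagonal]
    field_simp
  unfold densInv
  rw [Matrix.smul_apply, Matrix.smul_apply, sqrt_det_comp, h1]
  simp only [smul_eq_mul]
  ring

theorem isSymm_comp {h : TensorField} {y : Fin 4 → ℝ} (hL : IsLorentzianAt h (param 1 y)) :
    (comp 1 h y).IsSymm := by
  ext i j
  exact hL.1 _ _ (isTangent_coordVec 1 y j) (isTangent_coordVec 1 y i)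

theorem isSymm_densInv {M : Matrix (Fin 4) (Fin 4) ℝ} (hM : M.IsSymm) : (densInv M).IsSymm := by
  unfold densInv
  rw [Matrix.IsSymm, Matrix.transpose_smul, Matrix.transpose_nonsing_inv, hM.eq]

end

/-! ### The density `|det M|^{1/2} M⁻¹` near the Minkowski matrix. -/

section

theorem contDiff_det {ι : Type*} [Fintype ι] [DecidableEq ι] {E : Type*} [NormedAddCommGroup E]
    [NormedSpace ℝ E] {n : WithTop ℕ∞} {A : E → Matrix ι ι ℝ}
    (hA : ∀ i j, ContDiff ℝ n fun x => A x i j) : ContDiff ℝ n fun x => (A x).det := by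
  simp only [Matrix.det_apply']
  exact ContDiff.sum fun σ _ => contDiff_const.mul (contDiff_prod fun i _ => hA _ _)

/-- By Cramer's rule the inverse is the adjugate over the determinant. The entries of the adjugate
and the determinant are polynomials, and `√|·|` is smooth away from `0`. -/
theorem contDiffAt_densInv {n : ℕ∞} (M : Fin 4 → Fin 4 → ℝ)
    (hM : (Matrix.of M).det ≠ 0) (j k : Fin 4) :
    ContDiffAt ℝ n (fun M : Fin 4 → Fin 4 → ℝ => densInv (Matrix.of M) j k) M := by
  have hdet : ContDiff ℝ n fun M : Fin 4 → Fin 4 → ℝ => (Matrix.of M).det :=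
    contDiff_det (n := n) fun i j => contDiff_apply_apply ℝ ℝ i j
  have hadj : ContDiff ℝ n fun M : Fin 4 → Fin 4 → ℝ => (Matrix.of M).adjugate j k := by
    simp only [Matrix.adjugate_apply]
    refine contDiff_det fun a b => ?_
    simp only [Matrix.updateRow_apply]
    split_ifs
    · exact contDiff_const
    · exact contDiff_apply_apply ℝ ℝ a b
  have habs : ContDiffAt ℝ n (fun M : Fin 4 → Fin 4 → ℝ => |(Matrix.of M).det|) M :=
    (hdet.contDiffAt (x := M)).abs hM
  have h1 := habs.sqrt (abs_ne_zero.2 hM)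
  have h2 := (hdet.contDiffAt (x := M)).inv hM
  refine (h1.mul (h2.mul hadj.contDiffAt)).congr_of_eventuallyEq (Filter.Eventually.of_forall ?_)
  intro M
  simp [densInv, Matrix.inv_def, Ring.inverse_eq_inv']

theorem det_diagonal_mink : (Matrix.diagonal mink).det = -1 := by
  rw [Matrix.det_diagonal, Fin.prod_univ_four]
  simp [mink]

theorem densInv_diagonal_mink : densInv (Matrix.diagonal mink) = Matrix.diagonal mink := by
  have : (Matrix.diagonal mink)⁻¹ = Matrix.diagonal mink := by
    apply Matrix.inv_eq_right_inv
    rw [Matrix.diagonal_mul_diagonal]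
    have : ∀ j, mink j * mink j = 1 := fun j => by unfold mink; split_ifs <;> norm_num
    simp [this]
  rw [densInv, det_diagonal_mink, this]
  simp

/-- Near the Minkowski metric, `|det M|^{1/2} M⁻¹` is close to the Minkowski metric and has bounded
first derivatives. -/
theorem exists_densInv_bounds {κ : ℝ} (hκ : 0 < κ) :
    ∃ δ L : ℝ, 0 < δ ∧ 0 < L ∧ ∀ M : Fin 4 → Fin 4 → ℝ,
      (∀ i j, |M i j - Matrix.diagonal mink i j| ≤ δ) →
      (Matrix.of M).det ≠ 0 ∧ Real.sqrt |(Matrix.of M).det| ≤ 2 ∧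
      ∀ j k, |densInv (Matrix.of M) j k - Matrix.diagonal mink j k| ≤ κ ∧
        ‖fderiv ℝ (fun M : Fin 4 → Fin 4 → ℝ => densInv (Matrix.of M) j k) M‖ ≤ L := by
  set η : Fin 4 → Fin 4 → ℝ := fun i j => Matrix.diagonal mink i j with hη
  have hofη : Matrix.of η = Matrix.diagonal mink := rfl
  have hdet : Continuous fun M : Fin 4 → Fin 4 → ℝ => (Matrix.of M).det :=
    (contDiff_det (n := 0) fun i j => contDiff_apply_apply ℝ ℝ i j).continuous
  have hη0 : (Matrix.of η).det ≠ 0 := by rw [hofη, det_diagonal_mink]; norm_num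
  have e1 : ∀ᶠ M in nhds η, (Matrix.of M).det ≠ 0 := hdet.continuousAt.eventually_ne hη0
  have e2 : ∀ᶠ M in nhds η, Real.sqrt |(Matrix.of M).det| ≤ 2 := by
    have hc : Continuous fun M : Fin 4 → Fin 4 → ℝ => Real.sqrt |(Matrix.of M).det| :=
      hdet.abs.sqrt
    refine (hc.continuousAt.eventually_lt (g := fun _ => (2 : ℝ)) continuousAt_const ?_).mono
      fun M h => h.le
    rw [hofη, det_diagonal_mink]; norm_num
  have e3 : ∀ j k, ∀ᶠ M in nhds η,
      |densInv (Matrix.of M) j k - Matrix.diagonal mink j k| ≤ κ := fun j k => by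
    have hc := (contDiffAt_densInv (n := 0) η hη0 j k).continuousAt
    have hc2 := (hc.sub (continuousAt_const (y := Matrix.diagonal mink j k))).abs
    refine (hc2.eventually_lt (g := fun _ => κ) continuousAt_const ?_).mono fun M h => h.le
    change |densInv (Matrix.of η) j k - Matrix.diagonal mink j k| < κ
    rwa [hofη, densInv_diagonal_mink, sub_self, abs_zero]
  let f : Fin 4 → Fin 4 → (Fin 4 → Fin 4 → ℝ) → ℝ :=
    fun j k M => densInv (Matrix.of M) j k
  -- The sum over all entries gives one bound for all `j, k`; the added `1` leaves room for
  -- continuity of the derivative near `η`.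
  set L : ℝ := (∑ j, ∑ k, ‖fderiv ℝ (f j k) η‖) + 1 with hL
  have e4 : ∀ j k, ∀ᶠ M in nhds η, ‖fderiv ℝ (f j k) M‖ ≤ L := fun j k => by
    have hc : ContinuousAt (fderiv ℝ (f j k)) η :=
      ((contDiffAt_densInv (n := 1) η hη0 j k).fderiv_right (m := 0) le_rfl).continuousAt
    refine (hc.norm.eventually_lt (g := fun _ => L) continuousAt_const ?_).mono fun M h => h.le
    have h1 := Finset.single_le_sum (f := fun k => ‖fderiv ℝ (f j k) η‖)
      (fun _ _ => norm_nonneg _) (Finset.mem_univ k)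
    have h2 := Finset.single_le_sum (f := fun j => ∑ k, ‖fderiv ℝ (f j k) η‖)
      (fun _ _ => Finset.sum_nonneg fun _ _ => norm_nonneg _) (Finset.mem_univ j)
    beta_reduce at h1 h2
    linarith
  have e34 : ∀ᶠ M in nhds η, ∀ j k, |densInv (Matrix.of M) j k - Matrix.diagonal mink j k| ≤ κ ∧
      ‖fderiv ℝ (f j k) M‖ ≤ L :=
    Filter.eventually_all.2 fun j => Filter.eventually_all.2 fun k => (e3 j k).and (e4 j k)
  -- Closed balls of the sup norm on `Fin 4 → Fin 4 → ℝ` are exactly the entrywise conditions `|M i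
  -- j - η i j| ≤ δ`.
  obtain ⟨δ, hδ, hball⟩ := Metric.nhds_basis_closedBall.eventually_iff.1 (e1.and (e2.and e34))
  refine ⟨δ, L, hδ, ?_, fun M hM => hball ?_⟩
  · have : 0 ≤ ∑ j, ∑ k, ‖fderiv ℝ (f j k) η‖ :=
      Finset.sum_nonneg fun _ _ => Finset.sum_nonneg fun _ _ => norm_nonneg _
    linarith
  · rw [Metric.mem_closedBall, dist_pi_le_iff hδ.le]
    intro i
    rw [dist_pi_le_iff hδ.le]
    intro j
    rw [Real.dist_eq]
    exact hM i j

theorem pd_zero_mul_tail {f : (Fin 4 → ℝ) → ℝ} {y : Fin 4 → ℝ} (hf : DifferentiableAt ℝ f y)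
    {g : (Fin 4 → ℝ) → ℝ} (hg : DifferentiableAt ℝ g y) (hg0 : pd 0 g y = 0) :
    pd 0 (fun z => f z * g z) y = pd 0 f y * g y := by
  unfold pd at *
  rw [fderiv_fun_mul hf hg]
  simp [hg0, mul_comm]

theorem differentiableAt_hat {h : TensorField} {y : Fin 4 → ℝ}
    (hh : IsCkAt 1 h (param 1 y)) (i j : Fin 4) :
    ContDiffAt ℝ 1 (fun z => hat h z i j) y :=
  (contDiffAt_comp hh i j).div ((contDiff_scale i).mul (contDiff_scale j)).contDiffAt
    (mul_pos (scale_pos y i) (scale_pos y j)).ne'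

theorem isCkAt_eta {n : ℕ∞} (p : ℝ × S3) : IsCkAt n eta p := contMDiffAt_const

theorem comp_sub (ε : ℤˣ) (h k : TensorField) (y : Fin 4 → ℝ) (i j : Fin 4) :
    comp ε (h - k) y i j = comp ε h y i j - comp ε k y i j := by
  simp [comp]

/-- Neither the scaling factors nor the components of `η` depend on `T`, so `∂_T` of a frame
component of `h` equals the scaled `∂_T` of the component of `h - η`. -/
theorem pd_zero_hat {h : TensorField} {y : Fin 4 → ℝ} (hh : IsCkAt 1 h (param 1 y))
    (i j : Fin 4) : |pd 0 (fun z => hat h z i j) y| ≤ nablaNorm (h - eta) (param 1 y) := by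
  have hs : ∀ g : (Fin 4 → ℝ) → ℝ, DifferentiableAt ℝ g y →
      pd 0 (fun z => g z / (scale z i * scale z j)) y = pd 0 g y / (scale y i * scale y j) := by
    intro g hg
    simp only [div_eq_mul_inv]
    refine pd_zero_mul_tail hg ?_ ?_
    · have hc : ContDiff ℝ 1 fun z => (scale z i * scale z j)⁻¹ :=
        ((contDiff_scale i).mul (contDiff_scale j)).inv
          fun z => (mul_pos (scale_pos z i) (scale_pos z j)).ne'
      exact hc.differentiable one_ne_zero y
    · exact pd_zero_of_tail _ (fun x => ((if i = 0 then 1 else conf x) *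
        (if j = 0 then 1 else conf x))⁻¹) (fun z => rfl) y
  refine le_trans (le_of_eq ?_) (abs_pd_comp_le_nablaNorm (h - eta) i j y)
  have hd := (contDiffAt_comp hh i j).differentiableAt one_ne_zero
  have hde := (contDiffAt_comp (isCkAt_eta (n := 1) (param 1 y)) i j).differentiableAt one_ne_zero
  have h0 : pd 0 (fun z => comp 1 eta z i j) y = 0 :=
    pd_zero_of_tail _ (fun x => (Matrix.diagonal fun j : Fin 4 =>
      mink j * (if j = 0 then 1 else conf x) ^ 2) i j) (fun z => by rw [comp_eta]; rfl) y
  have h1 : pd 0 (fun z => comp 1 (h - eta) z i j) y = pd 0 (fun z => comp 1 h z i j) y := by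
    simp only [comp_sub]
    unfold pd at *
    rw [fderiv_fun_sub hd hde, sub_apply, h0, sub_zero]
  rw [h1, ← hs _ hd]
  rfl

/-- If the derivative of `|det M|^{1/2} M⁻¹` at `M = hat h y` is at most `L`, then the time
derivative of `|det h|^{1/2} h⁻¹` is controlled by `∇(h - η)`. -/
theorem abs_pd_densInv_hat_le {h : TensorField} {y : Fin 4 → ℝ} (hh : IsCkAt 1 h (param 1 y))
    (hdet : (hat h y).det ≠ 0) {L : ℝ} (j k : Fin 4)
    (hL : ‖fderiv ℝ (fun M : Fin 4 → Fin 4 → ℝ => densInv (Matrix.of M) j k)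
      (fun a b => hat h y a b)‖ ≤ L) :
    |pd 0 (fun z => densInv (hat h z) j k) y| ≤ L * nablaNorm (h - eta) (param 1 y) := by
  have hd : HasFDerivAt (fun z a b => hat h z a b)
      (ContinuousLinearMap.pi fun a => ContinuousLinearMap.pi fun b =>
        fderiv ℝ (fun z => hat h z a b) y) y := by
    rw [hasFDerivAt_pi]
    intro a
    rw [hasFDerivAt_pi]
    intro b
    exact ((differentiableAt_hat hh a b).differentiableAt one_ne_zero).hasFDerivAt
  have hf := ((contDiffAt_densInv (n := 1) (fun a b => hat h y a b) hdet j k).differentiableAt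
    one_ne_zero).hasFDerivAt
  have hc := hf.comp y hd
  have he : pd 0 (fun z => densInv (hat h z) j k) y
      = fderiv ℝ (fun M : Fin 4 → Fin 4 → ℝ => densInv (Matrix.of M) j k)
        (fun a b => hat h y a b) (fun a b => pd 0 (fun z => hat h z a b) y) := by
    unfold pd
    change fderiv ℝ ((fun M : Fin 4 → Fin 4 → ℝ => densInv (Matrix.of M) j k) ∘
      fun z a b => hat h z a b) y _ = _
    rw [hc.fderiv]
    rfl
  have hN : 0 ≤ nablaNorm (h - eta) (param 1 y) := Real.sqrt_nonneg _
  rw [he, ← Real.norm_eq_abs]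
  refine (ContinuousLinearMap.le_opNorm _ _).trans ?_
  refine mul_le_mul hL ?_ (norm_nonneg _) ((norm_nonneg _).trans hL)
  rw [pi_norm_le_iff_of_nonneg hN]
  intro a
  rw [pi_norm_le_iff_of_nonneg hN]
  intro b
  exact pd_zero_hat hh a b

theorem contDiffAt_densInv_hat {h : TensorField} {y : Fin 4 → ℝ} (hh : IsCkAt 1 h (param 1 y))
    (hdet : (hat h y).det ≠ 0) (j k : Fin 4) :
    ContDiffAt ℝ 1 (fun z => densInv (hat h z) j k) y := by
  have hd : ContDiffAt ℝ 1 (fun z a b => hat h z a b) y :=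
    contDiffAt_pi.2 fun a => contDiffAt_pi.2 fun b => differentiableAt_hat hh a b
  exact (contDiffAt_densInv (n := 1) (fun a b => hat h y a b) hdet j k).comp y hd

theorem det_comp_ne_zero {h : TensorField} {y : Fin 4 → ℝ} (hdet : (hat h y).det ≠ 0) :
    (comp 1 h y).det ≠ 0 := by
  have hc := (conf_pos (Fin.tail y)).ne'
  have hd : (Matrix.diagonal (scale y)).det = conf (Fin.tail y) ^ 3 := by
    rw [Matrix.det_diagonal, Fin.prod_univ_succ]; simp [scale_zero, scale_succ]
  rw [comp_eq_diagonal_mul_hat, Matrix.det_mul, Matrix.det_mul, hd]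
  positivity

end

section

/-! ### The gauge function of a star-shaped obstacle -/

/-- The point `x / |x|` of `S²` (an arbitrary point if `x = 0`). -/
def sphereDir (x : EuclideanSpace ℝ (Fin 3)) : S2 :=
  if h : x = 0 then ⟨EuclideanSpace.single 0 1, by simp⟩
  else ⟨‖x‖⁻¹ • x, by simp [norm_smul, norm_ne_zero_iff.2 h]⟩

theorem sphereDir_coe {x : EuclideanSpace ℝ (Fin 3)} (hx : x ≠ 0) :
    (sphereDir x : EuclideanSpace ℝ (Fin 3)) = ‖x‖⁻¹ • x := by
  simp [sphereDir, hx]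

theorem norm_smul_sphereDir (x : EuclideanSpace ℝ (Fin 3)) :
    ‖x‖ • (sphereDir x : EuclideanSpace ℝ (Fin 3)) = x := by
  by_cases hx : x = 0
  · simp [hx]
  · rw [sphereDir_coe hx, smul_smul, mul_inv_cancel₀ (norm_ne_zero_iff.2 hx), one_smul]

theorem sphereDir_smul {c : ℝ} (hc : 0 < c) (x : EuclideanSpace ℝ (Fin 3)) :
    sphereDir (c • x) = sphereDir x := by
  by_cases hx : x = 0
  · simp [hx]
  · apply Subtype.ext
    rw [sphereDir_coe hx, sphereDir_coe (smul_ne_zero hc.ne' hx), norm_smul, smul_smul,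
      Real.norm_eq_abs, abs_of_pos hc]
    congr 1
    field_simp

theorem sphereDir_sphere (θ : S2) : sphereDir (θ : EuclideanSpace ℝ (Fin 3)) = θ := by
  have h1 : ‖(θ : EuclideanSpace ℝ (Fin 3))‖ = 1 := mem_sphere_zero_iff_norm.1 θ.2
  have h0 : (θ : EuclideanSpace ℝ (Fin 3)) ≠ 0 := fun h => by simp [h] at h1
  apply Subtype.ext
  rw [sphereDir_coe h0, h1]; simp

/-- `ContMDiff.codRestrict_sphere` needs a map into the sphere that is defined and smooth
everywhere. Replacing `x` by `x₀ + χ(x)(x - x₀)`, with a bump `χ` supported where `|x - x₀| < |x₀|`,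
changes nothing near `x₀` and never gives `0`. -/
theorem contMDiffAt_sphereDir {n : ℕ∞} {x₀ : EuclideanSpace ℝ (Fin 3)} (hx₀ : x₀ ≠ 0) :
    ContMDiffAt 𝓘(ℝ, EuclideanSpace ℝ (Fin 3)) (𝓡 2) n sphereDir x₀ := by
  have hpos : 0 < ‖x₀‖ := norm_pos_iff.2 hx₀
  let χ : ContDiffBump x₀ := ⟨‖x₀‖ / 4, ‖x₀‖ / 2, by positivity, by linarith⟩
  let v : EuclideanSpace ℝ (Fin 3) → EuclideanSpace ℝ (Fin 3) := fun x => x₀ + χ x • (x - x₀)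
  have hv : ∀ x, v x ≠ 0 := by
    intro x hx
    have h1 : ‖χ x • (x - x₀)‖ < ‖x₀‖ := by
      by_cases hd : dist x x₀ < ‖x₀‖ / 2
      · rw [norm_smul, Real.norm_eq_abs, abs_of_nonneg χ.nonneg, ← dist_eq_norm]
        have := χ.le_one (x := x)
        have := χ.nonneg (x := x)
        have := dist_nonneg (x := x) (y := x₀)
        nlinarith
      · rw [χ.zero_of_le_dist (not_lt.1 hd), zero_smul, norm_zero]; exact hpos
    have h2 : χ x • (x - x₀) = -x₀ := by
      rw [eq_neg_iff_add_eq_zero, add_comm]; exact hx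
    rw [h2, norm_neg] at h1
    exact lt_irrefl _ h1
  have hvs : ContDiff ℝ n v :=
    contDiff_const.add (χ.contDiff.smul (contDiff_id.sub contDiff_const))
  have hg : ContDiff ℝ n fun x => ‖v x‖⁻¹ • v x :=
    ((hvs.norm ℝ hv).inv fun x => norm_ne_zero_iff.2 (hv x)).smul hvs
  have hmem : ∀ x, ‖v x‖⁻¹ • v x ∈ Metric.sphere (0 : EuclideanSpace ℝ (Fin 3)) 1 := fun x => by
    simp [norm_smul, norm_ne_zero_iff.2 (hv x)]
  have hfact : Fact (Module.finrank ℝ (EuclideanSpace ℝ (Fin 3)) = 2 + 1) := ⟨by simp⟩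
  have hc := ContMDiff.codRestrict_sphere (n := 2) hg.contMDiff hmem
  refine (hc x₀).congr_of_eventuallyEq ?_
  filter_upwards [χ.eventuallyEq_one, isOpen_ne.mem_nhds hx₀] with x hx hx0
  replace hx0 : x ≠ 0 := hx0
  apply Subtype.ext
  have : v x = x := by simp only [v, hx, Pi.one_apply, one_smul]; abel
  rw [sphereDir_coe hx0]
  simp [Set.codRestrict, this]

/-- The Minkowski gauge `|x| / φ(x/|x|)` of the obstacle. -/
def radialGauge (φ : S2 → ℝ) (x : Fin 3 → ℝ) : ℝ :=
  ‖(WithLp.toLp 2 x : EuclideanSpace ℝ (Fin 3))‖ / φ (sphereDir (WithLp.toLp 2 x))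

theorem norm_toLp_sq (x : Fin 3 → ℝ) :
    ‖(WithLp.toLp 2 x : EuclideanSpace ℝ (Fin 3))‖ ^ 2 = rsq x := by
  rw [EuclideanSpace.norm_sq_eq]; simp [rsq]

theorem norm_toLp (x : Fin 3 → ℝ) :
    ‖(WithLp.toLp 2 x : EuclideanSpace ℝ (Fin 3))‖ = Real.sqrt (rsq x) := by
  rw [← norm_toLp_sq, Real.sqrt_sq (norm_nonneg _)]

theorem radialGauge_smul (φ : S2 → ℝ) {c : ℝ} (hc : 0 < c) (x : Fin 3 → ℝ) :
    radialGauge φ (c • x) = c * radialGauge φ x := by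
  unfold radialGauge
  rw [WithLp.toLp_smul, sphereDir_smul hc, norm_smul, Real.norm_eq_abs, abs_of_pos hc, mul_div_assoc]

theorem radialGauge_zero (φ : S2 → ℝ) : radialGauge φ 0 = 0 := by simp [radialGauge]

theorem radialGauge_nonneg {φ : S2 → ℝ} (hφ : ∀ θ, 0 < φ θ) (x : Fin 3 → ℝ) :
    0 ≤ radialGauge φ x := div_nonneg (norm_nonneg _) (hφ _).le

theorem mem_obstacle_iff {φ : S2 → ℝ} (hφ : ∀ θ, 0 < φ θ) (z : EuclideanSpace ℝ (Fin 3)) :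
    z ∈ obstacle φ ↔ radialGauge φ z.ofLp ≤ 1 := by
  unfold radialGauge
  rw [WithLp.toLp_ofLp, div_le_one (hφ _)]
  constructor
  · rintro ⟨r, θ, hr, hrφ, rfl⟩
    rcases hr.eq_or_lt with h | h
    · subst h; simp [(hφ _).le]
    · rw [sphereDir_smul h, sphereDir_sphere, norm_smul, mem_sphere_zero_iff_norm.1 θ.2, mul_one,
        Real.norm_eq_abs, abs_of_pos h]
      exact hrφ
  · exact fun h => ⟨‖z‖, sphereDir z, norm_nonneg _, h, (norm_smul_sphereDir z).symm⟩

theorem mem_obstacleBoundary {φ : S2 → ℝ} (hφ : ∀ θ, 0 < φ θ) (z : EuclideanSpace ℝ (Fin 3))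
    (hz : radialGauge φ z.ofLp = 1) : z ∈ obstacleBoundary φ := by
  unfold radialGauge at hz
  rw [WithLp.toLp_ofLp, div_eq_one_iff_eq (hφ _).ne'] at hz
  exact ⟨sphereDir z, by rw [← hz, norm_smul_sphereDir]⟩

/-- One may take `μ = 1 / max φ`. This constant measures the size of the obstacle, and the smallness
required of `δ` depends on it. -/
theorem exists_le_radialGauge {φ : S2 → ℝ} (hc : Continuous φ) (hφ : ∀ θ, 0 < φ θ) :
    ∃ μ : ℝ, 0 < μ ∧ ∀ x, μ * Real.sqrt (rsq x) ≤ radialGauge φ x := by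
  obtain ⟨θ, _, hθ⟩ := isCompact_univ.exists_isMaxOn
    ⟨sphereDir 0, Set.mem_univ _⟩ hc.continuousOn
  refine ⟨(φ θ)⁻¹, inv_pos.2 (hφ θ), fun x => ?_⟩
  unfold radialGauge
  rw [norm_toLp, div_eq_inv_mul]
  exact mul_le_mul_of_nonneg_right (inv_anti₀ (hφ _) (hθ (Set.mem_univ _))) (Real.sqrt_nonneg _)

theorem exists_radialGauge_le {φ : S2 → ℝ} (hc : Continuous φ) (hφ : ∀ θ, 0 < φ θ) :
    ∃ μ : ℝ, 0 < μ ∧ ∀ x, radialGauge φ x ≤ μ * Real.sqrt (rsq x) := by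
  obtain ⟨θ, _, hθ⟩ := isCompact_univ.exists_isMinOn
    ⟨sphereDir 0, Set.mem_univ _⟩ hc.continuousOn
  refine ⟨(φ θ)⁻¹, inv_pos.2 (hφ θ), fun x => ?_⟩
  unfold radialGauge
  rw [norm_toLp, div_eq_inv_mul]
  exact mul_le_mul_of_nonneg_right (inv_anti₀ (hφ _) (hθ (Set.mem_univ _))) (Real.sqrt_nonneg _)

theorem contDiff_toLp {n : WithTop ℕ∞} :
    ContDiff ℝ n (fun x : Fin 3 → ℝ => (WithLp.toLp 2 x : EuclideanSpace ℝ (Fin 3))) := by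
  rw [contDiff_euclidean]; intro i; exact contDiff_apply ℝ ℝ i

theorem contDiffAt_radialGauge {φ : S2 → ℝ} (hs : ContMDiff (𝓡 2) 𝓘(ℝ, ℝ) ∞ φ)
    (hφ : ∀ θ, 0 < φ θ) {x : Fin 3 → ℝ} (hx : x ≠ 0) :
    ContDiffAt ℝ 1 (radialGauge φ) x := by
  have hx' : (WithLp.toLp 2 x : EuclideanSpace ℝ (Fin 3)) ≠ 0 := by
    intro h; exact hx (by simpa using h)
  have h1 : ContDiffAt ℝ 1 (fun z => φ (sphereDir z)) (WithLp.toLp 2 x) := by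
    rw [← contMDiffAt_iff_contDiffAt]
    exact ContMDiffAt.comp _ ((hs.of_le (by exact_mod_cast le_top)) _)
      (contMDiffAt_sphereDir (n := 1) hx')
  have h2 := ((contDiffAt_norm ℝ hx').div h1 (hφ _).ne').comp x contDiff_toLp.contDiffAt
  exact h2

theorem continuous_radialGauge {φ : S2 → ℝ} (hs : ContMDiff (𝓡 2) 𝓘(ℝ, ℝ) ∞ φ)
    (hφ : ∀ θ, 0 < φ θ) : Continuous (radialGauge φ) := by
  rw [continuous_iff_continuousAt]
  intro x
  by_cases hx : x = 0
  · subst hx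
    obtain ⟨μ, _, hμ⟩ := exists_radialGauge_le hs.continuous hφ
    have hc : Continuous fun x => μ * Real.sqrt (rsq x) :=
      continuous_const.mul (contDiff_rsq (n := 0)).continuous.sqrt
    have h0 := hc.tendsto 0
    have : μ * Real.sqrt (rsq 0) = 0 := by simp [rsq]
    rw [this] at h0
    rw [ContinuousAt, radialGauge_zero]
    exact squeeze_zero (radialGauge_nonneg hφ) hμ h0
  · exact (contDiffAt_radialGauge hs hφ hx).continuousAt

/-- Euler's identity for a function that is positively homogeneous of degree one: differentiate `c ↦
radialGauge φ (c • x)` at `c = 1` in two ways. -/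
theorem radialGauge_euler {φ : S2 → ℝ} (hs : ContMDiff (𝓡 2) 𝓘(ℝ, ℝ) ∞ φ)
    (hφ : ∀ θ, 0 < φ θ) {x : Fin 3 → ℝ} (hx : x ≠ 0) :
    fderiv ℝ (radialGauge φ) x x = radialGauge φ x := by
  have hd := ((contDiffAt_radialGauge hs hφ hx).differentiableAt one_ne_zero).hasFDerivAt
  have h1 : HasDerivAt (fun c : ℝ => c • x) x 1 := by
    simpa using (hasDerivAt_id (1 : ℝ)).smul_const x
  have h2 : HasDerivAt (fun c : ℝ => radialGauge φ (c • x)) (fderiv ℝ (radialGauge φ) x x) 1 := by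
    have hd' : HasFDerivAt (radialGauge φ) (fderiv ℝ (radialGauge φ) x) ((1 : ℝ) • x) := by
      rwa [one_smul]
    exact hd'.comp_hasDerivAt 1 h1
  have h3 : HasDerivAt (fun c : ℝ => radialGauge φ (c • x)) (radialGauge φ x) 1 := by
    have h4 : HasDerivAt (fun c : ℝ => c * radialGauge φ x) (radialGauge φ x) 1 := by
      simpa using (hasDerivAt_id (1 : ℝ)).mul_const (radialGauge φ x)
    refine h4.congr_of_eventuallyEq ?_
    filter_upwards [lt_mem_nhds (zero_lt_one (α := ℝ))] with c hc
    exact radialGauge_smul φ hc x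
  exact h2.unique h3

/-! ### The defining function of the domain -/

/-- A defining function of the domain `Y` in the stereographic chart. -/
def Psi (φ : S2 → ℝ) (y : Fin 4 → ℝ) : ℝ :=
  radialGauge φ (Fin.tail y) - 1 + Real.sin (y 0 / 2) ^ 2 * (1 + rsq (Fin.tail y))

theorem continuous_Psi {φ : S2 → ℝ} (hs : ContMDiff (𝓡 2) 𝓘(ℝ, ℝ) ∞ φ)
    (hφ : ∀ θ, 0 < φ θ) : Continuous (Psi φ) := by
  have h1 := (continuous_radialGauge hs hφ).comp (contDiff_tail (n := 0)).continuous
  have h2 : Continuous fun y : Fin 4 → ℝ => rsq (Fin.tail y) :=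
    (contDiff_rsq (n := 0)).continuous.comp (contDiff_tail (n := 0)).continuous
  unfold Psi
  exact (h1.sub continuous_const).add (((Real.continuous_sin.comp
    ((continuous_apply 0).div_const 2)).pow 2).mul (continuous_const.add h2))

theorem contDiffAt_Psi {φ : S2 → ℝ} (hs : ContMDiff (𝓡 2) 𝓘(ℝ, ℝ) ∞ φ)
    (hφ : ∀ θ, 0 < φ θ) {y : Fin 4 → ℝ} (hy : Fin.tail y ≠ 0) : ContDiffAt ℝ 1 (Psi φ) y := by
  have h1 := (contDiffAt_radialGauge hs hφ hy).comp y contDiff_tail.contDiffAt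
  have h2 : ContDiff ℝ 1 fun y : Fin 4 → ℝ => rsq (Fin.tail y) := contDiff_rsq.comp contDiff_tail
  have h3 : ContDiff ℝ 1 fun y : Fin 4 → ℝ => Real.sin (y 0 / 2) ^ 2 * (1 + rsq (Fin.tail y)) :=
    ((Real.contDiff_sin.comp ((contDiff_apply ℝ ℝ 0).div_const 2)).pow 2).mul
      (contDiff_const.add h2)
  exact (h1.sub contDiffAt_const).add h3.contDiffAt

theorem hasFDerivAt_Psi {φ : S2 → ℝ} (hs : ContMDiff (𝓡 2) 𝓘(ℝ, ℝ) ∞ φ)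
    (hφ : ∀ θ, 0 < φ θ) {y : Fin 4 → ℝ} (hy : Fin.tail y ≠ 0) (v : Fin 4 → ℝ) :
    fderiv ℝ (Psi φ) y v = fderiv ℝ (radialGauge φ) (Fin.tail y) (Fin.tail v)
      + Real.sin (y 0 / 2) * Real.cos (y 0 / 2) * (1 + rsq (Fin.tail y)) * v 0
      + Real.sin (y 0 / 2) ^ 2 * ∑ i, 2 * Fin.tail y i * Fin.tail v i := by
  have h1 : HasFDerivAt (fun z : Fin 4 → ℝ => radialGauge φ (Fin.tail z))
      ((fderiv ℝ (radialGauge φ) (Fin.tail y)).comp tailCLM) y :=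
    HasFDerivAt.comp y (f := tailCLM)
      ((contDiffAt_radialGauge hs hφ hy).differentiableAt one_ne_zero).hasFDerivAt
      tailCLM.hasFDerivAt
  have h2 : HasFDerivAt (fun z : Fin 4 → ℝ => rsq (Fin.tail z)) _ y :=
    HasFDerivAt.comp y (f := tailCLM) (hasFDerivAt_rsq (Fin.tail y)) tailCLM.hasFDerivAt
  have h3 : HasFDerivAt (fun z : Fin 4 → ℝ => z 0 * (1 / 2)) _ y :=
    (hasFDerivAt_apply (𝕜 := ℝ) (F' := fun _ : Fin 4 => ℝ) 0 y).mul_const (1 / 2)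
  have h4 := ((Real.hasDerivAt_sin (y 0 * (1 / 2))).comp_hasFDerivAt y h3).pow 2
  have h5 := (h1.sub_const 1).add (h4.mul (h2.const_add 1))
  have h6 : HasFDerivAt (Psi φ) _ y := h5.congr_of_eventuallyEq
    (Filter.Eventually.of_forall fun z => by simp [Psi, div_eq_mul_inv])
  rw [h6.fderiv]
  simp [tailCLM_apply, div_eq_mul_inv, Fin.sum_univ_three]
  ring

end

section

/-! ### The domain in the stereographic chart -/

theorem one_add_stereoVec_zero (x : Fin 3 → ℝ) : 1 + stereoVec 1 x 0 = conf x := by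
  have hp := (one_add_rsq_pos x).ne'
  rw [stereoVec_zero, conf]
  simp
  field_simp
  ring

theorem stereoVec_succ_eq (x : Fin 3 → ℝ) : (fun i : Fin 3 => stereoVec 1 x i.succ) = conf x • x := by
  ext i
  rw [stereoVec_succ, conf, Pi.smul_apply, smul_eq_mul]; ring

/-- This is where `Psi` comes from. On the sphere, with `X = (X₀, X')`, the image of the obstacle is
`gauge(X') ≤ X₀ + cos T`; dividing by the conformal factor `1 + X₀`, where `X' = (1 + X₀) x`, gives
`Psi ≤ 0`. -/
theorem conf_mul_Psi (φ : S2 → ℝ) (y : Fin 4 → ℝ) :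
    conf (Fin.tail y) * Psi φ y = radialGauge φ (fun i => stereoVec 1 (Fin.tail y) i.succ)
      - (stereoVec 1 (Fin.tail y) 0 + Real.cos (y 0)) := by
  rw [stereoVec_succ_eq, radialGauge_smul φ (conf_pos _)]
  have h1 := one_add_stereoVec_zero (Fin.tail y)
  have h2 : Real.cos (y 0) = 1 - 2 * Real.sin (y 0 / 2) ^ 2 := by
    have h := Real.cos_two_mul (y 0 / 2)
    have h' := Real.sin_sq_add_cos_sq (y 0 / 2)
    rw [show 2 * (y 0 / 2) = y 0 by ring] at h
    linarith
  have h3 : conf (Fin.tail y) * (1 + rsq (Fin.tail y)) = 2 :=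
    div_mul_cancel₀ _ (one_add_rsq_pos _).ne'
  unfold Psi
  linear_combination h1 + h2 + Real.sin (y 0 / 2) ^ 2 * h3

theorem sin_penroseR (t r : ℝ) : Real.sin (penroseR t r)
    = 2 * r * (Real.cos (Real.arctan (t + r)) * Real.cos (Real.arctan (t - r))) := by
  have h1 := Real.tan_arctan (t + r)
  have h2 := Real.tan_arctan (t - r)
  have c1 := (Real.cos_arctan_pos (t + r)).ne'
  have c2 := (Real.cos_arctan_pos (t - r)).ne'
  rw [Real.tan_eq_sin_div_cos, div_eq_iff c1] at h1
  rw [Real.tan_eq_sin_div_cos, div_eq_iff c2] at h2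
  rw [penroseR, Real.sin_sub, h1, h2]
  ring

theorem cos_penroseT_add (t r : ℝ) : Real.cos (penroseR t r) + Real.cos (penroseT t r)
    = 2 * (Real.cos (Real.arctan (t + r)) * Real.cos (Real.arctan (t - r))) := by
  rw [penroseR, penroseT, Real.cos_sub, Real.cos_add]; ring

/-- The Penrose map is conformal with factor `cos R + cos T`: the spatial part of its image is `z`
times this positive factor. By homogeneity the obstacle condition on `z` becomes a condition on
`X'`. -/
theorem penroseVec_succ (t : ℝ) (z : EuclideanSpace ℝ (Fin 3)) :
    (fun i : Fin 3 => penroseVec t z i.succ)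
      = (Real.cos (penroseR t ‖z‖) + Real.cos (penroseT t ‖z‖)) • z.ofLp := by
  ext i
  change Real.sin (penroseR t ‖z‖) * (z i / ‖z‖) = _
  rw [sin_penroseR, cos_penroseT_add, Pi.smul_apply, smul_eq_mul]
  by_cases hz : z = 0
  · simp [hz]
  · have := norm_ne_zero_iff.2 hz
    field_simp

theorem penroseVec_zero (t : ℝ) (z : EuclideanSpace ℝ (Fin 3)) :
    penroseVec t z 0 = Real.cos (penroseR t ‖z‖) := rfl

theorem cos_add_cos_penrose_pos (t r : ℝ) :
    0 < Real.cos (penroseR t r) + Real.cos (penroseT t r) := by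
  rw [cos_penroseT_add]
  have := Real.cos_arctan_pos (t + r)
  have := Real.cos_arctan_pos (t - r)
  positivity

theorem Psi_nonpos_of_mem {φ : S2 → ℝ} (hφ : ∀ θ, 0 < φ θ) {y : Fin 4 → ℝ}
    (h : param 1 y ∈ penrose '' (Set.Ici 0 ×ˢ obstacle φ)) : Psi φ y ≤ 0 := by
  obtain ⟨⟨t, z⟩, ⟨-, hz⟩, hp⟩ := h
  have hT : penroseT t ‖z‖ = y 0 := congrArg Prod.fst hp
  have hX : penroseVec t z = stereoVec 1 (Fin.tail y) := congrArg (fun p => (p.2 : EuclideanSpace ℝ (Fin 4))) hp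
  have h1 := conf_mul_Psi φ y
  rw [← hX, penroseVec_succ, penroseVec_zero, ← hT,
    radialGauge_smul φ (cos_add_cos_penrose_pos t ‖z‖)] at h1
  have h2 := (mem_obstacle_iff hφ z).1 hz
  have h3 := cos_add_cos_penrose_pos t ‖z‖
  have h4 : conf (Fin.tail y) * Psi φ y ≤ 0 := by
    rw [h1]; nlinarith
  by_contra hneg
  have := mul_pos (conf_pos (Fin.tail y)) (not_le.1 hneg)
  linarith

/-- The preimage is explicit: `t = sin T / d` and `z = X' / d` with `d = X₀ + cos T`. The condition
`Psi ≤ 0` says `gauge(X') ≤ d`, which makes `d` positive and puts the point in the Penrose diamond.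
-/
theorem exists_penrose_eq {φ : S2 → ℝ} (hφ : ∀ θ, 0 < φ θ) {y : Fin 4 → ℝ} (h0 : 0 ≤ y 0)
    (hπ : y 0 < Real.pi) (hΨ : Psi φ y ≤ 0) :
    ∃ t z, 0 ≤ t ∧ penrose (t, z) = param 1 y ∧ radialGauge φ z.ofLp ≤ 1 ∧
      (Psi φ y = 0 → radialGauge φ z.ofLp = 1) := by
  set x := Fin.tail y with hx
  set X := stereoVec 1 x with hXdef
  have h1 := conf_mul_Psi φ y
  rw [← hx, ← hXdef] at h1
  set d := X 0 + Real.cos (y 0) with hd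
  have hc := conf_pos x
  have hX' : (fun i : Fin 3 => X i.succ) = conf x • x := stereoVec_succ_eq x
  have hX0 : 1 + X 0 = conf x := one_add_stereoVec_zero x
  have hd0 : 0 ≤ d := by
    have := radialGauge_nonneg hφ (fun i : Fin 3 => X i.succ)
    nlinarith
  have hXn : X 0 ^ 2 + ‖(WithLp.toLp 2 (fun i : Fin 3 => X i.succ) : EuclideanSpace ℝ (Fin 3))‖ ^ 2
      = 1 := by
    have h := mem_sphere_zero_iff_norm.1 (stereoVec_mem 1 x)
    rw [← hXdef] at h
    have h2 := EuclideanSpace.norm_sq_eq X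
    rw [h, Fin.sum_univ_succ] at h2
    rw [norm_toLp_sq, rsq]
    simp only [Real.norm_eq_abs, sq_abs] at h2
    linarith
  set N := ‖(WithLp.toLp 2 (fun i : Fin 3 => X i.succ) : EuclideanSpace ℝ (Fin 3))‖ with hN
  have hN0 : 0 ≤ N := norm_nonneg _
  have hX1 : -1 < X 0 := by linarith
  have hX2 : X 0 ≤ 1 := by nlinarith
  set R := Real.arccos (X 0) with hR
  have hcR : Real.cos R = X 0 := Real.cos_arccos hX1.le hX2
  have hsR : Real.sin R = N := by
    rw [hR, Real.sin_arccos, Real.sqrt_eq_iff_mul_self_eq (by nlinarith) hN0]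
    linarith
  have hR0 : 0 ≤ R := Real.arccos_nonneg _
  have hRπ : R < Real.pi := by
    rcases (Real.arccos_le_pi (X 0)).lt_or_eq with h | h
    · exact h
    · exfalso
      have : Real.cos R = -1 := by rw [hR, h, Real.cos_pi]
      linarith
  have hprod : d = 2 * Real.cos ((y 0 + R) / 2) * Real.cos ((y 0 - R) / 2) := by
    rw [hd, ← hcR, add_comm, Real.cos_add_cos]
  have hc2 : 0 < Real.cos ((y 0 - R) / 2) :=
    Real.cos_pos_of_mem_Ioo ⟨by linarith, by linarith⟩
  -- If `d = 0`, the gauge of `X'` vanishes; then `X' = 0`, `X₀ = 1` and `cos T = -1`, which `T < π`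
  -- excludes.
  have hdpos : 0 < d := by
    rcases hd0.lt_or_eq with h | h
    · exact h
    · exfalso
      rw [← h] at h1
      have hg : radialGauge φ (fun i : Fin 3 => X i.succ) = 0 := by
        have := radialGauge_nonneg hφ (fun i : Fin 3 => X i.succ)
        nlinarith
      have hNz : N = 0 := by
        rw [radialGauge, div_eq_zero_iff] at hg
        rcases hg with hg | hg
        · exact hg
        · exact absurd hg (hφ _).ne'
      have hX01 : X 0 = 1 := by
        rw [hNz] at hXn
        nlinarith
      have hcos : Real.cos (y 0) = -1 := by linarith
      have : Real.cos Real.pi < Real.cos (y 0) :=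
        Real.cos_lt_cos_of_nonneg_of_le_pi h0 le_rfl hπ
      rw [hcos, Real.cos_pi] at this
      exact lt_irrefl _ this
  have hc1 : 0 < Real.cos ((y 0 + R) / 2) := by
    by_contra hneg
    have : d ≤ 0 := by rw [hprod]; nlinarith [not_lt.1 hneg]
    linarith
  -- This is `T + R < π`, the range in which `arctan` inverts `tan` at `(T + R)/2`.
  have hle : (y 0 + R) / 2 < Real.pi / 2 := by
    by_contra hneg
    have := Real.cos_nonpos_of_pi_div_two_le_of_le (not_lt.1 hneg) (by linarith)
    linarith
  set t := Real.sin (y 0) / d with ht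
  set z : EuclideanSpace ℝ (Fin 3) := d⁻¹ • WithLp.toLp 2 (fun i : Fin 3 => X i.succ) with hz
  have hzn : ‖z‖ = N / d := by
    rw [hz, norm_smul, Real.norm_eq_abs, abs_of_pos (inv_pos.2 hdpos), ← hN, div_eq_inv_mul]
  have htan1 : t + ‖z‖ = Real.tan ((y 0 + R) / 2) := by
    rw [hzn, ht, ← add_div, ← hsR, Real.tan_eq_sin_div_cos, div_eq_div_iff hdpos.ne' hc1.ne', hprod]
    have : Real.sin (y 0) + Real.sin R = 2 * Real.sin ((y 0 + R) / 2) * Real.cos ((y 0 - R) / 2) := by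
      have e1 : y 0 = (y 0 + R) / 2 + (y 0 - R) / 2 := by ring
      have e2 : R = (y 0 + R) / 2 - (y 0 - R) / 2 := by ring
      conv_lhs => rw [e1, e2]
      rw [Real.sin_add, Real.sin_sub]
      ring_nf
    rw [this]; ring
  have htan2 : t - ‖z‖ = Real.tan ((y 0 - R) / 2) := by
    rw [hzn, ht, ← sub_div, ← hsR, Real.tan_eq_sin_div_cos, div_eq_div_iff hdpos.ne' hc2.ne', hprod,
      Real.sin_sub_sin]
    ring
  have hat1 : Real.arctan (t + ‖z‖) = (y 0 + R) / 2 := by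
    rw [htan1, Real.arctan_tan (by linarith) hle]
  have hat2 : Real.arctan (t - ‖z‖) = (y 0 - R) / 2 := by
    rw [htan2, Real.arctan_tan (by linarith) (by linarith)]
  have hpT : penroseT t ‖z‖ = y 0 := by rw [penroseT, hat1, hat2]; ring
  have hpR : penroseR t ‖z‖ = R := by rw [penroseR, hat1, hat2]; ring
  have hgz : radialGauge φ z.ofLp = radialGauge φ (fun i : Fin 3 => X i.succ) / d := by
    have : z.ofLp = d⁻¹ • (fun i : Fin 3 => X i.succ) := by rw [hz]; rfl
    rw [this, radialGauge_smul φ (inv_pos.2 hdpos), div_eq_inv_mul]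
  refine ⟨t, z, div_nonneg (Real.sin_nonneg_of_nonneg_of_le_pi h0 hπ.le) hdpos.le, ?_, ?_, ?_⟩
  · refine Prod.ext hpT (Subtype.ext ?_)
    change penroseVec t z = X
    ext i
    refine Fin.cases ?_ (fun i => ?_) i
    · rw [penroseVec_zero, hpR, hcR]
    · have h2 := congrFun (penroseVec_succ t z) i
      beta_reduce at h2
      rw [h2, hpT, hpR, hcR, ← hd, hz]
      simp [hdpos.ne']
  · rw [hgz, div_le_one hdpos]; nlinarith
  · intro h
    rw [h, mul_zero] at h1
    rw [hgz, div_eq_one_iff_eq hdpos.ne']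
    linarith

theorem param_mem_domainY_iff {φ : S2 → ℝ} (hφ : ∀ θ, 0 < φ θ) (y : Fin 4 → ℝ) :
    param 1 y ∈ domainY φ ↔ (0 ≤ y 0 ∧ y 0 < Real.pi) ∧ 0 < Psi φ y := by
  unfold domainY
  rw [Set.mem_sdiff, Set.mem_prod]
  constructor
  · rintro ⟨⟨⟨h0, hπ⟩, -⟩, hn⟩
    refine ⟨⟨h0, hπ⟩, ?_⟩
    by_contra hΨ
    obtain ⟨t, z, ht, he, hz, -⟩ := exists_penrose_eq hφ h0 hπ (not_lt.1 hΨ)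
    exact hn ⟨(t, z), ⟨ht, (mem_obstacle_iff hφ z).2 hz⟩, he⟩
  · rintro ⟨⟨h0, hπ⟩, hΨ⟩
    refine ⟨⟨⟨h0, hπ⟩, Set.mem_univ _⟩, fun hn => ?_⟩
    exact absurd (Psi_nonpos_of_mem hφ hn) (not_le.2 hΨ)

theorem param_mem_boundaryY {φ : S2 → ℝ} (hφ : ∀ θ, 0 < φ θ) {y : Fin 4 → ℝ} (h0 : 0 ≤ y 0)
    (hπ : y 0 < Real.pi) (hΨ : Psi φ y = 0) : param 1 y ∈ boundaryY φ := by
  obtain ⟨t, z, ht, he, -, hz⟩ := exists_penrose_eq hφ h0 hπ hΨ.le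
  exact ⟨(t, z), ⟨ht, mem_obstacleBoundary hφ z (hz hΨ)⟩, he⟩

/-- `cos R + cos T > 0` on the Penrose image, which is impossible if `cos R = -1`. Hence the whole
segment over the south pole lies in the domain, where the other chart is available. -/
theorem mem_domainY_of_south {φ : S2 → ℝ} (p : ℝ × S3) (h0 : 0 ≤ p.1) (hπ : p.1 < Real.pi)
    (hX : (p.2 : EuclideanSpace ℝ (Fin 4)) 0 = -1) : p ∈ domainY φ := by
  refine ⟨⟨⟨h0, hπ⟩, Set.mem_univ _⟩, ?_⟩
  rintro ⟨⟨t, z⟩, -, hp⟩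
  have h1 : penroseVec t z = p.2 := congrArg (fun p => (p.2 : EuclideanSpace ℝ (Fin 4))) hp
  have h3 := cos_add_cos_penrose_pos t ‖z‖
  have h4 : Real.cos (penroseR t ‖z‖) = -1 := by rw [← penroseVec_zero, h1, hX]
  have := Real.cos_le_one (penroseT t ‖z‖)
  linarith

theorem stereoInv_inversion {x : Fin 3 → ℝ} (hx : x ≠ 0) :
    stereoInv (-1) ((rsq x)⁻¹ • x) = stereoInv 1 x := by
  have hq : 0 < rsq x := by
    rcases (rsq_nonneg x).lt_or_eq with h | h
    · exact h
    · exfalso; apply hx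
      rw [rsq, eq_comm, Finset.sum_eq_zero_iff_of_nonneg fun _ _ => sq_nonneg _] at h
      ext i
      exact pow_eq_zero_iff two_ne_zero |>.1 (h i (Finset.mem_univ _))
  have h1 : rsq ((rsq x)⁻¹ • x) = (rsq x)⁻¹ := by
    have : rsq ((rsq x)⁻¹ • x) = ((rsq x)⁻¹) ^ 2 * rsq x := by
      simp only [rsq, Pi.smul_apply, smul_eq_mul, mul_pow, ← Finset.mul_sum]
    rw [this]; field_simp
  apply Subtype.ext
  change stereoVec (-1) ((rsq x)⁻¹ • x) = stereoVec 1 x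
  ext i
  refine Fin.cases ?_ (fun i => ?_) i
  · rw [stereoVec_zero, stereoVec_zero, h1]
    simp
    field_simp
    ring
  · rw [stereoVec_succ, stereoVec_succ, h1]
    simp
    field_simp
    ring

end

section

open MeasureTheory Set

/-! ### Integration over time slices -/

theorem continuous_cons :
    Continuous fun p : ℝ × (Fin 3 → ℝ) => (Fin.cons p.1 p.2 : Fin 4 → ℝ) := by
  refine continuous_pi fun i => ?_
  refine Fin.cases ?_ (fun i => ?_) i
  · simpa using continuous_fst
  · exact (continuous_apply i).comp continuous_snd

theorem hasDerivAt_cons (T : ℝ) (x : Fin 3 → ℝ) :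
    HasDerivAt (fun s : ℝ => (Fin.cons s x : Fin 4 → ℝ)) (Pi.single 0 1) T := by
  rw [hasDerivAt_pi]
  intro i
  refine Fin.cases ?_ (fun i => ?_) i
  · simpa using hasDerivAt_id' T
  · simpa [Pi.single_apply] using hasDerivAt_const T (x i)

theorem hasFDerivAt_cons (T : ℝ) (x : Fin 3 → ℝ) :
    HasFDerivAt (fun z : Fin 3 → ℝ => (Fin.cons T z : Fin 4 → ℝ))
      (ContinuousLinearMap.pi fun i : Fin 4 => Fin.cases (motive := fun _ => (Fin 3 → ℝ) →L[ℝ] ℝ) 0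
        (fun i => ContinuousLinearMap.proj (R := ℝ) (φ := fun _ : Fin 3 => ℝ) i) i) x := by
  rw [hasFDerivAt_pi]
  intro i
  refine Fin.cases ?_ (fun i => ?_) i
  · simpa using hasFDerivAt_const T x
  · simpa using hasFDerivAt_apply (𝕜 := ℝ) (F' := fun _ : Fin 3 => ℝ) i x

theorem contDiff_cons {n : WithTop ℕ∞} (T : ℝ) :
    ContDiff ℝ n fun z : Fin 3 → ℝ => (Fin.cons T z : Fin 4 → ℝ) := by
  rw [contDiff_pi]
  intro i
  refine Fin.cases ?_ (fun i => ?_) i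
  · simpa using contDiff_const
  · simpa using contDiff_apply ℝ ℝ i

theorem pd_slice {G : (Fin 4 → ℝ) → ℝ} {T : ℝ} {x : Fin 3 → ℝ}
    (hG : DifferentiableAt ℝ G (Fin.cons T x)) (j : Fin 3) :
    pd j (fun z => G (Fin.cons T z)) x = pd j.succ G (Fin.cons T x) := by
  have h := hG.hasFDerivAt.comp x (hasFDerivAt_cons T x)
  unfold pd
  change fderiv ℝ (G ∘ fun z => Fin.cons T z) x _ = _
  rw [h.fderiv]
  rw [ContinuousLinearMap.comp_apply]
  congr 1
  ext i
  refine Fin.cases ?_ (fun i => ?_) i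
  · simp
  · simp [Pi.single_apply]

theorem integral_pd_eq_zero {f : (Fin 3 → ℝ) → ℝ} (hf : ContDiff ℝ 1 f) {K : Set (Fin 3 → ℝ)}
    (hK : IsCompact K) (hfK : ∀ x ∉ K, f x = 0) (j : Fin 3) : ∫ x, pd j f x = 0 := by
  have hs : HasCompactSupport f := HasCompactSupport.intro hK hfK
  have hc : Continuous fun x => fderiv ℝ f x (Pi.single j 1) :=
    (hf.continuous_fderiv one_ne_zero).clm_apply continuous_const
  have hs' : HasCompactSupport fun x => fderiv ℝ f x (Pi.single j 1) := by
    have := hs.fderiv (𝕜 := ℝ)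
    exact this.comp_left (g := fun L => L (Pi.single j 1)) rfl
  have h := integral_mul_fderiv_eq_neg_fderiv_mul_of_integrable (𝕜 := ℝ) (μ := volume)
    (f := fun _ : Fin 3 → ℝ => (1 : ℝ)) (g := f) (v := Pi.single j 1)
    (by simp)
    (by simpa using hc.integrable_of_hasCompactSupport hs')
    (by simpa using hf.continuous.integrable_of_hasCompactSupport hs)
    (fun x _ => differentiableAt_const _) (fun x _ => hf.differentiable one_ne_zero x)
  simpa [pd] using h

theorem integral_pd_succ_eq_zero {G : (Fin 4 → ℝ) → ℝ} {T : ℝ}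
    (hG : ∀ x, ContDiffAt ℝ 1 G (Fin.cons T x)) {K : Set (Fin 3 → ℝ)}
    (hK : IsCompact K) (hGK : ∀ x ∉ K, G (Fin.cons T x) = 0) (j : Fin 3) :
    ∫ x, pd j.succ G (Fin.cons T x) = 0 := by
  have hf : ContDiff ℝ 1 fun z : Fin 3 → ℝ => G (Fin.cons T z) :=
    contDiff_iff_contDiffAt.2 fun x => (hG x).comp x (contDiff_cons T).contDiffAt
  rw [← integral_pd_eq_zero hf hK hGK j]
  exact integral_congr_ae (Filter.Eventually.of_forall fun x =>
    (pd_slice ((hG x).differentiableAt one_ne_zero) j).symm)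

theorem continuousOn_slice {G : (Fin 4 → ℝ) → ℝ} {I : Set ℝ}
    (hG : ∀ T ∈ I, ∀ x, ContinuousAt G (Fin.cons T x)) :
    ContinuousOn (fun p : ℝ × (Fin 3 → ℝ) => G (Fin.cons p.1 p.2)) (I ×ˢ univ) := fun p hp =>
  (ContinuousAt.comp (f := fun p : ℝ × (Fin 3 → ℝ) => (Fin.cons p.1 p.2 : Fin 4 → ℝ))
    (hG p.1 hp.1 p.2) continuous_cons.continuousAt).continuousWithinAt

theorem continuousOn_integral_slice {G : (Fin 4 → ℝ) → ℝ} {I : Set ℝ}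
    (hG : ∀ T ∈ I, ∀ x, ContinuousAt G (Fin.cons T x)) {K : Set (Fin 3 → ℝ)}
    (hK : IsCompact K) (hGK : ∀ T ∈ I, ∀ x ∉ K, G (Fin.cons T x) = 0) :
    ContinuousOn (fun T => ∫ x, G (Fin.cons T x)) I :=
  continuousOn_integral_of_compact_support (f := fun T x => G (Fin.cons T x)) hK
    (continuousOn_slice hG) fun T x hT hx => hGK T hT x hx

theorem integrable_slice {G : (Fin 4 → ℝ) → ℝ} {T : ℝ}
    (hG : ∀ x, ContinuousAt G (Fin.cons T x)) {K : Set (Fin 3 → ℝ)}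
    (hK : IsCompact K) (hGK : ∀ x ∉ K, G (Fin.cons T x) = 0) :
    Integrable fun x => G (Fin.cons T x) := by
  have hc : Continuous fun x : Fin 3 → ℝ => G (Fin.cons T x) :=
    continuous_iff_continuousAt.2 fun x =>
      (hG x).comp ((contDiff_cons (n := 0) T).continuous.continuousAt)
  exact hc.integrable_of_hasCompactSupport (HasCompactSupport.intro hK hGK)

theorem continuousAt_pd {n : ℕ} {G : (Fin n → ℝ) → ℝ} {y : Fin n → ℝ} (hG : ContDiffAt ℝ 1 G y)
    (j : Fin n) : ContinuousAt (pd j G) y :=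
  ((hG.fderiv_right (m := 0) le_rfl).continuousAt).clm_apply continuousAt_const

theorem hasDerivAt_integral_slice {G : (Fin 4 → ℝ) → ℝ} {a b : ℝ}
    (hG : ∀ T ∈ Ico a b, ∀ x, ContDiffAt ℝ 1 G (Fin.cons T x)) {K : Set (Fin 3 → ℝ)}
    (hK : IsCompact K) (hGK : ∀ T ∈ Ico a b, ∀ x ∉ K, G (Fin.cons T x) = 0) {T : ℝ}
    (hT : T ∈ Ioo a b) :
    HasDerivAt (fun T => ∫ x, G (Fin.cons T x)) (∫ x, pd 0 G (Fin.cons T x)) T := by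
  -- A compact time interval inside `[a, b)` is needed to bound the derivative uniformly for
  -- dominated convergence.
  obtain ⟨a', ha', haT⟩ := exists_between hT.1
  obtain ⟨b', hTb, hb'⟩ := exists_between hT.2
  have hsub : Icc a' b' ⊆ Ico a b := fun s hs => ⟨ha'.le.trans hs.1, hs.2.trans_lt hb'⟩
  have hsubo : Ioo a' b' ⊆ Ico a b := Ioo_subset_Icc_self.trans hsub
  have hd : ∀ s ∈ Ico a b, ∀ x, HasDerivAt (fun s => G (Fin.cons s x)) (pd 0 G (Fin.cons s x)) s :=
    fun s hs x => ((hG s hs x).differentiableAt one_ne_zero).hasFDerivAt.comp_hasDerivAt s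
      (hasDerivAt_cons s x)
  have hpc : ∀ s ∈ Ico a b, ∀ x, ContinuousAt (pd 0 G) (Fin.cons s x) := fun s hs x =>
    continuousAt_pd (hG s hs x) 0
  have hpK : ∀ s ∈ Ioo a b, ∀ x ∉ K, pd 0 G (Fin.cons s x) = 0 := fun s hs x hx => by
    have h1 := hd s (Ioo_subset_Ico_self hs) x
    have h2 : HasDerivAt (fun s => G (Fin.cons s x)) 0 s := by
      refine (hasDerivAt_const s (0 : ℝ)).congr_of_eventuallyEq ?_
      filter_upwards [isOpen_Ioo.mem_nhds hs] with r hr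
      exact hGK r (Ioo_subset_Ico_self hr) x hx
    exact h1.unique h2
  obtain ⟨M, hM⟩ := (isCompact_Icc.prod hK).exists_bound_of_continuousOn
    ((continuousOn_slice fun s hs x => hpc s (hsub hs) x).mono
      (prod_mono_right (subset_univ K)) : ContinuousOn
      (fun p : ℝ × (Fin 3 → ℝ) => pd 0 G (Fin.cons p.1 p.2)) (Icc a' b' ×ˢ K))
  have hTI : T ∈ Ico a b := Ioo_subset_Ico_self hT
  refine (hasDerivAt_integral_of_dominated_loc_of_deriv_le (μ := volume)
    (F := fun s x => G (Fin.cons s x)) (F' := fun s x => pd 0 G (Fin.cons s x))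
    (bound := K.indicator fun _ => M) (isOpen_Ioo.mem_nhds ⟨haT, hTb⟩) ?_ ?_ ?_ ?_ ?_ ?_).2
  · filter_upwards [isOpen_Ioo.mem_nhds (⟨haT, hTb⟩ : T ∈ Ioo a' b')] with s hs
    exact (integrable_slice (fun x => (hG s (hsubo hs) x).continuousAt) hK
      (hGK s (hsubo hs))).aestronglyMeasurable
  · exact integrable_slice (fun x => (hG T hTI x).continuousAt) hK (hGK T hTI)
  · exact (integrable_slice (hpc T hTI) hK (hpK T hT)).aestronglyMeasurable
  · refine Filter.Eventually.of_forall fun x s hs => ?_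
    by_cases hx : x ∈ K
    · rw [indicator_of_mem hx]
      exact hM (s, x) ⟨Ioo_subset_Icc_self hs, hx⟩
    · rw [indicator_of_notMem hx, hpK s ⟨ha'.trans hs.1, hs.2.trans hb'⟩ x hx, norm_zero]
  · have hKf : (volume : Measure (Fin 3 → ℝ)) K ≠ ⊤ := hK.measure_lt_top.ne
    exact (integrable_indicator_iff hK.measurableSet).2 (integrableOn_const hKf)
  · exact Filter.Eventually.of_forall fun x s hs => hd s (hsubo hs) x

/-! ### A Grönwall inequality -/

/-- If `f' ≤ a f + b` with continuous `a` and `b`, where `a, b ≥ 0`, then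
`f(T) ≤ e^{∫ a} (f(0) + ∫ b)`. -/
theorem gronwall_linear {f f' a b : ℝ → ℝ} {T : ℝ} (hT : 0 ≤ T) (hf : ContinuousOn f (Icc 0 T))
    (hf' : ∀ t ∈ Ioo 0 T, HasDerivAt f (f' t) t) (ha : ContinuousOn a (Icc 0 T))
    (hb : ContinuousOn b (Icc 0 T)) (ha0 : ∀ t ∈ Icc 0 T, 0 ≤ a t)
    (hb0 : ∀ t ∈ Icc 0 T, 0 ≤ b t)
    (hle : ∀ t ∈ Ioo 0 T, f' t ≤ a t * f t + b t) :
    f T ≤ Real.exp (∫ t in (0)..T, a t) * (f 0 + ∫ t in (0)..T, b t) := by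
  have hprim : ∀ g : ℝ → ℝ, ContinuousOn g (Icc 0 T) →
      ContinuousOn (fun t => ∫ s in (0)..t, g s) (Icc 0 T) ∧
      ∀ t ∈ Ioo 0 T, HasDerivAt (fun t => ∫ s in (0)..t, g s) (g t) t := by
    intro g hg
    constructor
    · have hi : IntegrableOn g (Icc 0 T) volume := hg.integrableOn_Icc
      rw [← uIcc_of_le hT] at hi ⊢
      exact intervalIntegral.continuousOn_primitive_interval hi
    · intro t ht
      have hsub : uIcc 0 t ⊆ Icc 0 T := by
        rw [uIcc_of_le ht.1.le]; exact Icc_subset_Icc_right ht.2.le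
      refine intervalIntegral.integral_hasDerivAt_right ((hg.mono hsub).intervalIntegrable) ?_
        (hg.continuousAt (Icc_mem_nhds ht.1 ht.2))
      exact (hg.mono Ioo_subset_Icc_self).stronglyMeasurableAtFilter isOpen_Ioo t ht
  set A := fun t => ∫ s in (0)..t, a s with hA
  set B := fun t => ∫ s in (0)..t, b s with hB
  obtain ⟨hAc, hAd⟩ := hprim a ha
  obtain ⟨hBc, hBd⟩ := hprim b hb
  have hA0 : ∀ t ∈ Icc 0 T, 0 ≤ A t := fun t ht =>
    intervalIntegral.integral_nonneg ht.1 fun s hs => ha0 s ⟨hs.1, hs.2.trans ht.2⟩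
  -- The integrating factor weights `f` only. Subtracting the unweighted `B` suffices, since `e^{-A}
  -- ≤ 1` and `b ≥ 0`.
  have hanti : AntitoneOn (fun t => Real.exp (-A t) * f t - B t) (Icc 0 T) := by
    refine antitoneOn_of_hasDerivWithinAt_nonpos (convex_Icc 0 T) ((hAc.neg.rexp.mul hf).sub hBc)
      (f' := fun t => (Real.exp (-A t) * (-a t)) * f t + Real.exp (-A t) * f' t - b t) ?_ ?_
    · intro t ht
      rw [interior_Icc] at ht
      exact (((hAd t ht).neg.exp.mul (hf' t ht)).sub (hBd t ht)).hasDerivWithinAt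
    · intro t ht
      rw [interior_Icc] at ht
      have h1 := hle t ht
      have h2 := Real.exp_pos (-A t)
      have h3 : Real.exp (-A t) ≤ 1 := by
        rw [Real.exp_le_one_iff]; linarith [hA0 t (Ioo_subset_Icc_self ht)]
      have h4 := hb0 t (Ioo_subset_Icc_self ht)
      have h5 := mul_le_mul_of_nonneg_left h1 h2.le
      nlinarith
  have h := hanti (left_mem_Icc.2 hT) (right_mem_Icc.2 hT) hT
  have e1 : A 0 = 0 := intervalIntegral.integral_same
  have e2 : B 0 = 0 := intervalIntegral.integral_same
  simp only [e1, e2, neg_zero, Real.exp_zero, one_mul, sub_zero] at h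
  have h6 : Real.exp (-A T) * f T ≤ f 0 + B T := by linarith
  have h7 := mul_le_mul_of_nonneg_left h6 (Real.exp_pos (A T)).le
  rw [← mul_assoc, ← Real.exp_add, add_neg_cancel, Real.exp_zero, one_mul] at h7
  exact h7

end

section

/-! ### The energy current -/

section PartialDerivatives

variable {n : ℕ} {f g : (Fin n → ℝ) → ℝ} {y : Fin n → ℝ}

theorem pd_mul (hf : DifferentiableAt ℝ f y) (hg : DifferentiableAt ℝ g y) (j : Fin n) :
    pd j (fun z => f z * g z) y = pd j f y * g y + f y * pd j g y := by
  unfold pd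
  rw [fderiv_fun_mul hf hg]
  simp; ring

theorem pd_sub (hf : DifferentiableAt ℝ f y) (hg : DifferentiableAt ℝ g y) (j : Fin n) :
    pd j (fun z => f z - g z) y = pd j f y - pd j g y := by
  unfold pd
  rw [fderiv_fun_sub hf hg]
  simp

theorem pd_const_mul (c : ℝ) (hf : DifferentiableAt ℝ f y) (j : Fin n) :
    pd j (fun z => c * f z) y = c * pd j f y := by
  unfold pd
  rw [fderiv_const_mul hf]
  simp

theorem pd_sum {ι : Type*} {s : Finset ι} {F : ι → (Fin n → ℝ) → ℝ}
    (hF : ∀ i ∈ s, DifferentiableAt ℝ (F i) y) (j : Fin n) :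
    pd j (fun z => ∑ i ∈ s, F i z) y = ∑ i ∈ s, pd j (F i) y := by
  unfold pd
  rw [fderiv_fun_sum hF]
  simp

theorem pd_congr (h : f =ᶠ[nhds y] g) (j : Fin n) : pd j f y = pd j g y := by
  unfold pd; rw [h.fderiv_eq]

theorem contDiffAt_pd (hf : ContDiffAt ℝ 2 f y) (j : Fin n) : ContDiffAt ℝ 1 (pd j f) y :=
  (hf.fderiv_right (m := 1) (by norm_num)).clm_apply contDiffAt_const

theorem pd_comm (hf : ContDiffAt ℝ 2 f y) (j k : Fin n) :
    pd j (pd k f) y = pd k (pd j f) y := by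
  have hd : DifferentiableAt ℝ (fderiv ℝ f) y :=
    (hf.fderiv_right (m := 1) (by norm_num)).differentiableAt one_ne_zero
  have h : ∀ a b : Fin n, pd a (pd b f) y
      = fderiv ℝ (fderiv ℝ f) y (Pi.single a 1) (Pi.single b 1) := by
    intro a b
    change fderiv ℝ (fun z => fderiv ℝ f z (Pi.single b 1)) y (Pi.single a 1) = _
    rw [fderiv_clm_apply hd (differentiableAt_const _)]
    simp
  rw [h, h]
  exact (hf.isSymmSndFDerivAt (by simp)).eq _ _

end PartialDerivatives

/-- The energy current `J^j = P^{jk} ∂_k v ∂_0 v - ½ δ^j_0 P^{kl} ∂_k v ∂_l v`. -/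
def current (P : (Fin 4 → ℝ) → Matrix (Fin 4) (Fin 4) ℝ) (v : (Fin 4 → ℝ) → ℝ) (j : Fin 4)
    (y : Fin 4 → ℝ) : ℝ :=
  (∑ k, P y j k * pd k v y) * pd 0 v y
    - if j = 0 then (1 / 2) * ∑ k, ∑ l, P y k l * (pd k v y * pd l v y) else 0

variable {P : (Fin 4 → ℝ) → Matrix (Fin 4) (Fin 4) ℝ} {v : (Fin 4 → ℝ) → ℝ} {y : Fin 4 → ℝ}

theorem contDiffAt_current (hP : ∀ j k, ContDiffAt ℝ 1 (fun z => P z j k) y)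
    (hv : ContDiffAt ℝ 2 v y) (j : Fin 4) : ContDiffAt ℝ 1 (current P v j) y := by
  have h1 : ∀ k, ContDiffAt ℝ 1 (pd k v) y := contDiffAt_pd hv
  unfold current
  refine ((ContDiffAt.sum fun k _ => (hP j k).mul (h1 k)).mul (h1 0)).sub ?_
  split_ifs
  · exact contDiffAt_const.mul
      (ContDiffAt.sum fun k _ => ContDiffAt.sum fun l _ => (hP k l).mul ((h1 k).mul (h1 l)))
  · exact contDiffAt_const

/-- By the symmetry of `P` and of second derivatives, the terms `P^{jk} ∂_k v ∂_j ∂_0 v` from the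
product cancel the second-order terms of `½ ∂_0 (P^{kl} ∂_k v ∂_l v)`. What remains is the wave
operator times `∂_0 v` and the term with `∂_0 P`. -/
theorem div_current (hP : ∀ j k, ContDiffAt ℝ 1 (fun z => P z j k) y)
    (hv : ContDiffAt ℝ 2 v y) (hs : (P y).IsSymm) :
    ∑ j, pd j (current P v j) y
      = (∑ j, ∑ k, pd j (fun z => P z j k * pd k v z) y) * pd 0 v y
        - (1 / 2) * ∑ k, ∑ l, pd 0 (fun z => P z k l) y * (pd k v y * pd l v y) := by
  have hPd : ∀ j k, DifferentiableAt ℝ (fun z => P z j k) y := fun j k =>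
    (hP j k).differentiableAt one_ne_zero
  have hvd : ∀ k, DifferentiableAt ℝ (pd k v) y := fun k =>
    (contDiffAt_pd hv k).differentiableAt one_ne_zero
  have hPv : ∀ j k, DifferentiableAt ℝ (fun z => P z j k * pd k v z) y := fun j k =>
    (hPd j k).mul (hvd k)
  have hS : ∀ j, DifferentiableAt ℝ (fun z => ∑ k, P z j k * pd k v z) y := fun j =>
    DifferentiableAt.fun_sum fun k _ => hPv j k
  have hvv : ∀ k l, DifferentiableAt ℝ (fun z => pd k v z * pd l v z) y := fun k l =>
    (hvd k).mul (hvd l)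
  have hPvv : ∀ k l, DifferentiableAt ℝ (fun z => P z k l * (pd k v z * pd l v z)) y := fun k l =>
    (hPd k l).mul (hvv k l)
  have hQ : DifferentiableAt ℝ (fun z => ∑ k, ∑ l, P z k l * (pd k v z * pd l v z)) y :=
    DifferentiableAt.fun_sum fun k _ => DifferentiableAt.fun_sum fun l _ => hPvv k l
  have h1 : ∀ j, pd j (current P v j) y
      = ((∑ k, pd j (fun z => P z j k * pd k v z) y) * pd 0 v y
        + (∑ k, P y j k * pd k v y) * pd j (pd 0 v) y)
        - if j = 0 then (1 / 2) * pd 0 (fun z => ∑ k, ∑ l, P z k l * (pd k v z * pd l v z)) y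
          else 0 := by
    intro j
    have hA : DifferentiableAt ℝ (fun z => (∑ k, P z j k * pd k v z) * pd 0 v z) y :=
      (hS j).mul (hvd 0)
    have hB : DifferentiableAt ℝ (fun z => if j = 0 then
        (1 / 2) * ∑ k, ∑ l, P z k l * (pd k v z * pd l v z) else 0) y := by
      split_ifs
      · exact hQ.const_mul _
      · exact differentiableAt_const _
    refine (pd_sub hA hB j).trans ?_
    rw [pd_mul (hS j) (hvd 0), pd_sum fun k _ => hPv j k]
    congr 1
    by_cases hj : j = 0
    · subst hj
      simp only [if_true]
      exact pd_const_mul _ hQ _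
    · simp only [hj, if_false]
      exact pd_const _ _ _
  have h2 : pd 0 (fun z => ∑ k, ∑ l, P z k l * (pd k v z * pd l v z)) y
      = ∑ k, ∑ l, (pd 0 (fun z => P z k l) y * (pd k v y * pd l v y)
        + P y k l * (pd 0 (pd k v) y * pd l v y + pd k v y * pd 0 (pd l v) y)) := by
    rw [pd_sum fun k _ => DifferentiableAt.fun_sum fun l _ => hPvv k l]
    refine Finset.sum_congr rfl fun k _ => ?_
    rw [pd_sum fun l _ => hPvv k l]
    refine Finset.sum_congr rfl fun l _ => ?_
    rw [pd_mul (hPd k l) (hvv k l), pd_mul (hvd k) (hvd l)]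
  have hsym : ∀ k l, P y k l = P y l k := fun k l => (hs.apply l k)
  have h3 : ∑ k, ∑ l, P y k l * (pd 0 (pd k v) y * pd l v y + pd k v y * pd 0 (pd l v) y)
      = 2 * ∑ j, (∑ k, P y j k * pd k v y) * pd j (pd 0 v) y := by
    have e1 : ∑ k, ∑ l, P y k l * (pd 0 (pd k v) y * pd l v y)
        = ∑ j, (∑ k, P y j k * pd k v y) * pd j (pd 0 v) y := by
      refine Finset.sum_congr rfl fun k _ => ?_
      rw [Finset.sum_mul]
      refine Finset.sum_congr rfl fun l _ => ?_
      rw [pd_comm hv 0 k]; ring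
    have e2 : ∑ k, ∑ l, P y k l * (pd k v y * pd 0 (pd l v) y)
        = ∑ j, (∑ k, P y j k * pd k v y) * pd j (pd 0 v) y := by
      rw [Finset.sum_comm]
      refine Finset.sum_congr rfl fun k _ => ?_
      rw [Finset.sum_mul]
      refine Finset.sum_congr rfl fun l _ => ?_
      rw [pd_comm hv 0 k, hsym l k]; ring
    simp only [mul_add, Finset.sum_add_distrib]
    rw [e1, e2]; ring
  simp only [h1, Finset.sum_sub_distrib, Finset.sum_add_distrib, Finset.sum_ite_eq',
    Finset.mem_univ, if_true, ← Finset.sum_mul]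
  rw [h2]
  simp only [Finset.sum_add_distrib]
  rw [h3]
  ring

theorem sum_pd_densInv_mul {H : (Fin 4 → ℝ) → Matrix (Fin 4) (Fin 4) ℝ} (hdet : (H y).det ≠ 0) :
    ∑ j, ∑ k, pd j (fun z => densInv (H z) j k * pd k v z) y
      = Real.sqrt |(H y).det| * boxCoord H v y := by
  unfold boxCoord
  rw [← mul_assoc, mul_inv_cancel₀ (Real.sqrt_ne_zero'.2 (abs_pos.2 hdet)), one_mul]
  have : ∀ j k, (fun z => densInv (H z) j k * pd k v z)
      = fun z => (H z)⁻¹ j k * Real.sqrt |(H z).det| * pd k v z := fun j k => by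
    funext z
    simp only [densInv, Matrix.smul_apply, smul_eq_mul]; ring
  simp only [this]

end

section

/-! ### Algebraic bounds for the energy current -/

theorem abs_bilin_le {N : Fin 4 → Fin 4 → ℝ} {κ : ℝ} (hN : ∀ k l, |N k l| ≤ κ) (a : Fin 4 → ℝ) :
    |∑ k, ∑ l, N k l * (a k * a l)| ≤ 4 * κ * ∑ k, a k ^ 2 := by
  have h1 : ∀ k l, |N k l * (a k * a l)| ≤ κ * ((a k ^ 2 + a l ^ 2) / 2) := fun k l => by
    rw [abs_mul]
    refine mul_le_mul (hN k l) ?_ (abs_nonneg _) ((abs_nonneg _).trans (hN k l))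
    rw [abs_le]
    constructor <;> nlinarith [sq_nonneg (a k + a l), sq_nonneg (a k - a l)]
  calc |∑ k, ∑ l, N k l * (a k * a l)| ≤ ∑ k, ∑ l, κ * ((a k ^ 2 + a l ^ 2) / 2) :=
        (Finset.abs_sum_le_sum_abs _ _).trans (Finset.sum_le_sum fun k _ =>
          (Finset.abs_sum_le_sum_abs _ _).trans (Finset.sum_le_sum fun l _ => h1 k l))
    _ = 4 * κ * ∑ k, a k ^ 2 := by simp only [Fin.sum_univ_four]; ring

/-- The factor `5/2` comes from `Σ_k (a_k² + a_0²)/2 = (Σ_k a_k² + 4 a_0²)/2`. -/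
theorem abs_row_le {N : Fin 4 → ℝ} {κ : ℝ} (hN : ∀ k, |N k| ≤ κ) (a : Fin 4 → ℝ) :
    |(∑ k, N k * a k) * a 0| ≤ 5 / 2 * κ * ∑ k, a k ^ 2 := by
  have hκ : 0 ≤ κ := (abs_nonneg _).trans (hN 0)
  have h1 : ∀ k, |N k * a k * a 0| ≤ κ * ((a k ^ 2 + a 0 ^ 2) / 2) := fun k => by
    rw [mul_assoc, abs_mul]
    refine mul_le_mul (hN k) ?_ (abs_nonneg _) hκ
    rw [abs_le]
    constructor <;> nlinarith [sq_nonneg (a k + a 0), sq_nonneg (a k - a 0)]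
  rw [Finset.sum_mul]
  calc |∑ k, N k * a k * a 0| ≤ ∑ k, κ * ((a k ^ 2 + a 0 ^ 2) / 2) :=
        (Finset.abs_sum_le_sum_abs _ _).trans (Finset.sum_le_sum fun k _ => h1 k)
    _ ≤ 5 / 2 * κ * ∑ k, a k ^ 2 := by
      simp only [Fin.sum_univ_four]
      have := mul_nonneg hκ (sq_nonneg (a 1))
      have := mul_nonneg hκ (sq_nonneg (a 2))
      have := mul_nonneg hκ (sq_nonneg (a 3))
      linarith

theorem diagonal_mink_bilin (a : Fin 4 → ℝ) :
    ∑ k, ∑ l, Matrix.diagonal mink k l * (a k * a l) = 2 * a 0 ^ 2 - ∑ k, a k ^ 2 := by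
  simp only [Fin.sum_univ_four, Matrix.diagonal_apply, mink]
  simp
  ring

theorem bilin_le {q : Matrix (Fin 4) (Fin 4) ℝ} {κ : ℝ}
    (hq : ∀ k l, |q k l - Matrix.diagonal mink k l| ≤ κ) (a : Fin 4 → ℝ) :
    |∑ k, ∑ l, q k l * (a k * a l) - (2 * a 0 ^ 2 - ∑ k, a k ^ 2)| ≤ 4 * κ * ∑ k, a k ^ 2 := by
  refine le_trans (le_of_eq ?_) (abs_bilin_le hq a)
  rw [← diagonal_mink_bilin]
  simp only [← Finset.sum_sub_distrib, sub_mul]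

/-- For the Minkowski matrix the middle expression is exactly `½ Σ a_k²`. The perturbation costs
`5κ/2` from the row and `½ · 4κ` from the quadratic form, and `9κ/2 ≤ 1/4` is the condition `κ ≤
1/18`. -/
theorem energy_density_bounds {q : Matrix (Fin 4) (Fin 4) ℝ} {κ : ℝ} (hκ : κ ≤ 1 / 18)
    (hq : ∀ k l, |q k l - Matrix.diagonal mink k l| ≤ κ) (a : Fin 4 → ℝ) :
    (∑ k, a k ^ 2) / 4 ≤ (∑ k, q 0 k * a k) * a 0 - (1 / 2) * ∑ k, ∑ l, q k l * (a k * a l) ∧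
    (∑ k, q 0 k * a k) * a 0 - (1 / 2) * ∑ k, ∑ l, q k l * (a k * a l) ≤ ∑ k, a k ^ 2 := by
  have h1 := bilin_le hq a
  have h2 := abs_row_le (fun k => hq 0 k) a
  have h3 : ∑ k, (q 0 k - Matrix.diagonal mink 0 k) * a k = (∑ k, q 0 k * a k) - a 0 := by
    simp only [sub_mul, Finset.sum_sub_distrib]
    simp [Matrix.diagonal_apply, mink]
  rw [h3, sub_mul] at h2
  have h0 : 0 ≤ ∑ k, a k ^ 2 := Finset.sum_nonneg fun _ _ => sq_nonneg _
  rw [abs_le] at h1 h2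
  have h4 := mul_le_mul_of_nonneg_right hκ h0
  constructor <;> nlinarith [h1.1, h1.2, h2.1, h2.2]

/-- The contravariant density with components `q` in the orthonormal frame. -/
def dens (q : (Fin 4 → ℝ) → Matrix (Fin 4) (Fin 4) ℝ) (y : Fin 4 → ℝ) :
    Matrix (Fin 4) (Fin 4) ℝ :=
  Matrix.of fun j k => conf (Fin.tail y) ^ 3 * q y j k / (scale y j * scale y k)

theorem dens_bilin (q : (Fin 4 → ℝ) → Matrix (Fin 4) (Fin 4) ℝ) (y a : Fin 4 → ℝ) :
    ∑ k, ∑ l, dens q y k l * (a k * a l)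
      = conf (Fin.tail y) ^ 3 * ∑ k, ∑ l, q y k l * (a k / scale y k * (a l / scale y l)) := by
  simp only [Finset.mul_sum]
  refine Finset.sum_congr rfl fun k _ => Finset.sum_congr rfl fun l _ => ?_
  have := (scale_pos y k).ne'
  have := (scale_pos y l).ne'
  simp only [dens, Matrix.of_apply]
  field_simp

theorem dens_row (q : (Fin 4 → ℝ) → Matrix (Fin 4) (Fin 4) ℝ) (y a : Fin 4 → ℝ) (j : Fin 4) :
    ∑ k, dens q y j k * a k
      = conf (Fin.tail y) ^ 3 / scale y j * ∑ k, q y j k * (a k / scale y k) := by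
  simp only [Finset.mul_sum]
  refine Finset.sum_congr rfl fun k _ => ?_
  have := (scale_pos y k).ne'
  have := (scale_pos y j).ne'
  simp only [dens, Matrix.of_apply]
  field_simp

theorem framed_zero (v : (Fin 4 → ℝ) → ℝ) (y : Fin 4 → ℝ) : framed v y 0 = pd 0 v y := by
  simp [framed, scale_zero]

theorem current_zero_eq (q : (Fin 4 → ℝ) → Matrix (Fin 4) (Fin 4) ℝ) (v : (Fin 4 → ℝ) → ℝ)
    (y : Fin 4 → ℝ) : current (dens q) v 0 y = conf (Fin.tail y) ^ 3 *
      ((∑ k, q y 0 k * framed v y k) * framed v y 0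
        - (1 / 2) * ∑ k, ∑ l, q y k l * (framed v y k * framed v y l)) := by
  have h1 := dens_row q y (fun k => pd k v y) 0
  have h2 := dens_bilin q y (fun k => pd k v y)
  unfold current
  rw [if_pos rfl, h1, h2, framed_zero, scale_zero]
  simp only [framed]
  ring

theorem current_succ_eq (q : (Fin 4 → ℝ) → Matrix (Fin 4) (Fin 4) ℝ) (v : (Fin 4 → ℝ) → ℝ)
    (y : Fin 4 → ℝ) (j : Fin 3) : current (dens q) v j.succ y = conf (Fin.tail y) ^ 2 *
      ((∑ k, q y j.succ k * framed v y k) * framed v y 0) := by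
  have h1 := dens_row q y (fun k => pd k v y) j.succ
  have := (conf_pos (Fin.tail y)).ne'
  unfold current
  rw [if_neg (Fin.succ_ne_zero j), h1, framed_zero, scale_succ]
  simp only [framed]
  field_simp
  ring

theorem abs_current_succ_le {q : (Fin 4 → ℝ) → Matrix (Fin 4) (Fin 4) ℝ} {κ : ℝ} {y : Fin 4 → ℝ}
    (hκ : κ ≤ 1) (hq : ∀ k l, |q y k l - Matrix.diagonal mink k l| ≤ κ) (v : (Fin 4 → ℝ) → ℝ)
    (j : Fin 3) : |current (dens q) v j.succ y|
      ≤ 5 * conf (Fin.tail y) ^ 2 * ∑ k, framed v y k ^ 2 := by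
  -- With entries bounded by `2`, `abs_row_le` gives the factor `5/2 · 2 = 5`.
  have hq2 : ∀ k, |q y j.succ k| ≤ 2 := fun k => by
    have h1 := hq j.succ k
    have h2 : |Matrix.diagonal mink j.succ k| ≤ 1 := by
      rw [Matrix.diagonal_apply]; unfold mink; split_ifs <;> simp
    have h3 := abs_sub_abs_le_abs_sub (q y j.succ k) (Matrix.diagonal mink j.succ k)
    linarith
  have h := abs_row_le hq2 (framed v y)
  rw [current_succ_eq, abs_mul, abs_of_nonneg (sq_nonneg (conf (Fin.tail y)))]
  have := mul_le_mul_of_nonneg_left h (sq_nonneg (conf (Fin.tail y)))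
  linarith

theorem current_zero_bounds {q : (Fin 4 → ℝ) → Matrix (Fin 4) (Fin 4) ℝ} {κ : ℝ} {y : Fin 4 → ℝ}
    (hκ : κ ≤ 1 / 18) (hq : ∀ k l, |q y k l - Matrix.diagonal mink k l| ≤ κ)
    (v : (Fin 4 → ℝ) → ℝ) :
    conf (Fin.tail y) ^ 3 * ∑ k, framed v y k ^ 2 ≤ 4 * current (dens q) v 0 y ∧
    current (dens q) v 0 y ≤ conf (Fin.tail y) ^ 3 * ∑ k, framed v y k ^ 2 := by
  have hc : 0 ≤ conf (Fin.tail y) ^ 3 := (pow_pos (conf_pos _) 3).le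
  obtain ⟨h1, h2⟩ := energy_density_bounds hκ hq (framed v y)
  rw [current_zero_eq]
  refine ⟨?_, mul_le_mul_of_nonneg_left h2 hc⟩
  have := mul_le_mul_of_nonneg_left h1 hc
  linarith

/-- If `dv` is a multiple of `dψ`, then the flux of the energy current through the level sets of
`ψ` is a multiple of `∂_0 ψ · P(dψ, dψ)`. -/
theorem flux_eq {P : (Fin 4 → ℝ) → Matrix (Fin 4) (Fin 4) ℝ} {v : (Fin 4 → ℝ) → ℝ}
    {y ψ : Fin 4 → ℝ} {c : ℝ} (hv : ∀ j, pd j v y = c * ψ j) :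
    ∑ j, current P v j y * ψ j = c ^ 2 / 2 * ψ 0 * ∑ k, ∑ l, P y k l * (ψ k * ψ l) := by
  unfold current
  simp only [hv, sub_mul, Finset.sum_sub_distrib, ite_mul, zero_mul, Finset.sum_ite_eq',
    Finset.mem_univ, if_true]
  simp only [Fin.sum_univ_four]
  ring

/-! ### The conormal of the boundary -/

theorem sum_mul_pd {n : ℕ} (f : (Fin n → ℝ) → ℝ) (y a : Fin n → ℝ) :
    ∑ j, a j * pd j f y = fderiv ℝ f y a := by
  have h : a = ∑ j, a j • (Pi.single j (1 : ℝ) : Fin n → ℝ) := by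
    ext i; simp [Pi.single_apply]
  conv_rhs => rw [h, map_sum]
  simp [pd]

variable {φ : S2 → ℝ}

theorem Psi_of_tail_eq_zero {y : Fin 4 → ℝ} (h : Fin.tail y = 0) :
    Psi φ y = -Real.cos (y 0 / 2) ^ 2 := by
  have h1 := Real.sin_sq_add_cos_sq (y 0 / 2)
  unfold Psi
  rw [h, radialGauge_zero]
  simp [rsq]
  linarith

theorem tail_ne_zero_of_pos {y : Fin 4 → ℝ} (h : 0 < Psi φ y) : Fin.tail y ≠ 0 := by
  intro h0
  rw [Psi_of_tail_eq_zero h0] at h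
  linarith [sq_nonneg (Real.cos (y 0 / 2))]

theorem cos_half_pos {T : ℝ} (h0 : 0 ≤ T) (hπ : T < Real.pi) : 0 < Real.cos (T / 2) :=
  Real.cos_pos_of_mem_Ioo ⟨by linarith [Real.pi_pos], by linarith⟩

theorem tail_ne_zero_of_nonneg {y : Fin 4 → ℝ} (h0 : 0 ≤ y 0) (hπ : y 0 < Real.pi)
    (h : 0 ≤ Psi φ y) : Fin.tail y ≠ 0 := by
  intro hz
  rw [Psi_of_tail_eq_zero hz] at h
  have := pow_pos (cos_half_pos h0 hπ) 2
  linarith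

theorem pd_zero_Psi (hs : ContMDiff (𝓡 2) 𝓘(ℝ, ℝ) ∞ φ) (hφ : ∀ θ, 0 < φ θ) {y : Fin 4 → ℝ}
    (hy : Fin.tail y ≠ 0) :
    pd 0 (Psi φ) y = Real.sin (y 0 / 2) * Real.cos (y 0 / 2) * (1 + rsq (Fin.tail y)) := by
  unfold pd
  rw [hasFDerivAt_Psi hs hφ hy, tail_single_zero]
  simp

/-- Euler's identity handles the gauge, and `|x|²` is homogeneous of degree two. The positive radial
derivative is the analytic form of star-shapedness. -/
theorem radial_deriv_Psi (hs : ContMDiff (𝓡 2) 𝓘(ℝ, ℝ) ∞ φ) (hφ : ∀ θ, 0 < φ θ)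
    {y : Fin 4 → ℝ} (hy : Fin.tail y ≠ 0) :
    ∑ j : Fin 3, Fin.tail y j * pd j.succ (Psi φ) y
      = radialGauge φ (Fin.tail y) + 2 * Real.sin (y 0 / 2) ^ 2 * rsq (Fin.tail y) := by
  have h := sum_mul_pd (Psi φ) y (Fin.cons 0 (Fin.tail y) : Fin 4 → ℝ)
  rw [Fin.sum_univ_succ] at h
  simp only [Fin.cons_zero, zero_mul, zero_add, Fin.cons_succ] at h
  rw [h, hasFDerivAt_Psi hs hφ hy, Fin.tail_cons, radialGauge_euler hs hφ hy, Fin.cons_zero]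
  simp only [rsq, Finset.mul_sum]
  rw [mul_zero, add_zero]
  congr 1
  exact Finset.sum_congr rfl fun i _ => by ring

/-- The conormal of the lateral boundary is uniformly space-like, up to the conformal factor. -/
theorem conormal_spacelike (hs : ContMDiff (𝓡 2) 𝓘(ℝ, ℝ) ∞ φ) (hφ : ∀ θ, 0 < φ θ) {μ : ℝ}
    (hμ : 0 < μ) (hμφ : ∀ x, μ * Real.sqrt (rsq x) ≤ radialGauge φ x)
    {y : Fin 4 → ℝ} (h0 : 0 ≤ y 0) (hπ : y 0 < Real.pi) (hΨ : Psi φ y = 0) :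
    framed (Psi φ) y 0 ^ 2 ≤ (conf (Fin.tail y))⁻¹ ^ 2 ∧
    (conf (Fin.tail y))⁻¹ ^ 2 * μ ^ 2 + framed (Psi φ) y 0 ^ 2
      ≤ ∑ j : Fin 3, framed (Psi φ) y j.succ ^ 2 := by
  have hy := tail_ne_zero_of_nonneg h0 hπ hΨ.ge
  set x := Fin.tail y with hx
  set s := Real.sin (y 0 / 2)
  set c := Real.cos (y 0 / 2)
  have hsc : s ^ 2 + c ^ 2 = 1 := Real.sin_sq_add_cos_sq _
  have hq1 := one_add_rsq_pos x
  have hci : (conf x)⁻¹ = (1 + rsq x) / 2 := by rw [conf, inv_div]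
  have hf0 : framed (Psi φ) y 0 = 2 * s * c * (conf x)⁻¹ := by
    rw [framed_zero, pd_zero_Psi hs hφ hy, hci]; ring
  set G := ∑ j : Fin 3, pd j.succ (Psi φ) y ^ 2 with hG
  have hfj : ∑ j : Fin 3, framed (Psi φ) y j.succ ^ 2 = (conf x)⁻¹ ^ 2 * G := by
    rw [hG, Finset.mul_sum]
    refine Finset.sum_congr rfl fun j _ => ?_
    rw [framed, scale_succ, div_eq_mul_inv]; ring
  have hrad := radial_deriv_Psi hs hφ hy
  rw [← hx] at hrad
  set m := radialGauge φ x with hm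
  -- On the boundary the radial derivative becomes `m + 2s²|x|² = c² + s²|x|²`, whose square is `m²
  -- + 4s²c²|x|²`.
  have hm1 : m = c ^ 2 - s ^ 2 * rsq x := by
    have : m - 1 + s ^ 2 * (1 + rsq x) = 0 := hΨ
    linear_combination this - hsc
  -- Cauchy–Schwarz: the radial derivative bounds the full spatial gradient `G` from below.
  have hCS : (m + 2 * s ^ 2 * rsq x) ^ 2 ≤ rsq x * G := by
    rw [← hrad]
    exact Finset.sum_mul_sq_le_sq_mul_sq _ _ _
  have hq0 : 0 < rsq x := by
    rcases (rsq_nonneg x).lt_or_eq with h | h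
    · exact h
    · exfalso; apply hy
      rw [rsq, eq_comm, Finset.sum_eq_zero_iff_of_nonneg fun _ _ => sq_nonneg _] at h
      ext i
      exact pow_eq_zero_iff two_ne_zero |>.1 (h i (Finset.mem_univ _))
  have hmμ : μ ^ 2 * rsq x ≤ m ^ 2 := by
    have h1 := hμφ x
    have h2 : 0 ≤ μ * Real.sqrt (rsq x) := by positivity
    have h3 := mul_self_le_mul_self h2 h1
    have h4 := Real.mul_self_sqrt hq0.le
    calc μ ^ 2 * rsq x = μ * Real.sqrt (rsq x) * (μ * Real.sqrt (rsq x)) := by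
          rw [← h4]; ring_nf; rw [Real.sqrt_sq (Real.sqrt_nonneg _)]
      _ ≤ m ^ 2 := by rw [sq]; exact h3
  -- The term `4s²c²` is exactly what `(∂_T Psi)²` needs after scaling, and `m²/|x|² ≥ μ²` is the
  -- uniform excess.
  have hGle : μ ^ 2 + 4 * s ^ 2 * c ^ 2 ≤ G := by
    have h1 : rsq x * (μ ^ 2 + 4 * s ^ 2 * c ^ 2) ≤ rsq x * G := by
      refine le_trans ?_ hCS
      rw [hm1] at hmμ ⊢
      nlinarith
    exact le_of_mul_le_mul_left h1 hq0
  have hb : 0 ≤ (conf x)⁻¹ ^ 2 := sq_nonneg _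
  rw [hfj, hf0]
  constructor
  · have : 4 * s ^ 2 * c ^ 2 ≤ 1 := by nlinarith [sq_nonneg (s ^ 2 - c ^ 2)]
    nlinarith
  · nlinarith

/-- The space-like margin `λ⁻² μ²` of the conormal absorbs the `κ`-perturbation of the quadratic
form. The hypothesis on `κ` contains no `T`, so the choice is uniform up to `T = π`. -/
theorem conormal_bilin_nonpos (hs : ContMDiff (𝓡 2) 𝓘(ℝ, ℝ) ∞ φ) (hφ : ∀ θ, 0 < φ θ) {μ : ℝ}
    (hμ : 0 < μ) (hμφ : ∀ x, μ * Real.sqrt (rsq x) ≤ radialGauge φ x)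
    {y : Fin 4 → ℝ} (h0 : 0 ≤ y 0) (hπ : y 0 < Real.pi) (hΨ : Psi φ y = 0)
    {q : (Fin 4 → ℝ) → Matrix (Fin 4) (Fin 4) ℝ} {κ : ℝ} (hκ0 : 0 ≤ κ)
    (hκ : 4 * κ * (μ ^ 2 + 2) ≤ μ ^ 2)
    (hq : ∀ k l, |q y k l - Matrix.diagonal mink k l| ≤ κ) :
    ∑ k, ∑ l, dens q y k l * (pd k (Psi φ) y * pd l (Psi φ) y) ≤ 0 := by
  obtain ⟨h1, h2⟩ := conormal_spacelike hs hφ hμ hμφ h0 hπ hΨ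
  have h3 := dens_bilin q y (fun k => pd k (Psi φ) y)
  have h4 := (abs_le.1 (bilin_le hq (framed (Psi φ) y))).2
  rw [h3]
  refine mul_nonpos_of_nonneg_of_nonpos (pow_pos (conf_pos _) 3).le ?_
  change ∑ k, ∑ l, q y k l * (framed (Psi φ) y k * framed (Psi φ) y l) ≤ 0
  have h5 : ∑ k, framed (Psi φ) y k ^ 2 = framed (Psi φ) y 0 ^ 2
    + ∑ j : Fin 3, framed (Psi φ) y j.succ ^ 2 := Fin.sum_univ_succ _
  rw [h5] at h4
  set B := framed (Psi φ) y 0 ^ 2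
  set A := ∑ j : Fin 3, framed (Psi φ) y j.succ ^ 2
  set t := (conf (Fin.tail y))⁻¹ ^ 2
  have ht : 0 ≤ t := sq_nonneg _
  -- it remains to see that `4κ(A + B) ≤ A - B`
  have hκ1 : 4 * κ ≤ 1 := by
    by_contra hne
    have := sq_nonneg μ
    nlinarith [not_le.1 hne]
  have h6 : 4 * κ * (A + B) ≤ A - B := by
    -- Each summand is nonnegative: by the space-like margin, by `B ≤ t`, and by the smallness of
    -- `κ`, respectively.
    have e : A - B - 4 * κ * (A + B) = (1 - 4 * κ) * (A - B - t * μ ^ 2) + 8 * κ * (t - B)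
      + t * (μ ^ 2 - 4 * κ * (μ ^ 2 + 2)) := by ring
    have e1 : 0 ≤ (1 - 4 * κ) * (A - B - t * μ ^ 2) := mul_nonneg (by linarith) (by linarith)
    have e2 : 0 ≤ 8 * κ * (t - B) := mul_nonneg (by linarith) (by linarith)
    have e3 : 0 ≤ t * (μ ^ 2 - 4 * κ * (μ ^ 2 + 2)) := mul_nonneg ht (by linarith)
    linarith
  linarith

end

/-! ### The mixed problem in coordinates and the sign of the boundary flux. -/

section

open Set Filter Topology

variable {φ : S2 → ℝ}

/-- `y` lies in the closure, within `0 ≤ T < π`, of the domain in the stereographic chart. -/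
def InRegion (φ : S2 → ℝ) (y : Fin 4 → ℝ) : Prop := 0 ≤ y 0 ∧ y 0 < Real.pi ∧ 0 ≤ Psi φ y

/-- The local coordinate form of the mixed problem: a symmetric density `q` that is `κ`-close to
the Minkowski metric, and a function `v` that vanishes on the lateral boundary and whose
differential is bounded near the south pole. -/
structure WaveData (φ : S2 → ℝ) (κ : ℝ) (q : (Fin 4 → ℝ) → Matrix (Fin 4) (Fin 4) ℝ)
    (v : (Fin 4 → ℝ) → ℝ) : Prop where
  contDiffAt_q : ∀ y, InRegion φ y → ∀ j k, ContDiffAt ℝ 1 (fun z => q z j k) y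
  contDiffAt_v : ∀ y, InRegion φ y → ContDiffAt ℝ 2 v y
  isSymm : ∀ y, InRegion φ y → (q y).IsSymm
  close : ∀ y, InRegion φ y → ∀ j k, |q y j k - Matrix.diagonal mink j k| ≤ κ
  boundary : ∀ y, 0 ≤ y 0 → y 0 < Real.pi → Psi φ y = 0 → v y = 0
  bounded : ∀ T < Real.pi, ∃ M r : ℝ, ∀ y : Fin 4 → ℝ, 0 ≤ y 0 → y 0 ≤ T → r ≤ rsq (Fin.tail y) →
    ∑ k, framed v y k ^ 2 ≤ M

theorem Psi_cons_smul (T : ℝ) {c : ℝ} (hc : 0 < c) (x : Fin 3 → ℝ) :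
    Psi φ (Fin.cons T (c • x)) = c * radialGauge φ x - 1
      + Real.sin (T / 2) ^ 2 * (1 + c ^ 2 * rsq x) := by
  have h : rsq (c • x) = c ^ 2 * rsq x := by
    simp only [rsq, Pi.smul_apply, smul_eq_mul, mul_pow, ← Finset.mul_sum]
  unfold Psi
  rw [Fin.tail_cons, Fin.cons_zero, radialGauge_smul φ hc, h]

theorem rsq_pos {x : Fin 3 → ℝ} (hx : x ≠ 0) : 0 < rsq x := by
  rcases (rsq_nonneg x).lt_or_eq with h | h
  · exact h
  · exfalso; apply hx
    rw [rsq, eq_comm, Finset.sum_eq_zero_iff_of_nonneg fun _ _ => sq_nonneg _] at h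
    ext i
    exact pow_eq_zero_iff two_ne_zero |>.1 (h i (Finset.mem_univ _))

theorem radialGauge_pos (hφ : ∀ θ, 0 < φ θ) {x : Fin 3 → ℝ} (hx : x ≠ 0) :
    0 < radialGauge φ x := by
  unfold radialGauge
  rw [norm_toLp]
  exact div_pos (Real.sqrt_pos.2 (rsq_pos hx)) (hφ _)

theorem continuous_cons_smul (T : ℝ) (x : Fin 3 → ℝ) :
    Continuous fun c : ℝ => (Fin.cons T (c • x) : Fin 4 → ℝ) :=
  (contDiff_cons (n := 0) T).continuous.comp (continuous_id.smul continuous_const)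

/-- A boundary point is a limit of points of the domain at the same time. -/
theorem frequently_Psi_pos (hφ : ∀ θ, 0 < φ θ) {y : Fin 4 → ℝ} (hy : Fin.tail y ≠ 0)
    (hΨ : Psi φ y = 0) : ∃ᶠ z in 𝓝 y, z 0 = y 0 ∧ 0 < Psi φ z := by
  set x := Fin.tail y with hx
  have hyc : y = Fin.cons (y 0) ((1 : ℝ) • x) := by rw [one_smul, hx, Fin.cons_self_tail]
  -- Dilating `x` by `c > 1` strictly increases `Psi`; let `c` decrease to `1`.
  have hc : Tendsto (fun c : ℝ => (Fin.cons (y 0) (c • x) : Fin 4 → ℝ)) (𝓝[>] 1) (𝓝 y) := by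
    have := (continuous_cons_smul (y 0) x).tendsto 1
    rw [← hyc] at this
    exact this.mono_left nhdsWithin_le_nhds
  refine hc.frequently (Eventually.frequently ?_)
  filter_upwards [self_mem_nhdsWithin] with c hc1
  have hc1 : 1 < c := hc1
  refine ⟨rfl, ?_⟩
  have h0 : Psi φ y = 1 * radialGauge φ x - 1 + Real.sin (y 0 / 2) ^ 2 * (1 + 1 ^ 2 * rsq x) := by
    conv_lhs => rw [hyc]
    exact Psi_cons_smul _ one_pos _
  rw [Psi_cons_smul _ (by linarith)]
  have hg := radialGauge_pos hφ hy
  have h1 : 0 ≤ Real.sin (y 0 / 2) ^ 2 * rsq x := mul_nonneg (sq_nonneg _) (rsq_nonneg x)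
  have h2 : 1 ≤ c ^ 2 := by nlinarith
  nlinarith

/-- A boundary point at time `0` is a limit of boundary points at positive times. -/
theorem frequently_boundary_pos {y : Fin 4 → ℝ} (hy0 : y 0 = 0) (hΨ : Psi φ y = 0) :
    ∃ᶠ z in 𝓝 y, 0 < z 0 ∧ z 0 < Real.pi ∧ Psi φ z = 0 := by
  set x := Fin.tail y with hx
  have hyc : y = Fin.cons 0 ((1 : ℝ) • x) := by
    rw [one_smul, hx, ← hy0, Fin.cons_self_tail]
  have hm : radialGauge φ x = 1 := by
    have h0 : Psi φ y = 1 * radialGauge φ x - 1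
        + Real.sin (0 / 2) ^ 2 * (1 + 1 ^ 2 * rsq x) := by
      conv_lhs => rw [hyc]
      exact Psi_cons_smul _ one_pos _
    rw [hΨ] at h0
    simp at h0
    linarith
  have hcont : Tendsto (fun p : ℝ × ℝ => (Fin.cons p.1 (p.2 • x) : Fin 4 → ℝ)) (𝓝 (0, 1)) (𝓝 y) := by
    have : Continuous fun p : ℝ × ℝ => (Fin.cons p.1 (p.2 • x) : Fin 4 → ℝ) :=
      continuous_cons.comp (continuous_fst.prodMk (continuous_snd.smul continuous_const))
    have h := this.tendsto (0, 1)
    rwa [← hyc] at h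
  rw [frequently_iff]
  intro U hU
  have hV := hcont hU
  rw [mem_map, Metric.mem_nhds_iff] at hV
  obtain ⟨r, hr, hball⟩ := hV
  -- `e < r` keeps the new point in `U`; `e ≤ 1/2` keeps the dilation factor `c ≥ 1 - e` positive.
  set e := min (r / 2) (1 / 2) with he
  have he0 : 0 < e := by positivity
  have he1 : e ≤ 1 / 2 := min_le_right _ _
  have her : e < r := (min_le_left _ _).trans_lt (by linarith)
  -- choose a time with `sin² (T/2) (1 + |x|²) < e`
  have hsm : Tendsto (fun T : ℝ => Real.sin (T / 2) ^ 2 * (1 + rsq x)) (𝓝[>] 0) (𝓝 0) := by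
    have : Continuous fun T : ℝ => Real.sin (T / 2) ^ 2 * (1 + rsq x) := by fun_prop
    have h := this.tendsto 0
    simp only [zero_div, Real.sin_zero] at h
    norm_num at h
    exact h.mono_left nhdsWithin_le_nhds
  have hev1 : ∀ᶠ T in 𝓝[>] (0 : ℝ), T < min r Real.pi :=
    nhdsWithin_le_nhds (gt_mem_nhds (lt_min hr Real.pi_pos))
  have hev2 : ∀ᶠ T in 𝓝[>] (0 : ℝ), 0 < T := self_mem_nhdsWithin
  have hev : ∀ᶠ T in 𝓝[>] (0 : ℝ), Real.sin (T / 2) ^ 2 * (1 + rsq x) < e ∧ T < min r Real.pi ∧ 0 < T :=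
    (hsm.eventually (gt_mem_nhds he0)).and (hev1.and hev2)
  obtain ⟨T, hT1, hT2, hT0⟩ := hev.exists
  have hfc : ContinuousOn (fun c : ℝ => c * radialGauge φ x - 1
      + Real.sin (T / 2) ^ 2 * (1 + c ^ 2 * rsq x)) (Icc (1 - e) 1) := by fun_prop
  have hs0 := sq_nonneg (Real.sin (T / 2))
  have hq0 := rsq_nonneg x
  have hivt := intermediate_value_Icc (by linarith : 1 - e ≤ 1) hfc
  -- At `c = 1` the value is nonnegative because `T` only adds to `Psi`; at `c = 1 - e` it is
  -- negative by the choice of `T`.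
  have hmem : (0 : ℝ) ∈ (fun c : ℝ => c * radialGauge φ x - 1
      + Real.sin (T / 2) ^ 2 * (1 + c ^ 2 * rsq x)) '' Icc (1 - e) 1 := by
    apply hivt
    constructor
    · rw [hm]
      have h1 : (1 - e) ^ 2 ≤ 1 := by nlinarith
      have h2 := mul_nonneg hs0 hq0
      nlinarith
    · rw [hm]
      have h2 := mul_nonneg hs0 hq0
      nlinarith
  obtain ⟨c, ⟨hc1, hc2⟩, hc0⟩ := hmem
  have hTc : (T, c) ∈ Metric.ball ((0 : ℝ), (1 : ℝ)) r := by
    rw [Metric.mem_ball, Prod.dist_eq, max_lt_iff, Real.dist_eq, Real.dist_eq, sub_zero, abs_of_pos hT0]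
    refine ⟨hT2.trans_le (min_le_left _ _), ?_⟩
    rw [abs_sub_lt_iff]; constructor <;> linarith
  refine ⟨Fin.cons T (c • x), hball hTc, ?_, ?_, ?_⟩
  · exact hT0
  · exact hT2.trans_le (min_le_right _ _)
  · rw [Psi_cons_smul _ (by linarith)]; exact hc0

namespace WaveData

variable {κ : ℝ} {q : (Fin 4 → ℝ) → Matrix (Fin 4) (Fin 4) ℝ} {v : (Fin 4 → ℝ) → ℝ}

theorem contDiffAt_dens (hD : WaveData φ κ q v) {y : Fin 4 → ℝ} (hy : InRegion φ y) (j k : Fin 4) :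
    ContDiffAt ℝ 1 (fun z => dens q z j k) y :=
  ((((contDiff_conf.comp contDiff_tail).pow 3).contDiffAt).mul (hD.contDiffAt_q y hy j k)).div
    ((contDiff_scale j).mul (contDiff_scale k)).contDiffAt
    (mul_pos (scale_pos y j) (scale_pos y k)).ne'

theorem isSymm_dens (hD : WaveData φ κ q v) {y : Fin 4 → ℝ} (hy : InRegion φ y) :
    (dens q y).IsSymm := by
  ext j k
  have := (hD.isSymm y hy).apply j k
  simp only [Matrix.transpose_apply, dens, Matrix.of_apply, this, mul_comm (scale y j)]

theorem contDiffAt_current' (hD : WaveData φ κ q v) {y : Fin 4 → ℝ} (hy : InRegion φ y)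
    (j : Fin 4) : ContDiffAt ℝ 1 (current (dens q) v j) y :=
  contDiffAt_current (hD.contDiffAt_dens hy) (hD.contDiffAt_v y hy) j

/-- The flux of the energy current through the level sets of `Psi`. -/
def flux (φ : S2 → ℝ) (q : (Fin 4 → ℝ) → Matrix (Fin 4) (Fin 4) ℝ) (v : (Fin 4 → ℝ) → ℝ)
    (y : Fin 4 → ℝ) : ℝ := ∑ j, current (dens q) v j y * pd j (Psi φ) y

theorem continuousAt_flux (hs : ContMDiff (𝓡 2) 𝓘(ℝ, ℝ) ∞ φ) (hφ : ∀ θ, 0 < φ θ)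
    (hD : WaveData φ κ q v) {y : Fin 4 → ℝ} (hy : InRegion φ y) :
    ContinuousAt (flux φ q v) y := by
  have hy' := tail_ne_zero_of_nonneg hy.1 hy.2.1 hy.2.2
  unfold flux
  exact tendsto_finsetSum _ fun j _ => (hD.contDiffAt_current' hy j).continuousAt.mul
    (continuousAt_pd (contDiffAt_Psi hs hφ hy') j)

/-- `v` is constant on the boundary `{Psi = 0}`, so every boundary point is a constrained extremum
and Lagrange multipliers make `dv` a multiple of `dPsi`. `flux_eq` then gives the sign, from `∂_0
Psi > 0` and the space-like conormal. Positive time is used both to have boundary points at earlier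
and later times and to have `∂_0 Psi ≠ 0`. -/
theorem flux_nonpos_of_pos (hs : ContMDiff (𝓡 2) 𝓘(ℝ, ℝ) ∞ φ) (hφ : ∀ θ, 0 < φ θ) {μ : ℝ}
    (hμ : 0 < μ) (hμφ : ∀ x, μ * Real.sqrt (rsq x) ≤ radialGauge φ x) (hκ0 : 0 ≤ κ)
    (hκ : 4 * κ * (μ ^ 2 + 2) ≤ μ ^ 2)
    (hD : WaveData φ κ q v) {y : Fin 4 → ℝ} (h0 : 0 < y 0) (hπ : y 0 < Real.pi)
    (hΨ : Psi φ y = 0) : flux φ q v y ≤ 0 := by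
  have hreg : InRegion φ y := ⟨h0.le, hπ, hΨ.ge⟩
  have hy' := tail_ne_zero_of_nonneg h0.le hπ hΨ.ge
  have hextr : IsLocalExtrOn v {z | Psi φ z = Psi φ y} y := by
    left
    have hv0 := hD.boundary y h0.le hπ hΨ
    have hev : ∀ᶠ z : Fin 4 → ℝ in 𝓝[{z | Psi φ z = Psi φ y}] y, 0 < z 0 ∧ z 0 < Real.pi :=
      nhdsWithin_le_nhds (((continuous_apply 0).continuousAt.eventually (lt_mem_nhds h0)).and
        ((continuous_apply 0).continuousAt.eventually (gt_mem_nhds hπ)))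
    filter_upwards [hev, self_mem_nhdsWithin] with z hz hzΨ
    have hzΨ : Psi φ z = Psi φ y := hzΨ
    rw [hv0, hD.boundary z hz.1.le hz.2 (hzΨ.trans hΨ)]
  have hvs := (hD.contDiffAt_v y hreg).hasStrictFDerivAt two_ne_zero
  have hΨs := (contDiffAt_Psi hs hφ hy').hasStrictFDerivAt one_ne_zero
  obtain ⟨a, b, hab, hlin⟩ := hextr.exists_multipliers_of_hasStrictFDerivAt_1d hΨs hvs
  have hψ0 : 0 < pd 0 (Psi φ) y := by
    rw [pd_zero_Psi hs hφ hy']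
    have h1 := cos_half_pos h0.le hπ
    have h2 : 0 < Real.sin (y 0 / 2) := Real.sin_pos_of_pos_of_lt_pi (by linarith) (by linarith)
    have h3 := one_add_rsq_pos (Fin.tail y)
    positivity
  have hlin' : ∀ j, a * pd j (Psi φ) y + b * pd j v y = 0 := fun j => by
    have := congrArg (fun L => L (Pi.single j 1)) hlin
    simpa [pd] using this
  -- With `b = 0` the multiplier relation would force `∂_0 Psi = 0`.
  have hb : b ≠ 0 := by
    intro hb
    have := hlin' 0
    rw [hb, zero_mul, add_zero] at this
    rcases mul_eq_zero.1 this with h | h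
    · exact hab (by rw [h, hb]; rfl)
    · exact hψ0.ne' h
  have hv : ∀ j, pd j v y = (-a / b) * pd j (Psi φ) y := fun j => by
    have := hlin' j
    field_simp
    linarith
  unfold flux
  rw [flux_eq hv]
  exact mul_nonpos_of_nonneg_of_nonpos (by positivity)
    (conormal_bilin_nonpos hs hφ hμ hμφ h0.le hπ hΨ hκ0 hκ (hD.close y hreg))

/-- At time `0` the multiplier argument is not available, since the boundary condition says nothing
about `T < 0`. The flux is continuous and the point is a limit of boundary points at positive times.
-/
theorem flux_nonpos (hs : ContMDiff (𝓡 2) 𝓘(ℝ, ℝ) ∞ φ) (hφ : ∀ θ, 0 < φ θ) {μ : ℝ}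
    (hμ : 0 < μ) (hμφ : ∀ x, μ * Real.sqrt (rsq x) ≤ radialGauge φ x) (hκ0 : 0 ≤ κ)
    (hκ : 4 * κ * (μ ^ 2 + 2) ≤ μ ^ 2)
    (hD : WaveData φ κ q v) {y : Fin 4 → ℝ} (h0 : 0 ≤ y 0) (hπ : y 0 < Real.pi)
    (hΨ : Psi φ y = 0) : flux φ q v y ≤ 0 := by
  rcases h0.lt_or_eq with h | h
  · exact flux_nonpos_of_pos hs hφ hμ hμφ hκ0 hκ hD h hπ hΨ
  · by_contra hpos
    have hc := continuousAt_flux hs hφ hD ⟨h0, hπ, hΨ.ge⟩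
    have hev := hc.eventually (lt_mem_nhds (not_le.1 hpos))
    obtain ⟨z, ⟨hz0, hzπ, hzΨ⟩, hz⟩ := ((frequently_boundary_pos h.symm hΨ).and_eventually hev).exists
    exact absurd (flux_nonpos_of_pos hs hφ hμ hμφ hκ0 hκ hD hz0 hzπ hzΨ) (not_le.2 hz)

/-- An upper bound on `Psi` bounds the gauge, because the remaining term is nonnegative, and the
gauge dominates `μ |x|`. -/
theorem isCompact_strip (hs : ContMDiff (𝓡 2) 𝓘(ℝ, ℝ) ∞ φ) (hφ : ∀ θ, 0 < φ θ) {μ : ℝ}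
    (hμ : 0 < μ) (hμφ : ∀ x, μ * Real.sqrt (rsq x) ≤ radialGauge φ x) (T b : ℝ) :
    IsCompact {y : Fin 4 → ℝ | 0 ≤ y 0 ∧ y 0 ≤ T ∧ 0 ≤ Psi φ y ∧ Psi φ y ≤ b} := by
  have hc := continuous_Psi hs hφ
  have h0 : Continuous fun y : Fin 4 → ℝ => y 0 := continuous_apply 0
  refine Metric.isCompact_of_isClosed_isBounded ?_ ?_
  · exact (isClosed_le continuous_const h0).inter ((isClosed_le h0 continuous_const).inter
      ((isClosed_le continuous_const hc).inter (isClosed_le hc continuous_const)))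
  · refine (Metric.isBounded_closedBall (x := 0) (r := max |T| (|b + 1| / μ))).subset ?_
    rintro y ⟨hy0, hyT, -, hyb⟩
    rw [mem_closedBall_zero_iff, pi_norm_le_iff_of_nonneg (le_max_of_le_left (abs_nonneg _))]
    have hg : radialGauge φ (Fin.tail y) ≤ b + 1 := by
      have : 0 ≤ Real.sin (y 0 / 2) ^ 2 * (1 + rsq (Fin.tail y)) :=
        mul_nonneg (sq_nonneg _) (one_add_rsq_pos _).le
      unfold Psi at hyb
      linarith
    have hr : Real.sqrt (rsq (Fin.tail y)) ≤ |b + 1| / μ := by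
      rw [le_div_iff₀ hμ, mul_comm]
      exact ((hμφ _).trans hg).trans (le_abs_self _)
    intro i
    refine Fin.cases ?_ (fun i => ?_) i
    · refine le_max_of_le_left ?_
      rw [Real.norm_eq_abs, abs_of_nonneg hy0]
      exact hyT.trans (le_abs_self _)
    · refine le_max_of_le_right (le_trans ?_ hr)
      rw [Real.norm_eq_abs]
      exact Real.abs_le_sqrt (Finset.single_le_sum (f := fun i => Fin.tail y i ^ 2)
        (fun _ _ => sq_nonneg _) (Finset.mem_univ i))

/-- In a thin strip along the lateral boundary, the outward flux of energy is almost nonpositive. -/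
theorem exists_flux_le (hs : ContMDiff (𝓡 2) 𝓘(ℝ, ℝ) ∞ φ) (hφ : ∀ θ, 0 < φ θ) {μ : ℝ}
    (hμ : 0 < μ) (hμφ : ∀ x, μ * Real.sqrt (rsq x) ≤ radialGauge φ x) (hκ0 : 0 ≤ κ)
    (hκ : 4 * κ * (μ ^ 2 + 2) ≤ μ ^ 2) (hD : WaveData φ κ q v) {T τ : ℝ} (hT : T < Real.pi)
    (hτ : 0 < τ) : ∃ ε₀ : ℝ, 0 < ε₀ ∧ ∀ y : Fin 4 → ℝ, 0 ≤ y 0 → y 0 ≤ T → 0 ≤ Psi φ y →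
      Psi φ y ≤ ε₀ → flux φ q v y ≤ τ := by
  set K := {y : Fin 4 → ℝ | 0 ≤ y 0 ∧ y 0 ≤ T ∧ 0 ≤ Psi φ y ∧ Psi φ y ≤ 1} with hK
  have hKc : IsCompact K := isCompact_strip hs hφ hμ hμφ T 1
  have hfc : ContinuousOn (flux φ q v) K := fun y hy =>
    (continuousAt_flux hs hφ hD ⟨hy.1, hy.2.1.trans_lt hT, hy.2.2.1⟩).continuousWithinAt
  -- The bad set `{flux ≥ τ}` is compact and misses `{Psi = 0}`, so `Psi` has a positive minimum on
  -- it; half of this minimum serves as the width.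
  have hbad : IsCompact (K ∩ flux φ q v ⁻¹' Ici τ) :=
    hKc.of_isClosed_subset (hfc.preimage_isClosed_of_isClosed hKc.isClosed isClosed_Ici)
      inter_subset_left
  rcases (K ∩ flux φ q v ⁻¹' Ici τ).eq_empty_or_nonempty with hempty | hne
  · refine ⟨1, one_pos, fun y h0 h1 h2 h3 => ?_⟩
    by_contra hgt
    have : y ∈ K ∩ flux φ q v ⁻¹' Ici τ := ⟨⟨h0, h1, h2, h3⟩, (not_le.1 hgt).le⟩
    rw [hempty] at this
    exact this
  · obtain ⟨z, hz, hmin⟩ := hbad.exists_isMinOn hne (continuous_Psi hs hφ).continuousOn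
    have hzpos : 0 < Psi φ z := by
      rcases hz.1.2.2.1.lt_or_eq with h | h
      · exact h
      · exfalso
        have h1 := flux_nonpos hs hφ hμ hμφ hκ0 hκ hD hz.1.1 (hz.1.2.1.trans_lt hT) h.symm
        have h2 : τ ≤ flux φ q v z := hz.2
        linarith
    refine ⟨min 1 (Psi φ z / 2), by positivity, fun y h0 h1 h2 h3 => ?_⟩
    by_contra hgt
    have hmem : y ∈ K ∩ flux φ q v ⁻¹' Ici τ :=
      ⟨⟨h0, h1, h2, h3.trans (min_le_left _ _)⟩, (not_le.1 hgt).le⟩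
    have h4 : Psi φ z ≤ Psi φ y := hmin hmem
    have h5 := h3.trans (min_le_right _ _)
    linarith

end WaveData

end

section

open Set Filter Topology MeasureTheory

/-! ### Cutoff functions -/

theorem deriv_smoothTransition_nonneg (t : ℝ) : 0 ≤ deriv Real.smoothTransition t :=
  Real.smoothTransition.monotone.deriv_nonneg

theorem deriv_smoothTransition_of_neg {t : ℝ} (ht : t < 0) : deriv Real.smoothTransition t = 0 := by
  have : Real.smoothTransition =ᶠ[𝓝 t] fun _ => 0 := by
    filter_upwards [gt_mem_nhds ht] with s hs
    exact Real.smoothTransition.zero_of_nonpos (le_of_lt hs)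
  rw [this.deriv_eq, deriv_const]

theorem deriv_smoothTransition_of_gt {t : ℝ} (ht : 1 < t) : deriv Real.smoothTransition t = 0 := by
  have : Real.smoothTransition =ᶠ[𝓝 t] fun _ => 1 := by
    filter_upwards [lt_mem_nhds ht] with s hs
    exact Real.smoothTransition.one_of_one_le (le_of_lt hs)
  rw [this.deriv_eq, deriv_const]

theorem continuous_deriv_smoothTransition : Continuous (deriv Real.smoothTransition) :=
  (Real.smoothTransition.contDiff (n := 1)).continuous_deriv le_rfl

theorem exists_deriv_smoothTransition_le : ∃ S : ℝ, 0 ≤ S ∧ ∀ t, deriv Real.smoothTransition t ≤ S := by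
  obtain ⟨S, hS⟩ := (isCompact_Icc (a := (0 : ℝ)) (b := 1)).exists_bound_of_continuousOn
    continuous_deriv_smoothTransition.continuousOn
  have hS0 : 0 ≤ S := (norm_nonneg _).trans (hS 0 ⟨le_rfl, zero_le_one⟩)
  refine ⟨S, hS0, fun t => ?_⟩
  by_cases h0 : t < 0
  · rw [deriv_smoothTransition_of_neg h0]; exact hS0
  · by_cases h1 : 1 < t
    · rw [deriv_smoothTransition_of_gt h1]; exact hS0
    · exact (le_abs_self _).trans (hS t ⟨not_lt.1 h0, not_lt.1 h1⟩)

theorem hasDerivAt_smoothTransition (t : ℝ) :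
    HasDerivAt Real.smoothTransition (deriv Real.smoothTransition t) t :=
  ((Real.smoothTransition.contDiff (n := 1)).differentiable one_ne_zero t).hasDerivAt

variable {φ : S2 → ℝ}

/-- A cutoff that vanishes for `Psi ≤ ε` and is `1` for `Psi ≥ 2 ε`. -/
def bcut (φ : S2 → ℝ) (ε : ℝ) (y : Fin 4 → ℝ) : ℝ := Real.smoothTransition (Psi φ y / ε - 1)

/-- The factor `β` in `d(bcut) = β d(Psi)`. -/
def bslope (φ : S2 → ℝ) (ε : ℝ) (y : Fin 4 → ℝ) : ℝ :=
  deriv Real.smoothTransition (Psi φ y / ε - 1) / ε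

/-- A cutoff that is `1` for `|x|² ≤ r` and vanishes for `|x|² ≥ 2 r`. -/
def scut (r : ℝ) (y : Fin 4 → ℝ) : ℝ := Real.smoothTransition (2 - rsq (Fin.tail y) / r)

theorem bcut_nonneg (ε : ℝ) (y : Fin 4 → ℝ) : 0 ≤ bcut φ ε y := Real.smoothTransition.nonneg _
theorem bcut_le_one (ε : ℝ) (y : Fin 4 → ℝ) : bcut φ ε y ≤ 1 := Real.smoothTransition.le_one _
theorem scut_nonneg (r : ℝ) (y : Fin 4 → ℝ) : 0 ≤ scut r y := Real.smoothTransition.nonneg _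
theorem scut_le_one (r : ℝ) (y : Fin 4 → ℝ) : scut r y ≤ 1 := Real.smoothTransition.le_one _

theorem bcut_eq_zero {ε : ℝ} (hε : 0 < ε) {y : Fin 4 → ℝ} (h : Psi φ y ≤ ε) : bcut φ ε y = 0 :=
  Real.smoothTransition.zero_of_nonpos (by rw [sub_nonpos, div_le_one hε]; exact h)

theorem bcut_eq_one {ε : ℝ} (hε : 0 < ε) {y : Fin 4 → ℝ} (h : 2 * ε ≤ Psi φ y) :
    bcut φ ε y = 1 :=
  Real.smoothTransition.one_of_one_le (by rw [le_sub_iff_add_le, le_div_iff₀ hε]; linarith)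

theorem scut_eq_zero {r : ℝ} (hr : 0 < r) {y : Fin 4 → ℝ} (h : 2 * r ≤ rsq (Fin.tail y)) :
    scut r y = 0 :=
  Real.smoothTransition.zero_of_nonpos (by rw [sub_nonpos, le_div_iff₀ hr]; exact h)

theorem scut_eq_one {r : ℝ} (hr : 0 < r) {y : Fin 4 → ℝ} (h : rsq (Fin.tail y) ≤ r) :
    scut r y = 1 :=
  Real.smoothTransition.one_of_one_le (by
    have : rsq (Fin.tail y) / r ≤ 1 := (div_le_one hr).2 h
    linarith)

theorem bslope_nonneg {ε : ℝ} (hε : 0 < ε) (y : Fin 4 → ℝ) : 0 ≤ bslope φ ε y :=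
  div_nonneg (deriv_smoothTransition_nonneg _) hε.le

theorem bslope_of_lt {ε : ℝ} (hε : 0 < ε) {y : Fin 4 → ℝ} (h : Psi φ y < ε) :
    bslope φ ε y = 0 := by
  unfold bslope
  rw [deriv_smoothTransition_of_neg (by rw [sub_neg, div_lt_one hε]; exact h), zero_div]

theorem bslope_of_gt {ε : ℝ} (hε : 0 < ε) {y : Fin 4 → ℝ} (h : 2 * ε < Psi φ y) :
    bslope φ ε y = 0 := by
  unfold bslope
  rw [deriv_smoothTransition_of_gt (by rw [lt_sub_iff_add_lt, lt_div_iff₀ hε]; linarith), zero_div]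

theorem eventually_Psi_lt (hs : ContMDiff (𝓡 2) 𝓘(ℝ, ℝ) ∞ φ) (hφ : ∀ θ, 0 < φ θ)
    {ε : ℝ} {y : Fin 4 → ℝ} (h : Psi φ y < ε) :
    ∀ᶠ z in 𝓝 y, Psi φ z < ε :=
  (continuous_Psi hs hφ).continuousAt.eventually (gt_mem_nhds h)

theorem bcut_eventuallyEq_zero (hs : ContMDiff (𝓡 2) 𝓘(ℝ, ℝ) ∞ φ) (hφ : ∀ θ, 0 < φ θ)
    {ε : ℝ} (hε : 0 < ε) {y : Fin 4 → ℝ} (h : Psi φ y < ε) :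
    bcut φ ε =ᶠ[𝓝 y] fun _ => 0 := by
  filter_upwards [eventually_Psi_lt hs hφ h] with z hz
  exact bcut_eq_zero hε hz.le

theorem contDiff_bcut (hs : ContMDiff (𝓡 2) 𝓘(ℝ, ℝ) ∞ φ) (hφ : ∀ θ, 0 < φ θ)
    {ε : ℝ} (hε : 0 < ε) : ContDiff ℝ 1 (bcut φ ε) := by
  rw [contDiff_iff_contDiffAt]
  intro y
  by_cases h : Psi φ y < ε
  · exact contDiffAt_const.congr_of_eventuallyEq (bcut_eventuallyEq_zero hs hφ hε h)
  · have hy := tail_ne_zero_of_pos (hε.trans_le (not_lt.1 h))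
    exact (Real.smoothTransition.contDiff (n := 1)).contDiffAt.comp y
      (((contDiffAt_Psi hs hφ hy).div_const ε).sub contDiffAt_const)

theorem pd_bcut (hs : ContMDiff (𝓡 2) 𝓘(ℝ, ℝ) ∞ φ) (hφ : ∀ θ, 0 < φ θ)
    {ε : ℝ} (hε : 0 < ε) (y : Fin 4 → ℝ) (j : Fin 4) :
    pd j (bcut φ ε) y = bslope φ ε y * pd j (Psi φ) y := by
  by_cases h : Psi φ y < ε
  · rw [bslope_of_lt hε h, zero_mul, pd_congr (bcut_eventuallyEq_zero hs hφ hε h), pd_const]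
  · have hy := tail_ne_zero_of_pos (hε.trans_le (not_lt.1 h))
    have hd := ((contDiffAt_Psi hs hφ hy).differentiableAt one_ne_zero).hasFDerivAt
    have h1 := ((hd.mul_const ε⁻¹).sub_const 1)
    have h2 := (hasDerivAt_smoothTransition _).comp_hasFDerivAt y h1
    unfold pd bslope
    have h3 : bcut φ ε = Real.smoothTransition ∘ fun z => Psi φ z * ε⁻¹ - 1 := by
      funext z; simp [bcut, div_eq_mul_inv]
    rw [h3, h2.fderiv, div_eq_mul_inv, div_eq_mul_inv]
    simp
    ring

theorem continuous_bslope (hs : ContMDiff (𝓡 2) 𝓘(ℝ, ℝ) ∞ φ) (hφ : ∀ θ, 0 < φ θ)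
    (ε : ℝ) : Continuous (bslope φ ε) :=
  (continuous_deriv_smoothTransition.comp
    (((continuous_Psi hs hφ).div_const ε).sub continuous_const)).div_const ε

theorem contDiffAt_bcut_mul (hs : ContMDiff (𝓡 2) 𝓘(ℝ, ℝ) ∞ φ) (hφ : ∀ θ, 0 < φ θ)
    {ε : ℝ} (hε : 0 < ε) {G : (Fin 4 → ℝ) → ℝ} {y : Fin 4 → ℝ}
    (hG : 0 < Psi φ y → ContDiffAt ℝ 1 G y) : ContDiffAt ℝ 1 (fun z => bcut φ ε z * G z) y := by
  by_cases h : 0 < Psi φ y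
  · exact (contDiff_bcut hs hφ hε).contDiffAt.mul (hG h)
  · refine (contDiffAt_const (c := (0 : ℝ))).congr_of_eventuallyEq ?_
    filter_upwards [bcut_eventuallyEq_zero hs hφ hε ((not_lt.1 h).trans_lt hε)] with z hz
    rw [hz, zero_mul]

theorem continuousAt_bcut_mul (hs : ContMDiff (𝓡 2) 𝓘(ℝ, ℝ) ∞ φ) (hφ : ∀ θ, 0 < φ θ)
    {ε : ℝ} (hε : 0 < ε) {G : (Fin 4 → ℝ) → ℝ} {y : Fin 4 → ℝ}
    (hG : 0 < Psi φ y → ContinuousAt G y) : ContinuousAt (fun z => bcut φ ε z * G z) y := by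
  by_cases h : 0 < Psi φ y
  · exact (contDiff_bcut hs hφ hε).continuous.continuousAt.mul (hG h)
  · refine (continuousAt_const (y := (0 : ℝ))).congr ?_
    filter_upwards [bcut_eventuallyEq_zero hs hφ hε ((not_lt.1 h).trans_lt hε)] with z hz
    rw [hz, zero_mul]

theorem continuousAt_bslope_mul (hs : ContMDiff (𝓡 2) 𝓘(ℝ, ℝ) ∞ φ) (hφ : ∀ θ, 0 < φ θ)
    {ε : ℝ} (hε : 0 < ε) {G : (Fin 4 → ℝ) → ℝ} {y : Fin 4 → ℝ}
    (hG : 0 < Psi φ y → ContinuousAt G y) : ContinuousAt (fun z => bslope φ ε z * G z) y := by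
  by_cases h : 0 < Psi φ y
  · exact (continuous_bslope hs hφ ε).continuousAt.mul (hG h)
  · refine (continuousAt_const (y := (0 : ℝ))).congr ?_
    filter_upwards [eventually_Psi_lt hs hφ ((not_lt.1 h).trans_lt hε)] with z hz
    rw [bslope_of_lt hε hz, zero_mul]

theorem contDiff_scut {r : ℝ} : ContDiff ℝ 1 (scut r) :=
  (Real.smoothTransition.contDiff (n := 1)).comp
    (contDiff_const.sub ((contDiff_rsq.comp contDiff_tail).div_const r))

theorem pd_scut_zero (r : ℝ) (y : Fin 4 → ℝ) : pd 0 (scut r) y = 0 :=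
  pd_zero_of_tail _ (fun x => Real.smoothTransition (2 - rsq x / r)) (fun _ => rfl) y

theorem abs_pd_scut_le {r S : ℝ} (hr : 0 < r) (hS : ∀ t, deriv Real.smoothTransition t ≤ S)
    (y : Fin 4 → ℝ) (j : Fin 3) : |pd j.succ (scut r) y| ≤ S * (2 * |Fin.tail y j|) / r := by
  have h1 : HasFDerivAt (fun z : Fin 4 → ℝ => rsq (Fin.tail z)) _ y :=
    HasFDerivAt.comp y (f := tailCLM) (hasFDerivAt_rsq (Fin.tail y)) tailCLM.hasFDerivAt
  have h2 := (hasDerivAt_smoothTransition _).comp_hasFDerivAt y ((h1.mul_const r⁻¹).const_sub 2)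
  have h3 : scut r = Real.smoothTransition ∘ fun z => 2 - rsq (Fin.tail z) * r⁻¹ := by
    funext z; simp [scut, div_eq_mul_inv]
  have h4 : pd j.succ (scut r) y = -(deriv Real.smoothTransition (2 - rsq (Fin.tail y) * r⁻¹)
      * (r⁻¹ * (2 * Fin.tail y j))) := by
    unfold pd
    rw [h3, h2.fderiv]
    simp [tailCLM_apply, tail_single_succ, Pi.single_apply]
  rw [h4, abs_neg, abs_mul, abs_mul, abs_mul, abs_of_nonneg (deriv_smoothTransition_nonneg _),
    abs_of_pos (inv_pos.2 hr), abs_two]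
  calc _ ≤ S * (r⁻¹ * (2 * |Fin.tail y j|)) :=
        mul_le_mul_of_nonneg_right (hS _) (by positivity)
    _ = _ := by rw [div_eq_mul_inv]; ring

theorem pd_scut_eq_zero {r : ℝ} (hr : 0 < r) {y : Fin 4 → ℝ} (h : rsq (Fin.tail y) < r)
    (j : Fin 4) : pd j (scut r) y = 0 := by
  have hc : Continuous fun z : Fin 4 → ℝ => rsq (Fin.tail z) :=
    ((contDiff_rsq (n := 0)).comp contDiff_tail).continuous
  have : scut r =ᶠ[𝓝 y] fun _ => 1 := by
    filter_upwards [hc.continuousAt.eventually (gt_mem_nhds h)] with z hz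
    exact scut_eq_one hr (le_of_lt hz)
  rw [pd_congr this, pd_const]

theorem isCompact_rsq_le (r : ℝ) : IsCompact {x : Fin 3 → ℝ | rsq x ≤ r} := by
  refine Metric.isCompact_of_isClosed_isBounded
    (isClosed_le (contDiff_rsq (n := 0)).continuous continuous_const) ?_
  refine (Metric.isBounded_closedBall (x := 0) (r := Real.sqrt r)).subset fun x hx => ?_
  rw [mem_closedBall_zero_iff, pi_norm_le_iff_of_nonneg (Real.sqrt_nonneg _)]
  intro i
  exact Real.abs_le_sqrt ((Finset.single_le_sum (f := fun i => x i ^ 2)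
    (fun _ _ => sq_nonneg _) (Finset.mem_univ i)).trans hx)

/-- `Psi ≤ 2` gives gauge at most `3`, hence `μ |x| ≤ 3`. The compact set thus obtained depends
neither on `T` nor on the width of the cutoff. -/
theorem rsq_le_of_Psi_le {μ : ℝ} (hμ : 0 < μ)
    (hμφ : ∀ x, μ * Real.sqrt (rsq x) ≤ radialGauge φ x) {y : Fin 4 → ℝ} (h : Psi φ y ≤ 2) :
    rsq (Fin.tail y) ≤ 9 / μ ^ 2 := by
  have h1 : 0 ≤ Real.sin (y 0 / 2) ^ 2 * (1 + rsq (Fin.tail y)) :=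
    mul_nonneg (sq_nonneg _) (one_add_rsq_pos _).le
  have h2 : μ * Real.sqrt (rsq (Fin.tail y)) ≤ 3 := by
    refine (hμφ _).trans ?_
    unfold Psi at h
    linarith
  rw [le_div_iff₀ (pow_pos hμ 2)]
  have h3 := Real.mul_self_sqrt (rsq_nonneg (Fin.tail y))
  have h4 := Real.sqrt_nonneg (rsq (Fin.tail y))
  nlinarith [mul_nonneg hμ.le h4]

/-- The integral of `bslope` over a time slice is bounded independently of the width of the
cutoff. -/
theorem exists_integral_bslope_le (hs : ContMDiff (𝓡 2) 𝓘(ℝ, ℝ) ∞ φ) (hφ : ∀ θ, 0 < φ θ) {μ : ℝ}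
    (hμ : 0 < μ) (hμφ : ∀ x, μ * Real.sqrt (rsq x) ≤ radialGauge φ x) {T₁ : ℝ}
    (hT₁ : T₁ < Real.pi) : ∃ C : ℝ, 0 ≤ C ∧ ∀ ε : ℝ, 0 < ε → ε ≤ 1 → ∀ T, 0 ≤ T → T ≤ T₁ →
      Integrable (fun x => bslope φ ε (Fin.cons T x)) ∧
      ∫ x, bslope φ ε (Fin.cons T x) ≤ C := by
  set K := {x : Fin 3 → ℝ | rsq x ≤ 9 / μ ^ 2} with hKdef
  have hK : IsCompact K := isCompact_rsq_le _
  have hKf : (volume : Measure (Fin 3 → ℝ)) K ≠ ⊤ := hK.measure_lt_top.ne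
  refine ⟨3 * volume.real K / Real.cos (T₁ / 2) ^ 2, by positivity, fun ε hε hε1 T hT0 hTT => ?_⟩
  have houtside : ∀ x ∉ K, 2 * ε < Psi φ (Fin.cons T x) := fun x hx => by
    by_contra hle
    have := rsq_le_of_Psi_le hμ hμφ (y := Fin.cons T x) ((not_lt.1 hle).trans (by linarith))
    rw [Fin.tail_cons] at this
    exact hx this
  have hint : Integrable fun x => bslope φ ε (Fin.cons T x) :=
    integrable_slice (fun x => (continuous_bslope hs hφ ε).continuousAt) hK
      fun x hx => bslope_of_gt hε (houtside x hx)
  refine ⟨hint, ?_⟩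
  have hb := contDiff_bcut hs hφ hε
  have hcoord : ∀ j : Fin 3, ContDiff ℝ 1 fun y : Fin 4 → ℝ => (1 - bcut φ ε y) * y j.succ :=
    fun j => (contDiff_const.sub hb).mul (contDiff_apply ℝ ℝ j.succ)
  -- The compactly supported radial field `(1 - bcut) x` has divergence of integral zero. This
  -- identifies the integral of `bslope` times the radial derivative of `Psi` with `3 ∫ (1 - bcut)`.
  have hzero : ∀ j : Fin 3, ∫ x, pd j.succ (fun y : Fin 4 → ℝ => (1 - bcut φ ε y) * y j.succ)
      (Fin.cons T x) = 0 := fun j =>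
    integral_pd_succ_eq_zero (fun x => (hcoord j).contDiffAt) hK (fun x hx => by
      rw [bcut_eq_one hε (houtside x hx).le, sub_self, zero_mul]) j
  have hpd : ∀ (j : Fin 3) (y : Fin 4 → ℝ),
      pd j.succ (fun y : Fin 4 → ℝ => (1 - bcut φ ε y) * y j.succ) y
        = (1 - bcut φ ε y) - bslope φ ε y * (Fin.tail y j * pd j.succ (Psi φ) y) := by
    intro j y
    have hbd := hb.differentiable one_ne_zero y
    have hcd : DifferentiableAt ℝ (fun _ : Fin 4 → ℝ => (1 : ℝ)) y := differentiableAt_const _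
    have hsd : DifferentiableAt ℝ (fun z => 1 - bcut φ ε z) y := hcd.sub hbd
    rw [pd_mul hsd (differentiableAt_apply j.succ y), pd_sub hcd hbd, pd_const, pd_bcut hs hφ hε]
    have : pd j.succ (fun z : Fin 4 → ℝ => z j.succ) y = 1 := by
      unfold pd
      rw [(hasFDerivAt_apply (𝕜 := ℝ) (F' := fun _ : Fin 4 => ℝ) j.succ y).fderiv]
      simp
    rw [this]
    simp only [Fin.tail]
    ring
  have hI1 : Integrable fun x => 1 - bcut φ ε (Fin.cons T x : Fin 4 → ℝ) :=
    integrable_slice (G := fun y => 1 - bcut φ ε y)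
      (fun x => (continuous_const.sub hb.continuous).continuousAt) hK fun x hx => by
        rw [bcut_eq_one hε (houtside x hx).le, sub_self]
  have hI2 : ∀ j : Fin 3, Integrable fun x => pd j.succ
      (fun y : Fin 4 → ℝ => (1 - bcut φ ε y) * y j.succ) (Fin.cons T x) := fun j =>
    integrable_slice (fun x => continuousAt_pd (hcoord j).contDiffAt _) hK fun x hx => by
      rw [hpd, bcut_eq_one hε (houtside x hx).le, bslope_of_gt hε (houtside x hx)]; ring
  have hsum : ∫ x, ∑ j : Fin 3, pd j.succ (fun y : Fin 4 → ℝ => (1 - bcut φ ε y) * y j.succ)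
      (Fin.cons T x) = 0 := by
    rw [integral_finsetSum _ fun j _ => hI2 j]
    exact Finset.sum_eq_zero fun j _ => hzero j
  have hc1 : 0 < Real.cos (T₁ / 2) := cos_half_pos (hT0.trans hTT) hT₁
  have hcT : Real.cos (T₁ / 2) ^ 2 ≤ Real.cos (T / 2) ^ 2 := by
    have : Real.cos (T₁ / 2) ≤ Real.cos (T / 2) :=
      Real.cos_le_cos_of_nonneg_of_le_pi (by linarith) (by linarith [Real.pi_pos]) (by linarith)
    exact pow_le_pow_left₀ hc1.le this 2
  have hpt : ∀ x, Real.cos (T₁ / 2) ^ 2 * bslope φ ε (Fin.cons T x)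
      + ∑ j : Fin 3, pd j.succ (fun y : Fin 4 → ℝ => (1 - bcut φ ε y) * y j.succ) (Fin.cons T x)
      ≤ 3 * K.indicator (fun _ => (1 : ℝ)) x := by
    intro x
    set y : Fin 4 → ℝ := Fin.cons T x with hy
    simp only [hpd]
    rw [Finset.sum_sub_distrib (fun _ => 1 - bcut φ ε y), ← Finset.mul_sum]
    have h1 : ∑ j : Fin 3, (1 - bcut φ ε y) ≤ 3 * K.indicator (fun _ => (1 : ℝ)) x := by
      rw [Finset.sum_const, Finset.card_univ, Fintype.card_fin, nsmul_eq_mul]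
      by_cases hx : x ∈ K
      · rw [indicator_of_mem hx]
        have := bcut_nonneg (φ := φ) ε y
        push_cast; linarith
      · rw [indicator_of_notMem hx, bcut_eq_one hε (houtside x hx).le]; simp
    -- Where `Psi > 0`, the gauge exceeds `cos²(T/2) - sin²(T/2)|x|²`, so the radial derivative of
    -- `Psi` exceeds `cos²(T/2)`.
    have h2 : Real.cos (T₁ / 2) ^ 2 * bslope φ ε y
        ≤ bslope φ ε y * ∑ j : Fin 3, Fin.tail y j * pd j.succ (Psi φ) y := by
      by_cases h : Psi φ y < ε
      · rw [bslope_of_lt hε h]; simp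
      · have hΨ0 : 0 < Psi φ y := hε.trans_le (not_lt.1 h)
        rw [radial_deriv_Psi hs hφ (tail_ne_zero_of_pos hΨ0), mul_comm]
        refine mul_le_mul_of_nonneg_left (hcT.trans ?_) (bslope_nonneg hε y)
        have h3 := Real.sin_sq_add_cos_sq (T / 2)
        have h4 : 0 ≤ Real.sin (T / 2) ^ 2 * rsq (Fin.tail y) :=
          mul_nonneg (sq_nonneg _) (rsq_nonneg _)
        have h5 : Psi φ y = radialGauge φ (Fin.tail y) - 1
          + Real.sin (T / 2) ^ 2 * (1 + rsq (Fin.tail y)) := rfl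
        have h6 : y 0 = T := rfl
        rw [h6]
        linarith
    linarith
  have hIK : Integrable (fun x => 3 * K.indicator (fun _ => (1 : ℝ)) x) :=
    ((integrable_indicator_iff hK.measurableSet).2 (integrableOn_const hKf)).const_mul 3
  have hfin := integral_mono (μ := volume) ((hint.const_mul (Real.cos (T₁ / 2) ^ 2)).add
    (integrable_finsetSum _ fun j _ => hI2 j)) hIK hpt
  rw [integral_add' (hint.const_mul _) (integrable_finsetSum _ fun j _ => hI2 j), hsum, add_zero,
    integral_const_mul, integral_const_mul, integral_indicator hK.measurableSet] at hfin
  simp only [integral_const, MeasurableSet.univ, measureReal_restrict_apply, univ_inter, smul_eq_mul,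
    mul_one] at hfin
  rw [le_div_iff₀ (pow_pos hc1 2), mul_comm]
  exact hfin

end

/-! ### The energy identity with cutoffs and the smallness of its errors. -/

section

open Set Filter Topology MeasureTheory

variable {φ : S2 → ℝ}

theorem pd_scut_eq_zero_of_gt {r : ℝ} (hr : 0 < r) {y : Fin 4 → ℝ} (h : 2 * r < rsq (Fin.tail y))
    (j : Fin 4) : pd j (scut r) y = 0 := by
  have hc : Continuous fun z : Fin 4 → ℝ => rsq (Fin.tail z) :=
    ((contDiff_rsq (n := 0)).comp contDiff_tail).continuous
  have : scut r =ᶠ[𝓝 y] fun _ => 0 := by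
    filter_upwards [hc.continuousAt.eventually (lt_mem_nhds h)] with z hz
    exact scut_eq_zero hr (le_of_lt hz)
  rw [pd_congr this, pd_const]

/-- The ball lies in a cube of side `2 √R`; only the growth `R^{3/2}` matters. -/
theorem volume_rsq_le (R : ℝ) :
    (volume : Measure (Fin 3 → ℝ)).real {x | rsq x ≤ R} ≤ (2 * Real.sqrt R) ^ 3 := by
  have hsub : {x : Fin 3 → ℝ | rsq x ≤ R} ⊆ Icc (fun _ => -Real.sqrt R) (fun _ => Real.sqrt R) := by
    intro x hx
    have h : ∀ i, |x i| ≤ Real.sqrt R := fun i =>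
      Real.abs_le_sqrt ((Finset.single_le_sum (f := fun i => x i ^ 2)
        (fun _ _ => sq_nonneg _) (Finset.mem_univ i)).trans hx)
    exact ⟨fun i => (abs_le.1 (h i)).1, fun i => (abs_le.1 (h i)).2⟩
  refine (measureReal_mono hsub isCompact_Icc.measure_lt_top.ne).trans (le_of_eq ?_)
  have hle : (fun _ => -Real.sqrt R : Fin 3 → ℝ) ≤ fun _ => Real.sqrt R := fun _ => by
    have := Real.sqrt_nonneg R
    beta_reduce; linarith
  rw [Measure.real, Real.volume_Icc_pi_toReal hle]
  simp
  ring

/-- The source term `∂_j (P^{jk} ∂_k v)`. -/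
def source (P : (Fin 4 → ℝ) → Matrix (Fin 4) (Fin 4) ℝ) (v : (Fin 4 → ℝ) → ℝ)
    (y : Fin 4 → ℝ) : ℝ := ∑ j, ∑ k, pd j (fun z => P z j k * pd k v z) y

/-- The deformation term `-½ (∂_0 P^{kl}) ∂_k v ∂_l v`. -/
def deform (P : (Fin 4 → ℝ) → Matrix (Fin 4) (Fin 4) ℝ) (v : (Fin 4 → ℝ) → ℝ)
    (y : Fin 4 → ℝ) : ℝ :=
  -((1 / 2) * ∑ k, ∑ l, pd 0 (fun z => P z k l) y * (pd k v y * pd l v y))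

/-- The error caused by the cutoffs in the energy identity. -/
def cutError (φ : S2 → ℝ) (q : (Fin 4 → ℝ) → Matrix (Fin 4) (Fin 4) ℝ) (v : (Fin 4 → ℝ) → ℝ)
    (ε r : ℝ) (y : Fin 4 → ℝ) : ℝ :=
  bslope φ ε y * (scut r y * WaveData.flux φ q v y)
    + bcut φ ε y * ∑ j : Fin 3, pd j.succ (scut r) y * current (dens q) v j.succ y

namespace WaveData

variable {κ : ℝ} {q : (Fin 4 → ℝ) → Matrix (Fin 4) (Fin 4) ℝ} {v : (Fin 4 → ℝ) → ℝ}

theorem continuousAt_source (hD : WaveData φ κ q v) {y : Fin 4 → ℝ} (hy : InRegion φ y) :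
    ContinuousAt (source (dens q) v) y := by
  unfold source
  exact tendsto_finsetSum _ fun j _ => tendsto_finsetSum _ fun k _ =>
    continuousAt_pd ((hD.contDiffAt_dens hy j k).mul (contDiffAt_pd (hD.contDiffAt_v y hy) k)) j

theorem continuousAt_pd_v (hD : WaveData φ κ q v) {y : Fin 4 → ℝ} (hy : InRegion φ y) (k : Fin 4) :
    ContinuousAt (pd k v) y := (contDiffAt_pd (hD.contDiffAt_v y hy) k).continuousAt

theorem continuousAt_deform (hD : WaveData φ κ q v) {y : Fin 4 → ℝ} (hy : InRegion φ y) :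
    ContinuousAt (deform (dens q) v) y := by
  unfold deform
  refine ContinuousAt.neg (continuousAt_const.mul ?_)
  exact tendsto_finsetSum _ fun k _ => tendsto_finsetSum _ fun l _ =>
    (continuousAt_pd (hD.contDiffAt_dens hy k l) 0).mul
      ((hD.continuousAt_pd_v hy k).mul (hD.continuousAt_pd_v hy l))

/-- The product rule and `div_current` where `Psi > 0`; elsewhere everything vanishes, because the
boundary cutoff is zero in a neighbourhood. Thus nothing is required of `q` and `v` outside the
region. -/
theorem sum_pd_cut_current (hs : ContMDiff (𝓡 2) 𝓘(ℝ, ℝ) ∞ φ) (hφ : ∀ θ, 0 < φ θ)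
    (hD : WaveData φ κ q v) {ε : ℝ} (hε : 0 < ε) (r : ℝ) {y : Fin 4 → ℝ} (h0 : 0 ≤ y 0)
    (hπ : y 0 < Real.pi) :
    ∑ j, pd j (fun z => bcut φ ε z * (scut r z * current (dens q) v j z)) y
      = bcut φ ε y * (scut r y * deform (dens q) v y)
        + bcut φ ε y * (scut r y * (source (dens q) v y * pd 0 v y)) + cutError φ q v ε r y := by
  by_cases hΨ : 0 < Psi φ y
  · have hreg : InRegion φ y := ⟨h0, hπ, hΨ.le⟩
    have hb := (contDiff_bcut hs hφ hε).differentiable one_ne_zero y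
    have hsc := (contDiff_scut (r := r)).differentiable one_ne_zero y
    have hJ := fun j => (hD.contDiffAt_current' hreg j).differentiableAt one_ne_zero
    have h1 : ∀ j, pd j (fun z => bcut φ ε z * (scut r z * current (dens q) v j z)) y
        = bslope φ ε y * pd j (Psi φ) y * (scut r y * current (dens q) v j y)
          + bcut φ ε y * (pd j (scut r) y * current (dens q) v j y
            + scut r y * pd j (current (dens q) v j) y) := fun j => by
      have hscJ : DifferentiableAt ℝ (fun z => scut r z * current (dens q) v j z) y :=
        hsc.mul (hJ j)
      rw [pd_mul hb hscJ, pd_mul hsc (hJ j), pd_bcut hs hφ hε]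
    have h2 := div_current (hD.contDiffAt_dens hreg) (hD.contDiffAt_v y hreg) (hD.isSymm_dens hreg)
    have h3 : ∑ j, pd j (scut r) y * current (dens q) v j y
        = ∑ j : Fin 3, pd j.succ (scut r) y * current (dens q) v j.succ y := by
      rw [Fin.sum_univ_succ, pd_scut_zero, zero_mul, zero_add]
    simp only [h1, mul_add, Finset.sum_add_distrib, ← Finset.mul_sum]
    rw [h2, h3]
    have h4 : ∑ j, bslope φ ε y * pd j (Psi φ) y * (scut r y * current (dens q) v j y)
        = bslope φ ε y * (scut r y * flux φ q v y) := by
      simp only [flux, Finset.mul_sum]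
      exact Finset.sum_congr rfl fun j _ => by ring
    rw [h4]
    unfold cutError source deform
    ring
  · have hlt := (not_lt.1 hΨ).trans_lt hε
    have hz : ∀ j, pd j (fun z => bcut φ ε z * (scut r z * current (dens q) v j z)) y = 0 := by
      intro j
      have : (fun z => bcut φ ε z * (scut r z * current (dens q) v j z)) =ᶠ[𝓝 y] fun _ => 0 := by
        filter_upwards [bcut_eventuallyEq_zero hs hφ hε hlt] with z hz
        rw [hz, zero_mul]
      rw [pd_congr this, pd_const]
    simp only [hz, cutError, bcut_eq_zero hε hlt.le, bslope_of_lt hε hlt]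
    simp

theorem continuousAt_cutError (hs : ContMDiff (𝓡 2) 𝓘(ℝ, ℝ) ∞ φ) (hφ : ∀ θ, 0 < φ θ)
    (hD : WaveData φ κ q v) {ε : ℝ} (hε : 0 < ε) (r : ℝ) {y : Fin 4 → ℝ} (h0 : 0 ≤ y 0)
    (hπ : y 0 < Real.pi) : ContinuousAt (cutError φ q v ε r) y := by
  unfold cutError
  refine ContinuousAt.add ?_ ?_
  · exact continuousAt_bslope_mul hs hφ hε fun hΨ =>
      contDiff_scut.continuous.continuousAt.mul (continuousAt_flux hs hφ hD ⟨h0, hπ, hΨ.le⟩)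
  · refine continuousAt_bcut_mul hs hφ hε fun hΨ => tendsto_finsetSum _ fun j _ => ?_
    exact (continuousAt_pd contDiff_scut.contDiffAt _).mul
      (hD.contDiffAt_current' ⟨h0, hπ, hΨ.le⟩ _).continuousAt

theorem cutError_eq_zero {ε r : ℝ} (hr : 0 < r) {y : Fin 4 → ℝ} (h : 2 * r < rsq (Fin.tail y)) :
    cutError φ q v ε r y = 0 := by
  simp [cutError, scut_eq_zero hr h.le, pd_scut_eq_zero_of_gt hr h]

/-- The errors caused by the cutoffs can be made arbitrarily small. -/
theorem exists_cutError_le (hs : ContMDiff (𝓡 2) 𝓘(ℝ, ℝ) ∞ φ) (hφ : ∀ θ, 0 < φ θ) {μ : ℝ}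
    (hμ : 0 < μ) (hμφ : ∀ x, μ * Real.sqrt (rsq x) ≤ radialGauge φ x) (hκ0 : 0 ≤ κ) (hκ1 : κ ≤ 1)
    (hκ : 4 * κ * (μ ^ 2 + 2) ≤ μ ^ 2) (hD : WaveData φ κ q v) {T₁ τ : ℝ} (hT₁ : T₁ < Real.pi)
    (hτ : 0 < τ) : ∃ ε r : ℝ, 0 < ε ∧ 2 * ε ≤ τ ∧ 0 < r ∧ 1 / τ ≤ r ∧ ∀ T, 0 ≤ T → T ≤ T₁ →
      ∫ x, cutError φ q v ε r (Fin.cons T x) ≤ τ := by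
  obtain ⟨C, hC0, hC⟩ := exists_integral_bslope_le hs hφ hμ hμφ hT₁
  obtain ⟨S, hS0, hS⟩ := exists_deriv_smoothTransition_le
  obtain ⟨M', r₁, hM'⟩ := hD.bounded T₁ hT₁
  set M := max M' 0 with hMdef
  have hM0 : 0 ≤ M := le_max_right _ _
  obtain ⟨ε₀, hε₀, hflux⟩ := exists_flux_le hs hφ hμ hμφ hκ0 hκ hD hT₁
    (τ := τ / (2 * (C + 1))) (by positivity)
  set ε := min (min (ε₀ / 2) 1) (τ / 2) with hεdef
  have hε : 0 < ε := by positivity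
  have hε1 : ε ≤ 1 := (min_le_left _ _).trans (min_le_right _ _)
  have hε2 : 2 * ε ≤ ε₀ := by
    have : ε ≤ ε₀ / 2 := (min_le_left _ _).trans (min_le_left _ _)
    linarith
  have hε3 : 2 * ε ≤ τ := by
    have : ε ≤ τ / 2 := min_le_right _ _
    linarith
  -- `r₁` gives the bound on `dv` near the pole, `1/τ` makes the cutoff equal to `1` for `|x|² ≤
  -- 1/τ`, and the last entry makes the polar error at most `τ/2`.
  set r := max (max r₁ 1) (max (1 / τ) (7680 * S * M / τ)) with hrdef
  have hr1 : 1 ≤ r := (le_max_right _ _).trans (le_max_left _ _)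
  have hr₁ : r₁ ≤ r := (le_max_left _ _).trans (le_max_left _ _)
  have hrτ : 1 / τ ≤ r := (le_max_left _ _).trans (le_max_right _ _)
  have hrS : 7680 * S * M / τ ≤ r := (le_max_right _ _).trans (le_max_right _ _)
  have hr : 0 < r := one_pos.trans_le hr1
  refine ⟨ε, r, hε, hε3, hr, hrτ, fun T hT0 hTT => ?_⟩
  set K := {x : Fin 3 → ℝ | rsq x ≤ 2 * r} with hKdef
  have hK : IsCompact K := isCompact_rsq_le _
  have hKf : (volume : Measure (Fin 3 → ℝ)) K ≠ ⊤ := hK.measure_lt_top.ne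
  -- The integrand bound near the pole: three components, each with `|∂ scut| ≤ 2S √(2r)/r` and
  -- `|J^j| ≤ 5 · (4/r²) · M`.
  set B := 120 * S * M * Real.sqrt (2 * r) / r ^ 3 with hB
  have hB0 : 0 ≤ B := by positivity
  obtain ⟨hβint, hβle⟩ := hC ε hε hε1 T hT0 hTT
  have hpt : ∀ x, cutError φ q v ε r (Fin.cons T x)
      ≤ τ / (2 * (C + 1)) * bslope φ ε (Fin.cons T x) + K.indicator (fun _ => B) x := by
    intro x
    set y : Fin 4 → ℝ := Fin.cons T x with hy
    have hy0 : y 0 = T := rfl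
    have hyt : Fin.tail y = x := rfl
    unfold cutError
    refine add_le_add ?_ ?_
    · have hβ := bslope_nonneg (φ := φ) hε y
      rw [mul_comm (τ / (2 * (C + 1)))]
      by_cases h1 : Psi φ y < ε
      · rw [bslope_of_lt hε h1]; simp
      · by_cases h2 : 2 * ε < Psi φ y
        · rw [bslope_of_gt hε h2]; simp
        · refine mul_le_mul_of_nonneg_left ?_ hβ
          have h3 := hflux y hT0 hTT (hε.le.trans (not_lt.1 h1)) ((not_lt.1 h2).trans hε2)
          have h4 := scut_nonneg r y
          have h5 := scut_le_one r y
          have h6 : 0 < τ / (2 * (C + 1)) := by positivity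
          nlinarith
    · by_cases hxK : x ∈ K
      swap
      · have h2r : 2 * r < rsq (Fin.tail y) := not_le.1 hxK
        simp [pd_scut_eq_zero_of_gt hr h2r, indicator_of_notMem hxK]
      rw [indicator_of_mem hxK]
      by_cases hxr : rsq (Fin.tail y) < r
      · simp [pd_scut_eq_zero hr hxr, hB0]
      have hxr := not_lt.1 hxr
      by_cases hΨ : Psi φ y < ε
      · rw [bcut_eq_zero hε hΨ.le, zero_mul]; exact hB0
      have hreg : InRegion φ y := ⟨hT0, hTT.trans_lt hT₁, hε.le.trans (not_lt.1 hΨ)⟩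
      have hW : ∑ k, framed v y k ^ 2 ≤ M :=
        (hM' y hT0 hTT (hr₁.trans hxr)).trans (le_max_left _ _)
      have hconf : conf (Fin.tail y) ≤ 2 / r :=
        div_le_div_of_nonneg_left two_pos.le hr (by linarith)
      have hconf2 : conf (Fin.tail y) ^ 2 ≤ 4 / r ^ 2 := by
        have := pow_le_pow_left₀ (conf_pos (Fin.tail y)).le hconf 2
        rw [div_pow] at this
        norm_num at this
        exact this
      have hterm : ∀ j : Fin 3, |pd j.succ (scut r) y * current (dens q) v j.succ y| ≤ B / 3 := by
        intro j
        have h1 := abs_pd_scut_le hr hS y j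
        have h2 := abs_current_succ_le hκ1 (hD.close y hreg) v j
        have h3 : |Fin.tail y j| ≤ Real.sqrt (2 * r) :=
          Real.abs_le_sqrt ((Finset.single_le_sum (f := fun i => Fin.tail y i ^ 2)
            (fun _ _ => sq_nonneg _) (Finset.mem_univ j)).trans hxK)
        have h4 : |current (dens q) v j.succ y| ≤ 5 * (4 / r ^ 2) * M := by
          refine h2.trans (mul_le_mul (by linarith) hW
            (Finset.sum_nonneg fun _ _ => sq_nonneg _) (by positivity))
        have h5 : |pd j.succ (scut r) y| ≤ S * (2 * Real.sqrt (2 * r)) / r := by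
          refine h1.trans ?_
          gcongr
        rw [abs_mul]
        refine (mul_le_mul h5 h4 (abs_nonneg _) (by positivity)).trans (le_of_eq ?_)
        rw [hB]; field_simp; ring
      have hsum : |∑ j : Fin 3, pd j.succ (scut r) y * current (dens q) v j.succ y| ≤ B := by
        refine (Finset.abs_sum_le_sum_abs _ _).trans ((Finset.sum_le_sum fun j _ => hterm j).trans ?_)
        simp; linarith
      have h7 := bcut_nonneg (φ := φ) ε y
      have h8 := bcut_le_one (φ := φ) ε y
      have h9 := le_abs_self (∑ j : Fin 3, pd j.succ (scut r) y * current (dens q) v j.succ y)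
      nlinarith
  have hIK : Integrable (K.indicator fun _ => B) :=
    (integrable_indicator_iff hK.measurableSet).2 (integrableOn_const hKf)
  have hIE : Integrable fun x => cutError φ q v ε r (Fin.cons T x) :=
    integrable_slice (fun x => continuousAt_cutError hs hφ hD hε r hT0 (hTT.trans_lt hT₁)) hK
      fun x hx => cutError_eq_zero hr (not_le.1 hx)
  have hI := integral_mono (μ := volume) hIE ((hβint.const_mul (τ / (2 * (C + 1)))).add hIK) hpt
  rw [integral_add' (hβint.const_mul _) hIK, integral_const_mul,
    integral_indicator hK.measurableSet] at hI
  simp only [integral_const, MeasurableSet.univ, measureReal_restrict_apply, univ_inter,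
    smul_eq_mul] at hI
  have hvol := volume_rsq_le (2 * r)
  have e1 : τ / (2 * (C + 1)) * ∫ x, bslope φ ε (Fin.cons T x) ≤ τ / 2 := by
    calc τ / (2 * (C + 1)) * ∫ x, bslope φ ε (Fin.cons T x) ≤ τ / (2 * (C + 1)) * (C + 1) :=
          mul_le_mul_of_nonneg_left (by linarith) (by positivity)
      _ = τ / 2 := by field_simp
  have e2 : (volume : Measure (Fin 3 → ℝ)).real K * B ≤ τ / 2 := by
    refine (mul_le_mul_of_nonneg_right hvol hB0).trans ?_
    have hsq := Real.mul_self_sqrt (by positivity : 0 ≤ 2 * r)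
    -- A gradient of size `r^{-1/2}`, a current of size `r^{-2}` and a volume of size `r^{3/2}`
    -- combine to `O(1/r)`.
    have e3 : (2 * Real.sqrt (2 * r)) ^ 3 * B = 3840 * S * M / r := by
      rw [hB]
      have : Real.sqrt (2 * r) ^ 4 = (2 * r) ^ 2 := by
        linear_combination (Real.sqrt (2 * r) * Real.sqrt (2 * r) + 2 * r) * hsq
      field_simp
      rw [this]; ring
    rw [e3, div_le_iff₀ hr]
    rw [div_le_iff₀ hτ] at hrS
    linarith
  linarith

end WaveData

end

/-! ### The energy estimate in the chart. -/

section

open Set Filter Topology MeasureTheory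

variable {φ : S2 → ℝ}

/-- The density `λ³ Σ w_k²` of the energy with respect to Lebesgue measure. -/
def edens (v : (Fin 4 → ℝ) → ℝ) (y : Fin 4 → ℝ) : ℝ :=
  conf (Fin.tail y) ^ 3 * ∑ k, framed v y k ^ 2

theorem edens_nonneg (v : (Fin 4 → ℝ) → ℝ) (y : Fin 4 → ℝ) : 0 ≤ edens v y :=
  mul_nonneg (pow_pos (conf_pos _) 3).le (Finset.sum_nonneg fun _ _ => sq_nonneg _)

/-- The time slice of the domain in the stereographic chart. -/
def slice (φ : S2 → ℝ) (T : ℝ) : Set (Fin 3 → ℝ) := {x | 0 < Psi φ (Fin.cons T x)}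

theorem isOpen_slice (hs : ContMDiff (𝓡 2) 𝓘(ℝ, ℝ) ∞ φ) (hφ : ∀ θ, 0 < φ θ) (T : ℝ) :
    IsOpen (slice φ T) :=
  isOpen_lt continuous_const
    ((continuous_Psi hs hφ).comp (contDiff_cons (n := 0) T).continuous)

theorem ofReal_rpow_half {a : ℝ} (ha : 0 ≤ a) :
    ENNReal.ofReal a ^ (1 / 2 : ℝ) = ENNReal.ofReal (Real.sqrt a) := by
  rw [ENNReal.ofReal_rpow_of_nonneg ha (by norm_num), Real.sqrt_eq_rpow]

/-- Only the continuous minorant `g` is integrated in the classical sense. The majorant `A` need not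
be measurable, so no measurability in time of the slice norms is required. -/
theorem ofReal_intervalIntegral_le {g : ℝ → ℝ} {T : ℝ} (hT : 0 ≤ T) (hg : ContinuousOn g (Icc 0 T))
    (hg0 : ∀ t ∈ Icc 0 T, 0 ≤ g t) {A : ℝ → ENNReal}
    (hA : ∀ t ∈ Icc 0 T, ENNReal.ofReal (g t) ≤ A t) :
    ENNReal.ofReal (∫ t in (0)..T, g t) ≤ ∫⁻ t in Ioc 0 T, A t := by
  have hi : IntegrableOn g (Ioc 0 T) volume := hg.integrableOn_Icc.mono_set Ioc_subset_Icc_self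
  rw [intervalIntegral.integral_of_le hT, ofReal_integral_eq_lintegral_ofReal hi]
  · exact setLIntegral_mono' measurableSet_Ioc fun t ht => hA t (Ioc_subset_Icc_self ht)
  · filter_upwards [ae_restrict_mem measurableSet_Ioc] with t ht
    exact hg0 t (Ioc_subset_Icc_self ht)

namespace WaveData

variable {κ : ℝ} {q : (Fin 4 → ℝ) → Matrix (Fin 4) (Fin 4) ℝ} {v : (Fin 4 → ℝ) → ℝ}

/-- The energy estimate on the part of the time slice that is cut off at distance `τ` from the
lateral boundary and from the south pole, up to an error that tends to `0` with `τ`. -/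
theorem energy_le_of_cut (hs : ContMDiff (𝓡 2) 𝓘(ℝ, ℝ) ∞ φ) (hφ : ∀ θ, 0 < φ θ) {μ : ℝ}
    (hμ : 0 < μ) (hμφ : ∀ x, μ * Real.sqrt (rsq x) ≤ radialGauge φ x) (hκ0 : 0 ≤ κ)
    (hκ1 : κ ≤ 1 / 18)
    (hκ : 4 * κ * (μ ^ 2 + 2) ≤ μ ^ 2) (hD : WaveData φ κ q v) {T₁ : ℝ} (hT0 : 0 < T₁)
    (hT₁ : T₁ < Real.pi) {A B : ℝ → ENNReal} {A₀ : ℝ}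
    (hA₀0 : 0 ≤ A₀) (hA : ∀ T ∈ Icc 0 T₁, ∀ᵐ x : Fin 3 → ℝ, x ∈ slice φ T →
      ENNReal.ofReal |deform (dens q) v (Fin.cons T x)|
        ≤ A T * ENNReal.ofReal (edens v (Fin.cons T x)))
    (hAint : ∫⁻ T in Ioc 0 T₁, A T ≤ ENNReal.ofReal A₀)
    (hB : ∀ T ∈ Icc 0 T₁, (∫⁻ x in slice φ T, ENNReal.ofReal (|source (dens q) v (Fin.cons T x)|
      / Real.sqrt (conf x ^ 3)) ^ (2 : ℝ)) ^ (1 / 2 : ℝ) ≤ B T)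
    {τ : ℝ} (hτ : 0 < τ) :
    (∫⁻ x in {x | τ ≤ Psi φ (Fin.cons T₁ x) ∧ rsq x ≤ 1 / τ},
        ENNReal.ofReal (edens v (Fin.cons T₁ x))) ^ (1 / 2 : ℝ)
      ≤ ENNReal.ofReal (2 * Real.exp (2 * A₀)) *
        ((∫⁻ x in slice φ 0, ENNReal.ofReal (edens v (Fin.cons 0 x))) ^ (1 / 2 : ℝ)
          + (∫⁻ T in Ioc 0 T₁, B T) + ENNReal.ofReal (3 * Real.sqrt τ)) := by
  obtain ⟨ε, r, hε, hετ, hr, hrτ, herr⟩ :=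
    hD.exists_cutError_le hs hφ hμ hμφ hκ0 (hκ1.trans (by norm_num)) hκ hT₁ hτ
  set K := {x : Fin 3 → ℝ | rsq x ≤ 2 * r} with hKdef
  have hK : IsCompact K := isCompact_rsq_le _
  have hIcc : ∀ T ∈ Icc 0 T₁, 0 ≤ T ∧ T < Real.pi := fun T hT => ⟨hT.1, hT.2.trans_lt hT₁⟩
  have houtside : ∀ (T : ℝ) (x : Fin 3 → ℝ), x ∉ K → scut r (Fin.cons T x) = 0 := fun T x hx =>
    scut_eq_zero hr (le_of_lt (not_le.1 hx))
  let G : Fin 4 → (Fin 4 → ℝ) → ℝ :=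
    fun j y => bcut φ ε y * (scut r y * current (dens q) v j y)
  let g₁ : (Fin 4 → ℝ) → ℝ := fun y => bcut φ ε y * (scut r y * deform (dens q) v y)
  let g₂ : (Fin 4 → ℝ) → ℝ := fun y => bcut φ ε y * (scut r y * (source (dens q) v y * pd 0 v y))
  have hGC : ∀ j, ∀ T ∈ Ico 0 Real.pi, ∀ x, ContDiffAt ℝ 1 (G j) (Fin.cons T x) :=
    fun j T hT x => contDiffAt_bcut_mul hs hφ hε fun hΨ =>
      contDiff_scut.contDiffAt.mul (hD.contDiffAt_current' ⟨hT.1, hT.2, hΨ.le⟩ j)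
  have hg₁C : ∀ T ∈ Ico 0 Real.pi, ∀ x, ContinuousAt g₁ (Fin.cons T x) :=
    fun T hT x => continuousAt_bcut_mul hs hφ hε fun hΨ =>
      contDiff_scut.continuous.continuousAt.mul (hD.continuousAt_deform ⟨hT.1, hT.2, hΨ.le⟩)
  have hg₂C : ∀ T ∈ Ico 0 Real.pi, ∀ x, ContinuousAt g₂ (Fin.cons T x) :=
    fun T hT x => continuousAt_bcut_mul hs hφ hε fun hΨ =>
      contDiff_scut.continuous.continuousAt.mul ((hD.continuousAt_source ⟨hT.1, hT.2, hΨ.le⟩).mul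
        (hD.continuousAt_pd_v ⟨hT.1, hT.2, hΨ.le⟩ 0))
  have hG0 : ∀ j T, ∀ x ∉ K, G j (Fin.cons T x) = 0 := fun j T x hx => by
    simp [G, houtside T x hx]
  have hg₁0 : ∀ T, ∀ x ∉ K, g₁ (Fin.cons T x) = 0 := fun T x hx => by
    simp [g₁, houtside T x hx]
  have hg₂0 : ∀ T, ∀ x ∉ K, g₂ (Fin.cons T x) = 0 := fun T x hx => by
    simp [g₂, houtside T x hx]
  have hsub : Icc 0 T₁ ⊆ Ico 0 Real.pi := fun T hT => hIcc T hT
  -- the energy, the deformation and the source integrals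
  set E : ℝ → ℝ := fun T => ∫ x, G 0 (Fin.cons T x) with hEdef
  set I₁ : ℝ → ℝ := fun T => ∫ x, g₁ (Fin.cons T x) with hI₁def
  set I₂ : ℝ → ℝ := fun T => ∫ x, g₂ (Fin.cons T x) with hI₂def
  have hEc : ContinuousOn E (Icc 0 T₁) := continuousOn_integral_slice
    (fun T hT x => (hGC 0 T (hsub hT) x).continuousAt) hK fun T _ x hx => hG0 0 T x hx
  have hI₁c : ContinuousOn I₁ (Icc 0 T₁) := continuousOn_integral_slice
    (fun T hT x => hg₁C T (hsub hT) x) hK fun T _ x hx => hg₁0 T x hx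
  have hI₂c : ContinuousOn I₂ (Icc 0 T₁) := continuousOn_integral_slice
    (fun T hT x => hg₂C T (hsub hT) x) hK fun T _ x hx => hg₂0 T x hx
  -- The spatial derivatives integrate to zero, so `E'` is the integral of the full divergence;
  -- `herr` bounds the cutoff error by `τ`.
  have hEd : ∀ T ∈ Ioo 0 T₁, ∃ e', HasDerivAt E e' T ∧ e' ≤ I₁ T + I₂ T + τ := by
    intro T hT
    have hTπ : T ∈ Ioo 0 Real.pi := ⟨hT.1, hT.2.trans hT₁⟩
    have hTI : T ∈ Ico 0 Real.pi := Ioo_subset_Ico_self hTπ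
    refine ⟨_, hasDerivAt_integral_slice (hGC 0) hK (fun T _ => hG0 0 T) hTπ, ?_⟩
    have hpdint : ∀ j, Integrable fun x => pd j (G j) (Fin.cons T x) := by
      intro j
      refine integrable_slice (fun x => continuousAt_pd (hGC j T hTI x) j) hK fun x hx => ?_
      have hlt : 2 * r < rsq (Fin.tail (Fin.cons T x : Fin 4 → ℝ)) := not_le.1 hx
      have hc : Continuous fun z : Fin 4 → ℝ => rsq (Fin.tail z) :=
        ((contDiff_rsq (n := 0)).comp contDiff_tail).continuous
      have : G j =ᶠ[𝓝 (Fin.cons T x)] fun _ => 0 := by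
        filter_upwards [hc.continuousAt.eventually (lt_mem_nhds hlt)] with z hz
        simp [G, scut_eq_zero hr (le_of_lt hz)]
      rw [pd_congr this, pd_const]
    have h1 : ∫ x, ∑ j, pd j (G j) (Fin.cons T x) = ∫ x, pd 0 (G 0) (Fin.cons T x) := by
      rw [integral_finsetSum _ fun j _ => hpdint j, Fin.sum_univ_succ]
      rw [Finset.sum_eq_zero fun j _ => integral_pd_succ_eq_zero (hGC (Fin.succ j) T hTI) hK
        (hG0 _ T) j, add_zero]
    have h2 : ∀ x, ∑ j, pd j (G j) (Fin.cons T x)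
        = g₁ (Fin.cons T x) + g₂ (Fin.cons T x) + cutError φ q v ε r (Fin.cons T x) := fun x =>
      hD.sum_pd_cut_current hs hφ hε r hTI.1 hTI.2
    have i1 : Integrable fun x => g₁ (Fin.cons T x) := integrable_slice (hg₁C T hTI) hK (hg₁0 T)
    have i2 : Integrable fun x => g₂ (Fin.cons T x) := integrable_slice (hg₂C T hTI) hK (hg₂0 T)
    have i3 : Integrable fun x => cutError φ q v ε r (Fin.cons T x) :=
      integrable_slice (fun x => hD.continuousAt_cutError hs hφ hε r hTI.1 hTI.2) hK
        fun x hx => cutError_eq_zero hr (not_le.1 hx)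
    rw [← h1]
    simp only [h2]
    have i12 : Integrable fun x => g₁ (Fin.cons T x) + g₂ (Fin.cons T x) := i1.add i2
    rw [integral_add i12 i3, integral_add i1 i2]
    have := herr T hT.1.le hT.2.le
    simp only [hI₁def, hI₂def]
    linarith
  -- pointwise comparison of the cut off energy density
  have hw : ∀ T ∈ Icc 0 T₁, ∀ x, 0 ≤ G 0 (Fin.cons T x) ∧
      bcut φ ε (Fin.cons T x) * scut r (Fin.cons T x) * edens v (Fin.cons T x)
        ≤ 4 * G 0 (Fin.cons T x) ∧
      G 0 (Fin.cons T x) ≤ (slice φ T).indicator (fun x => edens v (Fin.cons T x)) x := by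
    intro T hT x
    set y : Fin 4 → ℝ := Fin.cons T x with hy
    have hb0 := bcut_nonneg (φ := φ) ε y
    have hb1 := bcut_le_one (φ := φ) ε y
    have hs0 := scut_nonneg r y
    have hs1 := scut_le_one r y
    by_cases hΨ : 0 < Psi φ y
    · have hreg : InRegion φ y := ⟨(hIcc T hT).1, (hIcc T hT).2, hΨ.le⟩
      obtain ⟨c1, c2⟩ := current_zero_bounds hκ1 (hD.close y hreg) v
      have he := edens_nonneg v y
      have hx : x ∈ slice φ T := hΨ
      rw [indicator_of_mem hx]
      change _ ≤ 4 * current (dens q) v 0 y at c1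
      have hc0 : 0 ≤ current (dens q) v 0 y := by
        unfold edens at he; linarith
      have hw0 : 0 ≤ bcut φ ε y * scut r y := mul_nonneg hb0 hs0
      have hw1 : bcut φ ε y * scut r y ≤ 1 := mul_le_one₀ hb1 hs0 hs1
      simp only [G]
      refine ⟨by positivity, ?_, ?_⟩
      · have := mul_le_mul_of_nonneg_left c1 hw0
        unfold edens
        linarith
      · unfold edens at he ⊢
        nlinarith
    · have hx : x ∉ slice φ T := hΨ
      have : bcut φ ε y = 0 := bcut_eq_zero hε ((not_lt.1 hΨ).trans hε.le)
      rw [indicator_of_notMem hx]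
      simp [G, this]
  have hGi : ∀ T ∈ Icc 0 T₁, Integrable fun x => G 0 (Fin.cons T x) := fun T hT =>
    integrable_slice (fun x => (hGC 0 T (hsub hT) x).continuousAt) hK (hG0 0 T)
  have hE0 : ∀ T ∈ Icc 0 T₁, 0 ≤ E T := fun T hT => integral_nonneg fun x => (hw T hT x).1
  have hEl : ∀ T ∈ Icc 0 T₁, ∫⁻ x, ENNReal.ofReal (4 * G 0 (Fin.cons T x))
      = ENNReal.ofReal (4 * E T) := fun T hT => by
    rw [← ofReal_integral_eq_lintegral_ofReal ((hGi T hT).const_mul 4)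
      (Eventually.of_forall fun x => mul_nonneg (by norm_num) (hw T hT x).1), integral_const_mul]
  have hGcont : ∀ T ∈ Icc 0 T₁, Continuous fun x : Fin 3 → ℝ => G 0 (Fin.cons T x) := fun T hT =>
    continuous_iff_continuousAt.2 fun x => ContinuousAt.comp
      (f := fun x : Fin 3 → ℝ => (Fin.cons T x : Fin 4 → ℝ)) (hGC 0 T (hsub hT) x).continuousAt
      (contDiff_cons (n := 0) T).continuous.continuousAt
  -- the deformation term
  have hI₁ : ∀ T ∈ Icc 0 T₁, ENNReal.ofReal |I₁ T| ≤ A T * ENNReal.ofReal (4 * E T) := by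
    intro T hT
    have hm : Measurable fun x : Fin 3 → ℝ => ENNReal.ofReal (4 * G 0 (Fin.cons T x)) :=
      (continuous_const.mul (hGcont T hT)).measurable.ennreal_ofReal
    rw [← hEl T hT, ← lintegral_const_mul _ hm, ← Real.enorm_eq_ofReal_abs]
    refine (enorm_integral_le_lintegral_enorm _).trans (lintegral_mono_ae ?_)
    filter_upwards [hA T hT] with x hx
    obtain ⟨-, h2, -⟩ := hw T hT x
    have hb0 := bcut_nonneg (φ := φ) ε (Fin.cons T x)
    have hs0 := scut_nonneg r (Fin.cons T x)
    by_cases hΨ : x ∈ slice φ T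
    · have h3 := hx hΨ
      rw [Real.enorm_eq_ofReal_abs]
      have h4 : |g₁ (Fin.cons T x)| = bcut φ ε (Fin.cons T x) * scut r (Fin.cons T x)
          * |deform (dens q) v (Fin.cons T x)| := by
        simp only [g₁]
        rw [abs_mul, abs_mul, abs_of_nonneg hb0, abs_of_nonneg hs0, mul_assoc]
      rw [h4, ENNReal.ofReal_mul (mul_nonneg hb0 hs0)]
      calc _ ≤ ENNReal.ofReal (bcut φ ε (Fin.cons T x) * scut r (Fin.cons T x))
            * (A T * ENNReal.ofReal (edens v (Fin.cons T x))) := by gcongr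
        _ = A T * ENNReal.ofReal (bcut φ ε (Fin.cons T x) * scut r (Fin.cons T x)
            * edens v (Fin.cons T x)) := by
          rw [ENNReal.ofReal_mul (mul_nonneg hb0 hs0)]; ring
        _ ≤ _ := by gcongr
    · have : bcut φ ε (Fin.cons T x) = 0 := bcut_eq_zero hε ((not_lt.1 hΨ).trans hε.le)
      simp [g₁, this]
  -- the source term
  have hI₂ : ∀ T ∈ Icc 0 T₁, ENNReal.ofReal |I₂ T|
      ≤ B T * ENNReal.ofReal (2 * Real.sqrt (E T)) := by
    intro T hT
    have hU := isOpen_slice hs hφ T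
    have hπ := hIcc T hT
    have hcomp : ∀ (f : (Fin 4 → ℝ) → ℝ), (∀ y, InRegion φ y → ContinuousAt f y) →
        ContinuousOn (fun x : Fin 3 → ℝ => f (Fin.cons T x)) (slice φ T) := fun f hf x hx =>
      (ContinuousAt.comp (f := fun x : Fin 3 → ℝ => (Fin.cons T x : Fin 4 → ℝ))
        (hf _ ⟨hπ.1, hπ.2, le_of_lt hx⟩)
        (contDiff_cons (n := 0) T).continuous.continuousAt).continuousWithinAt
    have hconf : Continuous fun x : Fin 3 → ℝ => Real.sqrt (conf x ^ 3) :=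
      ((contDiff_conf (n := 0)).continuous.pow 3).sqrt
    have hconf0 : ∀ x, 0 < Real.sqrt (conf x ^ 3) := fun x =>
      Real.sqrt_pos.2 (pow_pos (conf_pos x) 3)
    -- The weight `λ^{3/2}` is moved from one factor to the other so that Cauchy–Schwarz yields the
    -- hypothesis `hB` for the source and the energy for `∂_T v`.
    let f₁ : (Fin 3 → ℝ) → ENNReal := fun x =>
      ENNReal.ofReal (|source (dens q) v (Fin.cons T x)| / Real.sqrt (conf x ^ 3))
    let f₂ : (Fin 3 → ℝ) → ENNReal := fun x =>
      ENNReal.ofReal (bcut φ ε (Fin.cons T x) * scut r (Fin.cons T x)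
        * (|pd 0 v (Fin.cons T x)| * Real.sqrt (conf x ^ 3)))
    have hf₁ : AEMeasurable f₁ (volume.restrict (slice φ T)) := by
      refine (ContinuousOn.aemeasurable ?_ hU.measurableSet).ennreal_ofReal
      exact (hcomp _ fun y hy => (hD.continuousAt_source hy)).abs.div hconf.continuousOn
        fun x _ => (hconf0 x).ne'
    have hf₂ : AEMeasurable f₂ (volume.restrict (slice φ T)) := by
      refine (ContinuousOn.aemeasurable ?_ hU.measurableSet).ennreal_ofReal
      refine ContinuousOn.mul (hcomp (fun y => bcut φ ε y * scut r y) fun y _ =>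
        ((contDiff_bcut hs hφ hε).continuous.mul contDiff_scut.continuous).continuousAt) ?_
      exact (hcomp _ fun y hy => hD.continuousAt_pd_v hy 0).abs.mul hconf.continuousOn
    have hH := ENNReal.lintegral_mul_le_Lp_mul_Lq (volume.restrict (slice φ T))
      (Real.HolderConjugate.two_two) hf₁ hf₂
    have hstep : ∀ x, ‖g₂ (Fin.cons T x)‖ₑ = (slice φ T).indicator (f₁ * f₂) x := by
      intro x
      have hb0 := bcut_nonneg (φ := φ) ε (Fin.cons T x)
      have hs0 := scut_nonneg r (Fin.cons T x)
      by_cases hΨ : x ∈ slice φ T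
      · rw [indicator_of_mem hΨ, Pi.mul_apply, ← ENNReal.ofReal_mul (by positivity),
          Real.enorm_eq_ofReal_abs]
        congr 1
        simp only [g₂]
        rw [abs_mul, abs_mul, abs_mul, abs_of_nonneg hb0, abs_of_nonneg hs0]
        have := (hconf0 x).ne'
        field_simp
      · have : bcut φ ε (Fin.cons T x) = 0 := bcut_eq_zero hε ((not_lt.1 hΨ).trans hε.le)
        rw [indicator_of_notMem hΨ]
        simp [g₂, this]
    -- The cutoffs appear squared; having values in `[0, 1]`, their product dominates its square.
    have hsq : ∫⁻ x in slice φ T, f₂ x ^ (2 : ℝ) ≤ ENNReal.ofReal (4 * E T) := by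
      rw [← hEl T hT]
      refine (setLIntegral_le_lintegral _ _).trans (lintegral_mono fun x => ?_)
      obtain ⟨-, h2, -⟩ := hw T hT x
      have hb0 := bcut_nonneg (φ := φ) ε (Fin.cons T x)
      have hb1 := bcut_le_one (φ := φ) ε (Fin.cons T x)
      have hs0 := scut_nonneg r (Fin.cons T x)
      have hs1 := scut_le_one r (Fin.cons T x)
      simp only [f₂]
      rw [ENNReal.ofReal_rpow_of_nonneg (by positivity) (by norm_num)]
      refine ENNReal.ofReal_le_ofReal (le_trans ?_ h2)
      have hc3 : Real.sqrt (conf x ^ 3) ^ 2 = conf x ^ 3 := Real.sq_sqrt (pow_pos (conf_pos x) 3).le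
      have hv0 : pd 0 v (Fin.cons T x) ^ 2 ≤ ∑ k, framed v (Fin.cons T x) k ^ 2 := by
        rw [← framed_zero]
        exact Finset.single_le_sum (f := fun k => framed v (Fin.cons T x) k ^ 2)
          (fun _ _ => sq_nonneg _) (Finset.mem_univ 0)
      have hw0 : 0 ≤ bcut φ ε (Fin.cons T x) * scut r (Fin.cons T x) := mul_nonneg hb0 hs0
      have hw1 : bcut φ ε (Fin.cons T x) * scut r (Fin.cons T x) ≤ 1 := mul_le_one₀ hb1 hs0 hs1
      have hc0 := pow_pos (conf_pos x) 3
      rw [Real.rpow_two, mul_pow, mul_pow |pd 0 v (Fin.cons T x)|, sq_abs, hc3]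
      unfold edens
      rw [Fin.tail_cons, mul_comm (pd 0 v (Fin.cons T x) ^ 2)]
      refine mul_le_mul ?_ (mul_le_mul_of_nonneg_left hv0 hc0.le) (by positivity) hw0
      nlinarith
    calc ENNReal.ofReal |I₂ T| ≤ ∫⁻ x, ‖g₂ (Fin.cons T x)‖ₑ := by
          rw [← Real.enorm_eq_ofReal_abs]; exact enorm_integral_le_lintegral_enorm _
      _ = ∫⁻ x in slice φ T, (f₁ * f₂) x := by
          simp only [hstep]; exact lintegral_indicator hU.measurableSet _
      _ ≤ _ := hH
      _ ≤ B T * ENNReal.ofReal (4 * E T) ^ (1 / 2 : ℝ) := by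
          refine mul_le_mul' (hB T hT) (ENNReal.rpow_le_rpow hsq (by norm_num))
      _ = _ := by
          rw [ofReal_rpow_half (mul_nonneg (by norm_num) (hE0 T hT)),
            Real.sqrt_mul (by norm_num)]
          congr 3
          rw [show (4 : ℝ) = 2 ^ 2 by norm_num, Real.sqrt_sq (by norm_num)]
  -- Grönwall
  have hpos : ∀ T ∈ Icc 0 T₁, 0 < E T + τ := fun T hT => by linarith [hE0 T hT]
  -- Adding `τ` keeps the root differentiable where `E` vanishes, and the cutoff error `τ` then
  -- costs only `τ/(2y) ≤ √τ/2`.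
  set y : ℝ → ℝ := fun T => Real.sqrt (E T + τ) with hydef
  have hyτ : ∀ T ∈ Icc 0 T₁, Real.sqrt τ ≤ y T := fun T hT =>
    Real.sqrt_le_sqrt (by linarith [hE0 T hT])
  have hsτ : 0 < Real.sqrt τ := Real.sqrt_pos.2 hτ
  have hy0 : ∀ T ∈ Icc 0 T₁, 0 < y T := fun T hT => hsτ.trans_le (hyτ T hT)
  have hysq : ∀ T ∈ Icc 0 T₁, y T ^ 2 = E T + τ := fun T hT => Real.sq_sqrt (hpos T hT).le
  have hyc : ContinuousOn y (Icc 0 T₁) := (hEc.add continuousOn_const).sqrt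
  set a : ℝ → ℝ := fun T => |I₁ T| / (2 * (E T + τ)) with hadef
  set b : ℝ → ℝ := fun T => |I₂ T| / (2 * y T) with hbdef
  have hac : ContinuousOn a (Icc 0 T₁) := hI₁c.abs.div
    (continuousOn_const.mul (hEc.add continuousOn_const)) fun T hT => by
      have := hpos T hT; positivity
  have hbc : ContinuousOn b (Icc 0 T₁) := hI₂c.abs.div (continuousOn_const.mul hyc)
    fun T hT => by have := hy0 T hT; positivity
  have ha0 : ∀ T ∈ Icc 0 T₁, 0 ≤ a T := fun T hT => by
    have := hpos T hT; simp only [hadef]; positivity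
  have hb0 : ∀ T ∈ Icc 0 T₁, 0 ≤ b T := fun T hT => by
    have := hy0 T hT; simp only [hbdef]; positivity
  have hgron : y T₁ ≤ Real.exp (∫ t in (0)..T₁, a t)
      * (y 0 + ∫ t in (0)..T₁, (b t + Real.sqrt τ / 2)) := by
    choose! e' he' hle' using hEd
    refine gronwall_linear (f' := fun T => e' T / (2 * y T)) hT0.le hyc ?_ hac
      (hbc.add continuousOn_const) ha0 (fun t ht => add_nonneg (hb0 t ht) (by positivity)) ?_
    · intro t ht
      have htI := Ioo_subset_Icc_self ht
      exact ((he' t ht).add_const τ).sqrt (hpos t htI).ne'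
    · intro t ht
      have htI := Ioo_subset_Icc_self ht
      have h1 := hle' t ht
      have h2 := hy0 t htI
      have h3 := hysq t htI
      have h4 := hyτ t htI
      have h5 : a t * y t = |I₁ t| / (2 * y t) := by
        simp only [hadef]
        rw [← h3]; field_simp
      have h6 : τ / (2 * y t) ≤ Real.sqrt τ / 2 := by
        rw [div_le_div_iff₀ (by positivity) two_pos]
        have := Real.mul_self_sqrt hτ.le
        nlinarith
      have h7 : e' t / (2 * y t) ≤ (|I₁ t| + |I₂ t| + τ) / (2 * y t) := by
        gcongr
        linarith [le_abs_self (I₁ t), le_abs_self (I₂ t)]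
      rw [add_div, add_div] at h7
      rw [h5]
      simp only [hbdef]
      linarith
  -- `T₁ < π ≤ 4` turns `T₁ √τ/2` into `2√τ`; with the `√τ` from `y 0` this makes the final `3√τ`.
  have hintb : ∫ t in (0)..T₁, (b t + Real.sqrt τ / 2)
      ≤ (∫ t in (0)..T₁, b t) + 2 * Real.sqrt τ := by
    have hbi : IntervalIntegrable b volume 0 T₁ :=
      ContinuousOn.intervalIntegrable (by rwa [uIcc_of_le hT0.le])
    rw [intervalIntegral.integral_add hbi intervalIntegrable_const,
      intervalIntegral.integral_const, sub_zero, smul_eq_mul]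
    have := Real.pi_le_four
    nlinarith
  -- The factor `2` is `4E / (2(E + τ)) ≤ 2`, where the `4` comes from coercivity.
  have hA₀ : ∫ t in (0)..T₁, a t ≤ 2 * A₀ := by
    have h1 : ENNReal.ofReal (∫ t in (0)..T₁, a t) ≤ ∫⁻ t in Ioc 0 T₁, 2 * A t := by
      refine ofReal_intervalIntegral_le hT0.le hac ha0 fun t ht => ?_
      simp only [hadef]
      have h2 := hpos t ht
      rw [ENNReal.ofReal_div_of_pos (by positivity)]
      refine ENNReal.div_le_of_le_mul ((hI₁ t ht).trans ?_)
      rw [mul_comm 2 (A t), mul_assoc]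
      gcongr
      rw [← ENNReal.ofReal_ofNat 2, ← ENNReal.ofReal_mul (by norm_num)]
      exact ENNReal.ofReal_le_ofReal (by linarith)
    rw [lintegral_const_mul' _ _ (by norm_num)] at h1
    have h3 : ENNReal.ofReal (∫ t in (0)..T₁, a t) ≤ ENNReal.ofReal (2 * A₀) := by
      refine h1.trans ?_
      rw [ENNReal.ofReal_mul two_pos.le, ENNReal.ofReal_ofNat]
      gcongr
    exact (ENNReal.ofReal_le_ofReal_iff (by positivity)).1 h3
  -- translation into lower integrals
  have hyE : ∀ T ∈ Icc 0 T₁, Real.sqrt (E T) ≤ y T := fun T hT =>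
    Real.sqrt_le_sqrt (by linarith)
  have hB' : ENNReal.ofReal (∫ t in (0)..T₁, b t) ≤ ∫⁻ t in Ioc 0 T₁, B t := by
    refine ofReal_intervalIntegral_le hT0.le hbc hb0 fun t ht => ?_
    simp only [hbdef]
    have h2 := hy0 t ht
    rw [ENNReal.ofReal_div_of_pos (by positivity)]
    refine ENNReal.div_le_of_le_mul ((hI₂ t ht).trans ?_)
    gcongr
    exact hyE t ht
  have h0m : (0 : ℝ) ∈ Icc 0 T₁ := ⟨le_rfl, hT0.le⟩
  have h1m : T₁ ∈ Icc 0 T₁ := ⟨hT0.le, le_rfl⟩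
  have hy00 : y 0 ≤ Real.sqrt (E 0) + Real.sqrt τ := by
    simp only [hydef]
    refine Real.sqrt_le_iff.2 ⟨by positivity, ?_⟩
    nlinarith [Real.sq_sqrt (hE0 0 h0m), Real.sq_sqrt hτ.le, Real.sqrt_nonneg (E 0)]
  have hE00 : ENNReal.ofReal (Real.sqrt (E 0))
      ≤ (∫⁻ x in slice φ 0, ENNReal.ofReal (edens v (Fin.cons 0 x))) ^ (1 / 2 : ℝ) := by
    rw [← ofReal_rpow_half (hE0 0 h0m)]
    refine ENNReal.rpow_le_rpow ?_ (by norm_num)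
    rw [hEdef]
    beta_reduce
    rw [ofReal_integral_eq_lintegral_ofReal (hGi 0 h0m)
      (Eventually.of_forall fun x => (hw 0 h0m x).1),
      ← lintegral_indicator (isOpen_slice hs hφ 0).measurableSet]
    refine lintegral_mono fun x => ?_
    have h3 := (hw 0 h0m x).2.2
    by_cases hx : x ∈ slice φ 0
    · rw [indicator_of_mem hx] at h3 ⊢
      exact ENNReal.ofReal_le_ofReal h3
    · rw [indicator_of_notMem hx] at h3 ⊢
      exact (ENNReal.ofReal_of_nonpos h3).le
  have hfin : ENNReal.ofReal (2 * y T₁) ≤ ENNReal.ofReal (2 * Real.exp (2 * A₀))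
      * (ENNReal.ofReal (Real.sqrt (E 0)) + ENNReal.ofReal (∫ t in (0)..T₁, b t)
        + ENNReal.ofReal (3 * Real.sqrt τ)) := by
    have hb00 : 0 ≤ ∫ t in (0)..T₁, b t := intervalIntegral.integral_nonneg hT0.le hb0
    rw [← ENNReal.ofReal_add (Real.sqrt_nonneg _) hb00, ← ENNReal.ofReal_add (by positivity)
      (by positivity), ← ENNReal.ofReal_mul (by positivity)]
    refine ENNReal.ofReal_le_ofReal ?_
    have he := Real.exp_le_exp.2 hA₀
    have hle : y 0 + ∫ t in (0)..T₁, (b t + Real.sqrt τ / 2)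
        ≤ Real.sqrt (E 0) + (∫ t in (0)..T₁, b t) + 3 * Real.sqrt τ := by linarith
    have h5 : y T₁ ≤ Real.exp (2 * A₀)
        * (Real.sqrt (E 0) + (∫ t in (0)..T₁, b t) + 3 * Real.sqrt τ) := by
      refine hgron.trans ((mul_le_mul_of_nonneg_left hle (Real.exp_pos _).le).trans ?_)
      exact mul_le_mul_of_nonneg_right he (by positivity)
    linarith
  refine le_trans ?_ (hfin.trans ?_)
  · have hset : MeasurableSet {x : Fin 3 → ℝ | τ ≤ Psi φ (Fin.cons T₁ x) ∧ rsq x ≤ 1 / τ} :=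
      ((isClosed_le continuous_const
        ((continuous_Psi hs hφ).comp (contDiff_cons (n := 0) T₁).continuous)).inter
        (isClosed_le (contDiff_rsq (n := 0)).continuous continuous_const)).measurableSet
    calc _ ≤ ENNReal.ofReal (4 * E T₁) ^ (1 / 2 : ℝ) := by
          refine ENNReal.rpow_le_rpow ?_ (by norm_num)
          rw [← hEl T₁ h1m]
          refine le_trans (setLIntegral_mono' hset fun x hx => ?_) (setLIntegral_le_lintegral _ _)
          refine ENNReal.ofReal_le_ofReal ?_
          -- On this set both cutoffs equal `1`, because `2ε ≤ τ` and `1/τ ≤ r`.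
          have h2 := (hw T₁ h1m x).2.1
          rwa [bcut_eq_one hε (hετ.trans hx.1), scut_eq_one hr (by
            rw [Fin.tail_cons]; exact hx.2.trans hrτ), one_mul, one_mul] at h2
      _ = ENNReal.ofReal (2 * Real.sqrt (E T₁)) := by
          rw [ofReal_rpow_half (mul_nonneg (by norm_num) (hE0 T₁ h1m)),
            Real.sqrt_mul (by norm_num)]
          congr 2
          rw [show (4 : ℝ) = 2 ^ 2 by norm_num, Real.sqrt_sq (by norm_num)]
      _ ≤ _ := ENNReal.ofReal_le_ofReal (by linarith [hyE T₁ h1m])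
  · gcongr

/-- The energy estimate in the stereographic chart. -/
theorem energy_le (hs : ContMDiff (𝓡 2) 𝓘(ℝ, ℝ) ∞ φ) (hφ : ∀ θ, 0 < φ θ) {μ : ℝ}
    (hμ : 0 < μ) (hμφ : ∀ x, μ * Real.sqrt (rsq x) ≤ radialGauge φ x) (hκ0 : 0 ≤ κ)
    (hκ1 : κ ≤ 1 / 18)
    (hκ : 4 * κ * (μ ^ 2 + 2) ≤ μ ^ 2) (hD : WaveData φ κ q v) {T₁ : ℝ} (hT0 : 0 < T₁)
    (hT₁ : T₁ < Real.pi) {A B : ℝ → ENNReal} {A₀ : ℝ} (hA₀0 : 0 ≤ A₀)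
    (hA : ∀ T ∈ Icc 0 T₁, ∀ᵐ x : Fin 3 → ℝ, x ∈ slice φ T →
      ENNReal.ofReal |deform (dens q) v (Fin.cons T x)|
        ≤ A T * ENNReal.ofReal (edens v (Fin.cons T x)))
    (hAint : ∫⁻ T in Ioc 0 T₁, A T ≤ ENNReal.ofReal A₀)
    (hB : ∀ T ∈ Icc 0 T₁, (∫⁻ x in slice φ T, ENNReal.ofReal (|source (dens q) v (Fin.cons T x)|
      / Real.sqrt (conf x ^ 3)) ^ (2 : ℝ)) ^ (1 / 2 : ℝ) ≤ B T) :
    (∫⁻ x in slice φ T₁, ENNReal.ofReal (edens v (Fin.cons T₁ x))) ^ (1 / 2 : ℝ)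
      ≤ ENNReal.ofReal (2 * Real.exp (2 * A₀)) *
        ((∫⁻ x in slice φ 0, ENNReal.ofReal (edens v (Fin.cons 0 x))) ^ (1 / 2 : ℝ)
          + ∫⁻ T in Ioc 0 T₁, B T) := by
  -- The truncated sets increase to the full slice as `τ` decreases to `0`, so monotone convergence
  -- applies on the left.
  let τ : ℕ → ℝ := fun n => 1 / ((n : ℝ) + 1)
  have hτ : ∀ n, 0 < τ n := fun n => by positivity
  have hτ0 : Tendsto τ atTop (𝓝 0) := tendsto_one_div_add_atTop_nhds_zero_nat
  have hτm : Antitone τ := fun m n h => by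
    simp only [τ]
    gcongr
  let s : ℕ → Set (Fin 3 → ℝ) := fun n => {x | τ n ≤ Psi φ (Fin.cons T₁ x) ∧ rsq x ≤ 1 / τ n}
  have hsm : Monotone s := fun m n h x hx =>
    ⟨(hτm h).trans hx.1, hx.2.trans (one_div_le_one_div_of_le (hτ n) (hτm h))⟩
  have hsU : ⋃ n, s n = slice φ T₁ := by
    ext x
    rw [mem_iUnion]
    constructor
    · rintro ⟨n, hx, -⟩
      exact (hτ n).trans_le hx
    · intro hx
      have h1 : ∀ᶠ n in atTop, τ n < Psi φ (Fin.cons T₁ x) :=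
        hτ0.eventually (gt_mem_nhds hx)
      obtain ⟨n, hn1, hn2⟩ := (h1.and (eventually_ge_atTop ⌈rsq x⌉₊)).exists
      refine ⟨n, hn1.le, ?_⟩
      have := Nat.ceil_le.1 hn2
      simp only [τ, one_div_one_div]
      linarith
  have hlim := ((ENNReal.continuous_rpow_const (y := (1 / 2 : ℝ))).tendsto _).comp
    (tendsto_atTop_iSup fun m n h => lintegral_mono_set
      (f := fun x => ENNReal.ofReal (edens v (Fin.cons T₁ x))) (μ := volume) (hsm h))
  rw [← setLIntegral_iUnion_of_directed _ hsm.directed_le, hsU] at hlim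
  set X := (∫⁻ x in slice φ 0, ENNReal.ofReal (edens v (Fin.cons 0 x))) ^ (1 / 2 : ℝ)
    + ∫⁻ T in Ioc 0 T₁, B T with hX
  have hrhs : Tendsto (fun n => ENNReal.ofReal (2 * Real.exp (2 * A₀)) *
      (X + ENNReal.ofReal (3 * Real.sqrt (τ n)))) atTop
      (𝓝 (ENNReal.ofReal (2 * Real.exp (2 * A₀)) * X)) := by
    have h1 : Tendsto (fun n => ENNReal.ofReal (3 * Real.sqrt (τ n))) atTop (𝓝 0) := by
      have hc : Continuous fun t => ENNReal.ofReal (3 * Real.sqrt t) :=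
        ENNReal.continuous_ofReal.comp (continuous_const.mul Real.continuous_sqrt)
      have := hc.tendsto 0
      rw [Real.sqrt_zero, mul_zero, ENNReal.ofReal_zero] at this
      exact this.comp hτ0
    have h2 := ENNReal.Tendsto.const_mul (a := ENNReal.ofReal (2 * Real.exp (2 * A₀)))
      (h1.const_add X) (Or.inr ENNReal.ofReal_ne_top)
    rwa [add_zero] at h2
  exact le_of_tendsto_of_tendsto' hlim hrhs fun n =>
    hD.energy_le_of_cut hs hφ hμ hμφ hκ0 hκ1 hκ hT0 hT₁ hA₀0 hA hAint hB (hτ n)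

end WaveData

end

/-! ### Norms over the sphere as integrals in the chart. -/

section

open Set Filter Topology MeasureTheory

variable {φ : S2 → ℝ}

theorem measurableEmbedding_stereoInv : MeasurableEmbedding (stereoInv 1) :=
  Continuous.measurableEmbedding
    ((contDiff_stereoVec (n := 0) 1).continuous.subtype_mk _)
    (Function.LeftInverse.injective stereo_stereoInv)

theorem param_cons (T : ℝ) (x : Fin 3 → ℝ) : param 1 (Fin.cons T x) = (T, stereoInv 1 x) := rfl

theorem preimage_sliceY (hφ : ∀ θ, 0 < φ θ) {T : ℝ} (h0 : 0 ≤ T) (hπ : T < Real.pi) :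
    stereoInv 1 ⁻¹' sliceY φ T = slice φ T := by
  ext x
  have := param_mem_domainY_iff hφ (Fin.cons T x)
  rw [param_cons] at this
  exact this.trans ⟨fun h => h.2, fun h => ⟨⟨h0, hπ⟩, h⟩⟩

theorem sphereVol_restrict_sliceY (hs : ContMDiff (𝓡 2) 𝓘(ℝ, ℝ) ∞ φ) (hφ : ∀ θ, 0 < φ θ) {T : ℝ}
    (h0 : 0 ≤ T) (hπ : T < Real.pi) : sphereVol.restrict (sliceY φ T)
      = (((volume : Measure (Fin 3 → ℝ)).restrict (slice φ T)).withDensity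
          fun x => ENNReal.ofReal (conf x ^ 3)).map (stereoInv 1) := by
  unfold sphereVol
  rw [measurableEmbedding_stereoInv.restrict_map, preimage_sliceY hφ h0 hπ,
    restrict_withDensity (isOpen_slice hs hφ T).measurableSet]
  simp only [sqrt_det_sphereMetric]

theorem measurable_ofReal_conf : Measurable fun x : Fin 3 → ℝ => ENNReal.ofReal (conf x ^ 3) :=
  ((contDiff_conf (n := 0)).continuous.pow 3).measurable.ennreal_ofReal

/-- `f` is arbitrary: `stereoInv 1` is a measurable embedding and the density is measurable and
finite, so neither change of measure needs measurability of `f`. -/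
theorem normSlice_two (hs : ContMDiff (𝓡 2) 𝓘(ℝ, ℝ) ∞ φ) (hφ : ∀ θ, 0 < φ θ) {T : ℝ}
    (h0 : 0 ≤ T) (hπ : T < Real.pi) (f : ℝ × S3 → ℝ) :
    normSlice φ 2 f T = (∫⁻ x in slice φ T,
      ENNReal.ofReal (conf x ^ 3 * f (param 1 (Fin.cons T x)) ^ 2)) ^ (1 / 2 : ℝ) := by
  unfold normSlice
  rw [sphereVol_restrict_sliceY hs hφ h0 hπ, measurableEmbedding_stereoInv.eLpNorm_map_measure,
    eLpNorm_eq_lintegral_rpow_enorm_toReal two_ne_zero ENNReal.ofNat_ne_top,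
    lintegral_withDensity_eq_lintegral_mul_non_measurable _ measurable_ofReal_conf
      (Eventually.of_forall fun _ => ENNReal.ofReal_lt_top)]
  rw [ENNReal.toReal_ofNat]
  congr 1
  refine lintegral_congr fun x => ?_
  have hc := (pow_pos (conf_pos x) 3).le
  rw [Pi.mul_apply, ENNReal.ofReal_mul hc, ← sq_abs (f _), ← Real.rpow_two,
    ← ENNReal.ofReal_rpow_of_nonneg (abs_nonneg _) two_pos.le, ← Real.enorm_eq_ofReal_abs]
  rfl

/-- The density is positive everywhere, so null sets for the sphere volume are Lebesgue null in the
chart. -/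
theorem ae_le_normSlice_top (hs : ContMDiff (𝓡 2) 𝓘(ℝ, ℝ) ∞ φ) (hφ : ∀ θ, 0 < φ θ) {T : ℝ}
    (h0 : 0 ≤ T) (hπ : T < Real.pi) (f : ℝ × S3 → ℝ) :
    ∀ᵐ x : Fin 3 → ℝ, x ∈ slice φ T → ‖f (param 1 (Fin.cons T x))‖ₑ ≤ normSlice φ ⊤ f T := by
  unfold normSlice
  rw [sphereVol_restrict_sliceY hs hφ h0 hπ, measurableEmbedding_stereoInv.eLpNorm_map_measure,
    eLpNorm_exponent_top, ← ae_restrict_iff' (isOpen_slice hs hφ T).measurableSet]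
  have := ae_le_eLpNormEssSup (f := (fun X => f (T, X)) ∘ stereoInv 1)
    (μ := ((volume : Measure (Fin 3 → ℝ)).restrict (slice φ T)).withDensity
      fun x => ENNReal.ofReal (conf x ^ 3))
  rw [ae_withDensity_iff measurable_ofReal_conf] at this
  filter_upwards [this] with x hx
  exact hx (ENNReal.ofReal_pos.2 (pow_pos (conf_pos x) 3)).ne'

theorem normSlice_gradNorm (hs : ContMDiff (𝓡 2) 𝓘(ℝ, ℝ) ∞ φ) (hφ : ∀ θ, 0 < φ θ) {T : ℝ}
    (h0 : 0 ≤ T) (hπ : T < Real.pi) (u : ℝ × S3 → ℝ) :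
    normSlice φ 2 (gradNorm u) T = (∫⁻ x in slice φ T,
      ENNReal.ofReal (edens (u ∘ param 1) (Fin.cons T x))) ^ (1 / 2 : ℝ) := by
  rw [normSlice_two hs hφ h0 hπ]
  simp only [gradNorm_param, edens, Fin.tail_cons]

end

section

open Set Filter Topology MeasureTheory

variable {φ : S2 → ℝ}

/-! ### The differential near the south pole -/

/-- The coordinate change `x ↦ x / |x|²` between the two stereographic charts. -/
def inversion (y : Fin 4 → ℝ) : Fin 4 → ℝ :=
  Fin.cons (y 0) ((rsq (Fin.tail y))⁻¹ • Fin.tail y)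

theorem param_inversion {y : Fin 4 → ℝ} (hy : Fin.tail y ≠ 0) :
    param (-1) (inversion y) = param 1 y := by
  unfold param inversion
  rw [Fin.cons_zero, Fin.tail_cons, stereoInv_inversion hy]

theorem abs_le_sqrt_rsq (x : Fin 3 → ℝ) (i : Fin 3) : |x i| ≤ Real.sqrt (rsq x) :=
  Real.abs_le_sqrt (Finset.single_le_sum (f := fun i => x i ^ 2)
    (fun _ _ => sq_nonneg _) (Finset.mem_univ i))

/-- The inversion has differential of size `|x|⁻²`, the same rate as the conformal factor, so framed
derivatives stay bounded when passing to the chart at the south pole. -/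
theorem exists_hasFDerivAt_inversion {y : Fin 4 → ℝ} (hy : Fin.tail y ≠ 0) :
    ∃ D : (Fin 4 → ℝ) →L[ℝ] (Fin 4 → ℝ), HasFDerivAt inversion D y ∧
      ‖D (Pi.single 0 1)‖ ≤ 1 ∧
      ∀ j : Fin 3, ‖D (Pi.single j.succ 1)‖ ≤ 3 / rsq (Fin.tail y) := by
  have hq := rsq_pos hy
  have h1 : HasFDerivAt (fun z : Fin 4 → ℝ => rsq (Fin.tail z)) _ y :=
    HasFDerivAt.comp y (f := tailCLM) (hasFDerivAt_rsq (Fin.tail y)) tailCLM.hasFDerivAt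
  have h2 := (hasDerivAt_inv hq.ne').comp_hasFDerivAt y h1
  have h3 := h2.smul (tailCLM.hasFDerivAt (x := y))
  have h4 : HasFDerivAt (fun z : Fin 4 → ℝ => z 0)
      (ContinuousLinearMap.proj (R := ℝ) (φ := fun _ : Fin 4 => ℝ) 0) y := hasFDerivAt_apply 0 y
  have h5 := HasFDerivAt.finCons (F' := fun _ : Fin 4 => ℝ) h4 h3
  refine ⟨_, h5, ?_, fun j => ?_⟩
  · refine (pi_norm_le_iff_of_nonneg zero_le_one).2 fun i => ?_
    refine Fin.cases ?_ (fun i => ?_) i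
    · simp
    · simp [tailCLM_apply, tail_single_zero]
  · refine (pi_norm_le_iff_of_nonneg (by positivity)).2 fun i => ?_
    refine Fin.cases ?_ (fun i => ?_) i
    · simp; positivity
    · have hi := abs_le_sqrt_rsq (Fin.tail y) i
      have hj := abs_le_sqrt_rsq (Fin.tail y) j
      have hsq := Real.mul_self_sqrt hq.le
      have hs0 := Real.sqrt_nonneg (rsq (Fin.tail y))
      have hij : |Fin.tail y j * Fin.tail y i| ≤ rsq (Fin.tail y) := by
        rw [abs_mul, ← hsq]
        exact mul_le_mul hj hi (abs_nonneg _) hs0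
      have hsingle : |(Pi.single j 1 : Fin 3 → ℝ) i| ≤ 1 := by
        rw [Pi.single_apply]; split_ifs <;> simp
      simp [tailCLM_apply, tail_single_succ]
      have hsum : ∑ i, 2 * Fin.tail y i * (Pi.single j 1 : Fin 3 → ℝ) i = 2 * Fin.tail y j := by
        simp [Pi.single_apply]
      rw [hsum]
      have he : (rsq (Fin.tail y))⁻¹ * (Pi.single j 1 : Fin 3 → ℝ) i
          + -((rsq (Fin.tail y) ^ 2)⁻¹ * (2 * Fin.tail y j) * Fin.tail y i)
          = ((Pi.single j 1 : Fin 3 → ℝ) i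
            - 2 * (Fin.tail y j * Fin.tail y i) / rsq (Fin.tail y)) / rsq (Fin.tail y) := by
        field_simp
        ring
      rw [he, abs_div, abs_of_pos hq]
      have h6 : |2 * (Fin.tail y j * Fin.tail y i) / rsq (Fin.tail y)| ≤ 2 := by
        rw [abs_div, abs_mul, abs_two, abs_of_pos hq, div_le_iff₀ hq]
        linarith
      gcongr
      exact (abs_sub _ _).trans (by linarith)

/-- A tube argument: the differential is continuous along the compact segment over the pole, so a
bound for it extends to a neighbourhood whose radius does not depend on `T`. -/
theorem exists_fderiv_bound {w : (Fin 4 → ℝ) → ℝ} {T₁ : ℝ}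
    (hw : ∀ T ∈ Icc 0 T₁, ContDiffAt ℝ 2 w (Fin.cons T 0)) :
    ∃ M ρ : ℝ, 0 < ρ ∧ ∀ T ∈ Icc 0 T₁, ∀ x : Fin 3 → ℝ, ‖x‖ < ρ →
      DifferentiableAt ℝ w (Fin.cons T x) ∧ ‖fderiv ℝ w (Fin.cons T x)‖ ≤ M := by
  have hc : ∀ T ∈ Icc 0 T₁, ContinuousAt (fderiv ℝ w) (Fin.cons T 0) := fun T hT =>
    (ContDiffAt.fderiv_right (m := 1) (hw T hT) (by norm_num)).continuousAt
  have hcons : Continuous fun z : (Fin 3 → ℝ) × ℝ => (Fin.cons z.2 z.1 : Fin 4 → ℝ) :=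
    continuous_pi fun i => Fin.cases (by simpa using continuous_snd)
      (fun i => (continuous_apply i).comp continuous_fst) i
  obtain ⟨M, hM⟩ := (isCompact_Icc (a := (0 : ℝ)) (b := T₁)).exists_bound_of_continuousOn
    (f := fun T => fderiv ℝ w (Fin.cons T 0)) fun T hT =>
      (ContinuousAt.comp (f := fun T : ℝ => (Fin.cons T 0 : Fin 4 → ℝ)) (hc T hT)
        (hcons.comp (continuous_const.prodMk continuous_id)).continuousAt).continuousWithinAt
  have hev := isCompact_Icc.eventually_forall_of_forall_eventually (x₀ := (0 : Fin 3 → ℝ))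
    (K := Icc 0 T₁) (P := fun x T => DifferentiableAt ℝ w (Fin.cons T x) ∧
      ‖fderiv ℝ w (Fin.cons T x)‖ ≤ M + 1) fun T hT => by
    have h1 : ∀ᶠ z in 𝓝 (Fin.cons T 0 : Fin 4 → ℝ), DifferentiableAt ℝ w z ∧
        ‖fderiv ℝ w z‖ ≤ M + 1 := by
      have h2 := (hw T hT).eventually (by norm_num)
      have h3 := (hc T hT).norm.eventually (gt_mem_nhds (lt_of_le_of_lt (hM T hT) (lt_add_one M)))
      filter_upwards [h2, h3] with z hz1 hz2
      exact ⟨hz1.differentiableAt two_ne_zero, le_of_lt hz2⟩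
    exact (hcons.tendsto (0, T)).eventually h1
  obtain ⟨ρ, hρ, hb⟩ := Metric.eventually_nhds_iff_ball.1 hev
  exact ⟨M + 1, ρ, hρ, fun T hT x hx => hb x (mem_ball_zero_iff.2 hx) T hT⟩

/-- The differential of a `C²` function is bounded in a neighbourhood of the south pole. -/
theorem exists_framed_bound {u : ℝ × S3 → ℝ} {T₁ : ℝ}
    (hu : ∀ T ∈ Icc 0 T₁, IsCkAt 2 u (param (-1) (Fin.cons T 0))) :
    ∃ M r : ℝ, ∀ y : Fin 4 → ℝ, 0 ≤ y 0 → y 0 ≤ T₁ → r ≤ rsq (Fin.tail y) →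
      ∑ k, framed (u ∘ param 1) y k ^ 2 ≤ M := by
  obtain ⟨M, ρ, hρ, hM⟩ := exists_fderiv_bound (w := u ∘ param (-1)) (T₁ := T₁)
    fun T hT => (hu T hT).contDiffAt
  -- `|x|² ≥ 4/ρ²` puts the inverted point within `ρ` of the origin. `|x|² ≥ 1` gives `1/|x|² ≤ conf
  -- x`, so each of the four framed derivatives is at most `3M`.
  refine ⟨4 * (3 * M) ^ 2, max 1 (4 / ρ ^ 2), fun y h0 hT hr => ?_⟩
  have hq1 : 1 ≤ rsq (Fin.tail y) := (le_max_left _ _).trans hr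
  have hq2 : 4 / ρ ^ 2 ≤ rsq (Fin.tail y) := (le_max_right _ _).trans hr
  have hq0 : 0 < rsq (Fin.tail y) := by linarith
  have hy : Fin.tail y ≠ 0 := by
    rintro h
    rw [h] at hq0
    simp [rsq] at hq0
  have hnorm : ‖(rsq (Fin.tail y))⁻¹ • Fin.tail y‖ < ρ := by
    refine (pi_norm_lt_iff hρ).2 fun i => ?_
    have hi := abs_le_sqrt_rsq (Fin.tail y) i
    have hs0 : 0 < Real.sqrt (rsq (Fin.tail y)) := Real.sqrt_pos.2 hq0
    have hsq := Real.mul_self_sqrt hq0.le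
    rw [Pi.smul_apply, smul_eq_mul, Real.norm_eq_abs, abs_mul, abs_of_pos (inv_pos.2 hq0),
      inv_mul_lt_iff₀ hq0]
    have h2 : 2 / ρ ≤ Real.sqrt (rsq (Fin.tail y)) := by
      refine Real.le_sqrt_of_sq_le ?_
      rw [div_pow]; norm_num; exact hq2
    rw [div_le_iff₀ hρ] at h2
    nlinarith
  obtain ⟨hd, hfd⟩ := hM (y 0) ⟨h0, hT⟩ _ hnorm
  obtain ⟨D, hD, hD0, hDs⟩ := exists_hasFDerivAt_inversion hy
  have hM0 : 0 ≤ M := (norm_nonneg _).trans hfd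
  have heq : u ∘ param 1 =ᶠ[𝓝 y] (u ∘ param (-1)) ∘ inversion := by
    have hcont : Continuous (Fin.tail : (Fin 4 → ℝ) → Fin 3 → ℝ) :=
      (contDiff_tail (n := 0)).continuous
    filter_upwards [hcont.continuousAt.eventually_ne hy] with z hz
    rw [Function.comp_apply, Function.comp_apply, Function.comp_apply, param_inversion hz]
  have hpd : ∀ j, |pd j (u ∘ param 1) y| ≤ M * ‖D (Pi.single j 1)‖ := fun j => by
    rw [pd_congr heq]
    unfold pd
    rw [(HasFDerivAt.comp y (hd.hasFDerivAt : HasFDerivAt _ _ (inversion y)) hD).fderiv,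
      ← Real.norm_eq_abs]
    rw [ContinuousLinearMap.comp_apply]
    exact (ContinuousLinearMap.le_opNorm _ _).trans
      (mul_le_mul_of_nonneg_right hfd (norm_nonneg _))
  have hfr : ∀ k, framed (u ∘ param 1) y k ^ 2 ≤ (3 * M) ^ 2 := fun k => by
    have habs : |framed (u ∘ param 1) y k| ≤ 3 * M := by
      refine Fin.cases ?_ (fun j => ?_) k
      · rw [framed_zero]
        have := (hpd 0).trans (mul_le_mul_of_nonneg_left hD0 hM0)
        linarith
      · unfold framed
        rw [scale_succ, abs_div, abs_of_pos (conf_pos _), div_le_iff₀ (conf_pos _)]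
        refine ((hpd j.succ).trans (mul_le_mul_of_nonneg_left (hDs j) hM0)).trans ?_
        have h3 : 1 / rsq (Fin.tail y) ≤ conf (Fin.tail y) := by
          unfold conf
          rw [div_le_div_iff₀ hq0 (one_add_rsq_pos _)]
          linarith
        calc M * (3 / rsq (Fin.tail y)) = 3 * M * (1 / rsq (Fin.tail y)) := by ring
          _ ≤ _ := by gcongr
    rw [← sq_abs]
    exact pow_le_pow_left₀ (abs_nonneg _) habs 2
  calc _ ≤ ∑ _k : Fin 4, (3 * M) ^ 2 := Finset.sum_le_sum fun k _ => hfr k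
    _ = _ := by simp

end

section

open Set Filter Topology MeasureTheory

variable {φ : S2 → ℝ}

/-! ### The coordinate form of the mixed problem -/

theorem dens_densInv_hat (h : TensorField) :
    dens (fun y => densInv (hat h y)) = fun y => densInv (comp 1 h y) := by
  funext y
  ext j k
  rw [densInv_comp]
  rfl

theorem param_south (T : ℝ) : ((param (-1) (Fin.cons T 0)).2 : EuclideanSpace ℝ (Fin 4)) 0 = -1 := by
  change stereoVec (-1) (Fin.tail (Fin.cons T 0 : Fin 4 → ℝ)) 0 = -1
  rw [Fin.tail_cons, stereoVec_zero]
  simp [rsq]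

theorem InRegion.mem (hφ : ∀ θ, 0 < φ θ) {y : Fin 4 → ℝ} (hy : InRegion φ y) :
    param 1 y ∈ domainY φ ∪ boundaryY φ := by
  rcases hy.2.2.lt_or_eq with h | h
  · exact Or.inl ((param_mem_domainY_iff hφ y).2 ⟨⟨hy.1, hy.2.1⟩, h⟩)
  · exact Or.inr (param_mem_boundaryY hφ hy.1 hy.2.1 h.symm)

/-- Closeness to the Minkowski metric extends from the domain to the lateral boundary. -/
theorem InRegion.abs_hat_sub_le (hφ : ∀ θ, 0 < φ θ) {h : TensorField} {δ : ℝ}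
    (hh : ∀ p ∈ domainY φ ∪ boundaryY φ, IsCkAt 1 h p) (hδ : ∀ p ∈ domainY φ, IsCloseAt δ h p)
    {y : Fin 4 → ℝ} (hy : InRegion φ y) (i j : Fin 4) :
    |hat h y i j - Matrix.diagonal mink i j| ≤ δ := by
  rcases hy.2.2.lt_or_eq with hΨ | hΨ
  · exact EinsteinWave.abs_hat_sub_le
      (hδ _ ((param_mem_domainY_iff hφ y).2 ⟨⟨hy.1, hy.2.1⟩, hΨ⟩)) i j
  · have hc : ContinuousAt (fun z => |hat h z i j - Matrix.diagonal mink i j|) y :=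
      ((differentiableAt_hat (hh _ (hy.mem hφ)) i j).continuousAt.sub continuousAt_const).abs
    refine le_of_tendsto_of_frequently hc ?_
    refine (frequently_Psi_pos hφ (tail_ne_zero_of_nonneg hy.1 hy.2.1 hy.2.2) hΨ.symm).mono ?_
    rintro z ⟨hz0, hz⟩
    refine EinsteinWave.abs_hat_sub_le (hδ _ ((param_mem_domainY_iff hφ z).2 ⟨?_, hz⟩)) i j
    rw [hz0]
    exact ⟨hy.1, hy.2.1⟩

/-- The conformal weights are independent of `T`, so `∂_T` falls on `densInv (hat h)` alone. The
constant is `½ · 4 · L`, with `4` from `abs_bilin_le`. -/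
theorem abs_deform_le {h : TensorField} {v : (Fin 4 → ℝ) → ℝ} {y : Fin 4 → ℝ} {L : ℝ}
    (hh : IsCkAt 1 h (param 1 y)) (hdet : (hat h y).det ≠ 0)
    (hL : ∀ j k, ‖fderiv ℝ (fun M : Fin 4 → Fin 4 → ℝ => densInv (Matrix.of M) j k)
      (fun a b => hat h y a b)‖ ≤ L) :
    |deform (dens fun y => densInv (hat h y)) v y|
      ≤ 2 * L * nablaNorm (h - eta) (param 1 y) * edens v y := by
  set q : (Fin 4 → ℝ) → Matrix (Fin 4) (Fin 4) ℝ := fun y => densInv (hat h y) with hq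
  let q' : (Fin 4 → ℝ) → Matrix (Fin 4) (Fin 4) ℝ :=
    fun y => Matrix.of fun j k => pd 0 (fun z => q z j k) y
  have hpd : ∀ k l, pd 0 (fun z => dens q z k l) y = dens q' y k l := fun k l => by
    have hc : ContDiff ℝ 1 fun z : Fin 4 → ℝ =>
        conf (Fin.tail z) ^ 3 / (scale z k * scale z l) :=
      ((contDiff_conf.comp contDiff_tail).pow 3).div ((contDiff_scale k).mul (contDiff_scale l))
        fun z => (mul_pos (scale_pos z k) (scale_pos z l)).ne'
    have h1 : (fun z => dens q z k l)
        = fun z => q z k l * (conf (Fin.tail z) ^ 3 / (scale z k * scale z l)) := by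
      funext z
      simp only [dens, Matrix.of_apply]; ring
    rw [h1, pd_zero_mul_tail ((contDiffAt_densInv_hat hh hdet k l).differentiableAt one_ne_zero)
      (hc.differentiable one_ne_zero y)]
    · simp only [dens, q', Matrix.of_apply]; ring
    · refine pd_zero_of_tail _ (fun x => conf x ^ 3 / ((if k = 0 then 1 else conf x)
        * (if l = 0 then 1 else conf x))) (fun z => rfl) y
  have hN : 0 ≤ nablaNorm (h - eta) (param 1 y) := Real.sqrt_nonneg _
  have hb := abs_bilin_le (N := fun k l => q' y k l)
    (fun k l => abs_pd_densInv_hat_le hh hdet k l (hL k l)) (framed v y)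
  unfold deform
  simp only [hpd]
  rw [dens_bilin, abs_neg, abs_mul, abs_mul, abs_of_pos (pow_pos (conf_pos _) 3),
    abs_of_pos (by norm_num : (0 : ℝ) < 1 / 2)]
  unfold edens
  have hc := (pow_pos (conf_pos (Fin.tail y)) 3).le
  calc _ ≤ 1 / 2 * (conf (Fin.tail y) ^ 3 * (4 * (L * nablaNorm (h - eta) (param 1 y))
        * ∑ k, framed v y k ^ 2)) := by gcongr; exact hb
    _ = _ := by ring

/-- The source is `|h|^{1/2} □_h u = λ³ |det (hat h)|^{1/2} □_h u`; squaring and dividing by `λ³`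
leaves the volume density times `(□_h u)²` and a determinant factor at most `4`. -/
theorem abs_source_div_le {h : TensorField} {u : ℝ × S3 → ℝ} {y : Fin 4 → ℝ}
    (hdet : (hat h y).det ≠ 0) (hs : Real.sqrt |(hat h y).det| ≤ 2) :
    (|source (dens fun y => densInv (hat h y)) (u ∘ param 1) y|
      / Real.sqrt (conf (Fin.tail y) ^ 3)) ^ 2
      ≤ 4 * (conf (Fin.tail y) ^ 3 * dAlembertian h u (param 1 y) ^ 2) := by
  have hc := pow_pos (conf_pos (Fin.tail y)) 3
  rw [dens_densInv_hat]
  unfold source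
  rw [sum_pd_densInv_mul (det_comp_ne_zero hdet), ← dAlembertian_param, sqrt_det_comp, div_pow,
    sq_abs, Real.sq_sqrt hc.le, div_le_iff₀ hc]
  have h4 : Real.sqrt |(hat h y).det| ^ 2 ≤ 4 := by
    have := Real.sqrt_nonneg |(hat h y).det|
    nlinarith
  calc _ = Real.sqrt |(hat h y).det| ^ 2 * ((conf (Fin.tail y) ^ 3) ^ 2
        * dAlembertian h u (param 1 y) ^ 2) := by ring
    _ ≤ 4 * ((conf (Fin.tail y) ^ 3) ^ 2 * dAlembertian h u (param 1 y) ^ 2) := by gcongr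
    _ = _ := by ring

theorem waveData_of_close (hφ : ∀ θ, 0 < φ θ) {h : TensorField} {u : ℝ × S3 → ℝ} {κ δ : ℝ}
    (hκ : ∀ M : Fin 4 → Fin 4 → ℝ, (∀ i j, |M i j - Matrix.diagonal mink i j| ≤ δ) →
      (Matrix.of M).det ≠ 0 ∧ ∀ j k, |densInv (Matrix.of M) j k - Matrix.diagonal mink j k| ≤ κ)
    (hh : ∀ p ∈ domainY φ ∪ boundaryY φ, IsCkAt 1 h p ∧ IsLorentzianAt h p)
    (hδ : ∀ p ∈ domainY φ, IsCloseAt δ h p)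
    (hu : ∀ p ∈ domainY φ ∪ boundaryY φ, IsCkAt 2 u p) (hu0 : ∀ p ∈ boundaryY φ, u p = 0) :
    WaveData φ κ (fun y => densInv (hat h y)) (u ∘ param 1) where
  contDiffAt_q y hy j k := contDiffAt_densInv_hat (hh _ (hy.mem hφ)).1
    (hκ _ (hy.abs_hat_sub_le hφ (fun p hp => (hh p hp).1) hδ)).1 j k
  contDiffAt_v y hy := (hu _ (hy.mem hφ)).contDiffAt
  isSymm y hy := by
    refine isSymm_densInv ?_
    ext i j
    have := (isSymm_comp (hh _ (hy.mem hφ)).2).apply i j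
    simp only [Matrix.transpose_apply, hat, Matrix.of_apply, this, mul_comm (scale y i)]
  close y hy := (hκ _ (hy.abs_hat_sub_le hφ (fun p hp => (hh p hp).1) hδ)).2
  boundary y h0 hπ hΨ := hu0 _ (param_mem_boundaryY hφ h0 hπ hΨ)
  bounded T hT := exists_framed_bound fun t ht => hu _ (Or.inl (mem_domainY_of_south _ ht.1
    (ht.2.trans_lt hT) (param_south t)))

/-- The energy estimate for the mixed problem in the exterior of the obstacle. -/
theorem energy_estimate (φ : S2 → ℝ)
    (hφ : ContMDiff (𝓡 2) 𝓘(ℝ, ℝ) ∞ φ) (hφ_pos : ∀ θ, 0 < φ θ) :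
    ∃ δ : ℝ, 0 < δ ∧ ∀ C₀ : ℝ≥0, ∃ C : ℝ≥0,
      ∀ (h : TensorField) (u F : ℝ × S3 → ℝ),
        (∀ p ∈ domainY φ ∪ boundaryY φ,
          IsCkAt 1 h p ∧ IsLorentzianAt h p) →
        (∀ p ∈ domainY φ, IsCloseAt δ h p) →
        (∫⁻ T in Set.Ico 0 Real.pi,
          normSlice φ ⊤ (nablaNorm (h - eta)) T
            ≤ (C₀ : ENNReal)) →
        (∀ p ∈ domainY φ ∪ boundaryY φ, IsCkAt 2 u p) →
        (∀ p ∈ domainY φ, dAlembertian h u p = F p) →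
        (∀ p ∈ boundaryY φ, u p = 0) →
        ∀ T : ℝ, 0 < T → T < Real.pi →
          normSlice φ 2 (gradNorm u) T
            ≤ C * normSlice φ 2 (gradNorm u) 0
              + C * ∫⁻ S in Set.Ioc 0 T, normSlice φ 2 F S := by
  obtain ⟨μ, hμ, hμφ⟩ := exists_le_radialGauge hφ.continuous hφ_pos
  -- The first entry gives coercivity of the energy, the second the sign of the boundary flux. Both
  -- depend only on the obstacle, hence so do `δ` and `L`.
  set κ := min (1 / 18) (μ ^ 2 / (4 * (μ ^ 2 + 2))) with hκdef
  have hκ0 : 0 < κ := by positivity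
  have hκ1 : κ ≤ 1 / 18 := min_le_left _ _
  have hκ : 4 * κ * (μ ^ 2 + 2) ≤ μ ^ 2 := by
    have h1 : κ ≤ μ ^ 2 / (4 * (μ ^ 2 + 2)) := min_le_right _ _
    rw [le_div_iff₀ (by positivity)] at h1
    linarith
  obtain ⟨δ, L, hδ, hL, hM⟩ := exists_densInv_bounds hκ0
  refine ⟨δ, hδ, fun C₀ => ?_⟩
  set K := 2 * Real.exp (2 * (2 * L * C₀)) with hK
  have hK0 : 0 < K := by positivity
  -- The extra factor `2` comes from `|det (hat h)|^{1/2} ≤ 2` in the source term.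
  refine ⟨Real.toNNReal (2 * K), fun h u F hh hclose hN hu hF hu0 T hT0 hT => ?_⟩
  have hD := waveData_of_close hφ_pos (fun M hMδ => ⟨(hM M hMδ).1, fun j k => ((hM M hMδ).2.2 j k).1⟩)
    hh hclose hu hu0
  have hIcc : ∀ t ∈ Icc 0 T, 0 ≤ t ∧ t < Real.pi := fun t ht => ⟨ht.1, ht.2.trans_lt hT⟩
  have hreg : ∀ t ∈ Icc 0 T, ∀ x ∈ slice φ t, InRegion φ (Fin.cons t x) := fun t ht x hx =>
    ⟨(hIcc t ht).1, (hIcc t ht).2, le_of_lt hx⟩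
  have hbd := fun t (ht : t ∈ Icc 0 T) x (hx : x ∈ slice φ t) =>
    hM _ ((hreg t ht x hx).abs_hat_sub_le hφ_pos (fun p hp => (hh p hp).1) hclose)
  have hA : ∀ t ∈ Icc 0 T, ∀ᵐ x : Fin 3 → ℝ, x ∈ slice φ t →
      ENNReal.ofReal |deform (dens fun y => densInv (hat h y)) (u ∘ param 1) (Fin.cons t x)|
        ≤ ENNReal.ofReal (2 * L) * normSlice φ ⊤ (nablaNorm (h - eta)) t
          * ENNReal.ofReal (edens (u ∘ param 1) (Fin.cons t x)) := by
    intro t ht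
    filter_upwards [ae_le_normSlice_top hφ hφ_pos (hIcc t ht).1 (hIcc t ht).2
      (nablaNorm (h - eta))] with x hx hxs
    obtain ⟨h1, -, h2⟩ := hbd t ht x hxs
    have h3 := abs_deform_le (v := u ∘ param 1)
      (hh _ ((hreg t ht x hxs).mem hφ_pos)).1 h1 fun j k => (h2 j k).2
    have hN0 : 0 ≤ nablaNorm (h - eta) (param 1 (Fin.cons t x)) := Real.sqrt_nonneg _
    refine (ENNReal.ofReal_le_ofReal h3).trans ?_
    rw [ENNReal.ofReal_mul (by positivity), ENNReal.ofReal_mul (by positivity)]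
    have h4 := hx hxs
    rw [Real.enorm_eq_ofReal hN0] at h4
    gcongr
  have hAint : ∫⁻ t in Ioc 0 T, ENNReal.ofReal (2 * L) * normSlice φ ⊤ (nablaNorm (h - eta)) t
      ≤ ENNReal.ofReal (2 * L * C₀) := by
    rw [lintegral_const_mul' _ _ ENNReal.ofReal_ne_top, ENNReal.ofReal_mul (p := 2 * L) (by positivity),
      ENNReal.ofReal_coe_nnreal]
    gcongr
    refine le_trans (lintegral_mono_set fun t ht => ?_) hN
    exact ⟨ht.1.le, ht.2.trans_lt hT⟩
  have hB : ∀ t ∈ Icc 0 T, (∫⁻ x in slice φ t,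
      ENNReal.ofReal (|source (dens fun y => densInv (hat h y)) (u ∘ param 1) (Fin.cons t x)|
        / Real.sqrt (conf x ^ 3)) ^ (2 : ℝ)) ^ (1 / 2 : ℝ) ≤ 2 * normSlice φ 2 F t := by
    intro t ht
    have h4 : (2 : ENNReal) = (4 : ENNReal) ^ (1 / 2 : ℝ) := by
      rw [show (4 : ENNReal) = 2 ^ (2 : ℝ) by norm_num, ← ENNReal.rpow_mul]; norm_num
    rw [normSlice_two hφ hφ_pos (hIcc t ht).1 (hIcc t ht).2, h4,
      ← ENNReal.mul_rpow_of_nonneg _ _ (by norm_num), ← lintegral_const_mul' _ _ (by norm_num)]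
    refine ENNReal.rpow_le_rpow (setLIntegral_mono' (isOpen_slice hφ hφ_pos t).measurableSet
      fun x hx => ?_) (by norm_num)
    obtain ⟨h1, h2, -⟩ := hbd t ht x hx
    have h3 := abs_source_div_le (u := u) h1 h2
    rw [hF _ ((param_mem_domainY_iff hφ_pos _).2 ⟨hIcc t ht, hx⟩), Fin.tail_cons] at h3
    rw [ENNReal.ofReal_rpow_of_nonneg (by positivity) (by norm_num), Real.rpow_two,
      ← ENNReal.ofReal_ofNat, ← ENNReal.ofReal_mul (by norm_num)]
    exact ENNReal.ofReal_le_ofReal h3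
  have hmain := hD.energy_le hφ hφ_pos hμ hμφ hκ0.le hκ1 hκ hT0 hT (by positivity) hA hAint hB
  rw [normSlice_gradNorm hφ hφ_pos hT0.le hT, normSlice_gradNorm hφ hφ_pos le_rfl Real.pi_pos]
  refine hmain.trans ?_
  rw [← mul_add, lintegral_const_mul' _ _ (by norm_num)]
  calc _ ≤ ENNReal.ofReal K * (2 * _ + 2 * _) := by
        gcongr
        exact le_mul_of_one_le_left' one_le_two
    _ = _ := by
        rw [← mul_add, ← mul_assoc, mul_comm (ENNReal.ofReal K) 2, ← ENNReal.ofReal_ofNat 2,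
          ← ENNReal.ofReal_mul two_pos.le]
        rfl

end

end EinsteinWave

end

theorem theorem3p2 (φ : EinsteinWave.S2 → ℝ)
    (hφ : ContMDiff (𝓡 2) 𝓘(ℝ, ℝ) ∞ φ) (hφ_pos : ∀ θ, 0 < φ θ) :
    ∃ δ : ℝ, 0 < δ ∧ ∀ C₀ : ℝ≥0, ∃ C : ℝ≥0,
      ∀ (h : EinsteinWave.TensorField) (u F : ℝ × EinsteinWave.S3 → ℝ),
        -- `h` is a Lorentzian metric on `Y`, of class `C¹` up to `∂Y`
        (∀ p ∈ EinsteinWave.domainY φ ∪ EinsteinWave.boundaryY φ,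
          EinsteinWave.IsCkAt 1 h p ∧ EinsteinWave.IsLorentzianAt h p) →
        -- `h` is `δ`-close to `η`
        (∀ p ∈ EinsteinWave.domainY φ, EinsteinWave.IsCloseAt δ h p) →
        -- the norm of `∇(h - η)` in `L¹_T L^∞_X` is at most `C₀`
        (∫⁻ T in Set.Ico 0 Real.pi,
          EinsteinWave.normSlice φ ⊤ (EinsteinWave.nablaNorm (h - EinsteinWave.eta)) T
            ≤ (C₀ : ENNReal)) →
        -- `u` is of class `C²` on `Y`, up to `∂Y`
        (∀ p ∈ EinsteinWave.domainY φ ∪ EinsteinWave.boundaryY φ, EinsteinWave.IsCkAt 2 u p) →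
        (∀ p ∈ EinsteinWave.domainY φ, EinsteinWave.dAlembertian h u p = F p) →
        (∀ p ∈ EinsteinWave.boundaryY φ, u p = 0) →
        ∀ T : ℝ, 0 < T → T < Real.pi →
          EinsteinWave.normSlice φ 2 (EinsteinWave.gradNorm u) T
            ≤ C * EinsteinWave.normSlice φ 2 (EinsteinWave.gradNorm u) 0
              + C * ∫⁻ S in Set.Ioc 0 T, EinsteinWave.normSlice φ 2 F S := by
  exact EinsteinWave.energy_estimate φ hφ hφ_pos
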